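/- **Setting.** For $\alpha>0$ let $h_\alpha=-\Delta-\frac{\alpha}{|x|}$ be the (self-adjoint) hydrogen Hamiltonian on $L^2(\mathbb R^3)$ with domain $H^2(\mathbb R^3)$, with ground state $u_\alpha(x)=\frac{\alpha^{3/2}}{\sqrt{8\pi}}e^{-\alpha|x|/2}$ and ground state energy $e_\alpha=-\frac{\alpha^2}{4}$; write $h_1,e_1,u_1$ for $\alpha=1$. For functions $\varphi$ of the operator $h_\beta$ (Borel functional calculus) put $\langle xu_\alpha|\varphi(h_\beta)|xu_\alpha\rangle=\sum_{j=1}^3\langle x_ju_\alpha|\varphi(h_\beta)|x_ju_\alpha\rangle_{L^2(\mathbb R^3)}$. Fix $\Lambda>0$ and a smooth function $\chi$ on $(0,\infty)$ with values in $[0,1]$, $\chi(r)=1$ for $r<\frac12$ and $\chi(r)=0$ for $r>1$, and let $\chi_\Lambda(k)=\chi(|k|/\Lambda)$. For $L>1$ put $y=L\alpha^{-1}$ and, with $\hat k=k/|k|$, $$f_y(k)=\frac{1}{2\pi^2}\,\frac{\chi_\Lambda(k)^2}{|k|}\,\bigl(-1-\hat k_1^2+\hat k_2^2+\hat k_3^2\bigr)\cos(2k_1y),\qquad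 k\in\mathbb R^3,$$ $$\aleph_{\alpha,L}=\frac{1}{6\pi}\Bigl\langle xu_1\Bigl|\,\alpha L\arctan\Bigl(\frac{1}{\alpha L(h_1-e_1)}\Bigr)\Bigr|xu_1\Bigr\rangle .$$ **Proposition B.2.** There exist $\alpha_0\in(0,1)$ and $C>0$, depending only on $\chi$ and $\Lambda$, such that for all $0<\alpha\le\alpha_0$ and all $L>1$ the function $k\mapsto f_y(k)\,\bigl\langle xu_\alpha\bigl|\frac{(h_\alpha-e_\alpha)|k|}{3(h_\alpha-e_\alpha+|k|)}\bigr|xu_\alpha\bigr\rangle$ is integrable on $\mathbb R^3$ and $$\left|\alpha\int_{\mathbb R^3}f_y(k)\,\Bigl\langle xu_\alpha\Bigl|\frac{(h_\alpha-e_\alpha)|k|}{3(h_\alpha-e_\alpha+|k|)}\Bigr|xu_\alpha\Bigr\rangle\,dk-\Bigl(\frac{\alpha^2}{L^3}-\aleph_{\alpha,L}\frac{\alpha}{L^4}\Bigr)\right|\le C\,\frac{\alpha^3}{L^2}\log(\alpha^{-1}).$$ -/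

import Mathlib

open MeasureTheory Set
open scoped ContDiff InnerProductSpace

noncomputable section

namespace CasimirPolder

/-! ### The Hilbert space and the hydrogen Hamiltonian -/

/-- Physical (and momentum) space `ℝ³` with its Euclidean norm. -/
abbrev R3 : Type := EuclideanSpace ℝ (Fin 3)

/-- The Hilbert space `L²(ℝ³; ℂ)`. -/
abbrev L2R3 : Type := Lp ℂ 2 (volume : Measure R3)

/-- The embedding of `L²(ℝ³)` into the tempered distributions. -/
abbrev toDistribution : L2R3 →L[ℂ] TemperedDistribution R3 ℂ :=
  Lp.toTemperedDistributionCLM ℂ (volume : Measure R3) 2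

lemma toDistribution_injective : Function.Injective toDistribution :=
  LinearMap.ker_eq_bot.1
    (Lp.ker_toTemperedDistributionCLM_eq_bot (E := R3) (F := ℂ) (μ := volume) (p := 2))

/-- The Sobolev space `H²(ℝ³)` as a subspace of `L²(ℝ³)`. -/
def sobolevTwo : Submodule ℂ L2R3 where
  carrier := {ψ | TemperedDistribution.MemSobolev 2 2 (toDistribution ψ)}
  add_mem' := by
    intro a b ha hb
    rw [Set.mem_ofPred_eq, map_add]
    exact TemperedDistribution.MemSobolev.add ha hb
  zero_mem' := by
    rw [Set.mem_ofPred_eq, map_zero]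
    exact TemperedDistribution.memSobolev_fun_zero R3 ℂ 2 2
  smul_mem' := by
    intro c a ha
    rw [Set.mem_ofPred_eq, map_smul]
    exact TemperedDistribution.MemSobolev.smul c ha

lemma exists_laplacian (ψ : sobolevTwo) :
    ∃ g : L2R3, Laplacian.laplacian (toDistribution ψ.1) = toDistribution g := by
  have h := TemperedDistribution.MemSobolev.laplacian ψ.2
  rw [sub_self] at h
  exact TemperedDistribution.memSobolev_zero_iff.1 h

/-- The distributional Laplacian `Δψ ∈ L²(ℝ³)` of `ψ ∈ H²(ℝ³)`. -/
def laplacianL2 (ψ : sobolevTwo) : L2R3 := (exists_laplacian ψ).choose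

lemma laplacianL2_spec (ψ : sobolevTwo) :
    toDistribution (laplacianL2 ψ) =
      LineDeriv.laplacianCLM ℂ R3 (TemperedDistribution R3 ℂ)
        (toDistribution ψ.1) := by
  rw [TemperedDistribution.laplacianCLM_apply]
  exact (exists_laplacian ψ).choose_spec.symm

/-- The self-adjoint operator `-Δ` on `L²(ℝ³)` with domain `H²(ℝ³)`. -/
def negLaplacian : L2R3 →ₗ.[ℂ] L2R3 where
  domain := sobolevTwo
  toFun :=
    { toFun := fun ψ => -laplacianL2 ψ
      map_add' := by
        intro a b
        rw [← neg_add]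
        refine congrArg _ (toDistribution_injective ?_)
        rw [map_add, laplacianL2_spec, laplacianL2_spec, laplacianL2_spec, ← map_add, ← map_add]
        rfl
      map_smul' := by
        intro c a
        rw [RingHom.id_apply, smul_neg]
        refine congrArg _ (toDistribution_injective ?_)
        rw [map_smul, laplacianL2_spec, laplacianL2_spec, ← map_smul, ← map_smul]
        rfl }

/-- The maximal domain `{ψ ∈ L²(ℝ³) | V ψ ∈ L²(ℝ³)}` of the multiplication by `V`. -/
def mulDomain (V : R3 → ℝ) : Submodule ℂ L2R3 where
  carrier := {ψ | MemLp (fun x => (V x : ℂ) * ψ x) 2 volume}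
  add_mem' := by
    intro a b ha hb
    refine (MemLp.add ha hb).ae_eq ?_
    filter_upwards [Lp.coeFn_add a b] with x hx
    rw [hx, Pi.add_apply, Pi.add_apply, mul_add]
  zero_mem' := by
    refine (MemLp.zero' (p := 2) (μ := (volume : Measure R3)) (ε := ℂ)).ae_eq ?_
    filter_upwards [Lp.coeFn_zero ℂ 2 (volume : Measure R3)] with x hx
    rw [hx, Pi.zero_apply, mul_zero]
  smul_mem' := by
    intro c a ha
    refine (MemLp.const_smul ha c).ae_eq ?_
    filter_upwards [Lp.coeFn_smul c a] with x hx
    rw [hx, Pi.smul_apply, Pi.smul_apply, smul_eq_mul, smul_eq_mul, mul_left_comm]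

lemma mem_mulDomain {V : R3 → ℝ} {ψ : L2R3} :
    ψ ∈ mulDomain V ↔ MemLp (fun x => (V x : ℂ) * ψ x) 2 volume := Iff.rfl

/-- The multiplication operator by a real function `V` on `L²(ℝ³)`, with its maximal domain. -/
def mulOperator (V : R3 → ℝ) : L2R3 →ₗ.[ℂ] L2R3 where
  domain := mulDomain V
  toFun :=
    { toFun := fun ψ => MemLp.toLp (fun x => (V x : ℂ) * ψ.1 x) (mem_mulDomain.1 ψ.2)
      map_add' := by
        intro a b
        rw [← MemLp.toLp_add]
        apply MemLp.toLp_congr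
        filter_upwards [Lp.coeFn_add a.1 b.1] with x hx
        rw [Pi.add_apply, Submodule.coe_add, hx, Pi.add_apply, mul_add]
      map_smul' := by
        intro c a
        rw [RingHom.id_apply, ← MemLp.toLp_const_smul]
        apply MemLp.toLp_congr
        filter_upwards [Lp.coeFn_smul c a.1] with x hx
        rw [Pi.smul_apply, Submodule.coe_smul, hx, Pi.smul_apply, smul_eq_mul, smul_eq_mul,
          mul_left_comm] }

/-- The hydrogen Hamiltonian `h_α = -Δ - α / |x|` on `L²(ℝ³)`, the sum of the two operators on
`D(-Δ) ∩ D(1 / |x|)`. By Hardy's inequality this is `D(-Δ) = H²(ℝ³)`. -/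
def hydrogen (α : ℝ) : L2R3 →ₗ.[ℂ] L2R3 :=
  negLaplacian - (α : ℂ) • mulOperator (fun x => ‖x‖⁻¹)

/-- The ground state energy `e_α = -α² / 4` of `h_α`. -/
def groundEnergy (α : ℝ) : ℝ := -α ^ 2 / 4

/-- The ground state `u_α(x) = α^{3/2} (8π)^{-1/2} e^{-α|x|/2}` of `h_α`. -/
def groundState (α : ℝ) (x : R3) : ℝ :=
  α ^ (3 / 2 : ℝ) / Real.sqrt (8 * Real.pi) * Real.exp (-α * ‖x‖ / 2)

lemma memLp_position_mul_groundState {α : ℝ} (hα : 0 < α) (j : Fin 3) :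
    MemLp (fun x : R3 => ((x j * groundState α x : ℝ) : ℂ)) 2 volume := by
  have hcont : Continuous (fun x : R3 => ((x j * groundState α x : ℝ) : ℂ)) := by
    unfold groundState
    fun_prop
  rw [memLp_two_iff_integrable_sq_norm hcont.aestronglyMeasurable]
  have hrad : Integrable (fun x : R3 => (fun r : ℝ => r ^ 2 * Real.exp (-α * r)) ‖x‖) volume := by
    rw [integrable_fun_norm_addHaar volume (f := fun r : ℝ => r ^ 2 * Real.exp (-α * r))]
    have h := integrableOn_rpow_mul_exp_neg_mul_rpow (p := 1) (s := 4) (b := α)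
      (by norm_num) (by norm_num) hα
    refine h.congr_fun ?_ measurableSet_Ioi
    intro r hr
    have h4 : r ^ (4 : ℝ) = r ^ 4 := by exact_mod_cast Real.rpow_natCast r 4
    simp only [finrank_euclideanSpace, Fintype.card_fin, smul_eq_mul, Real.rpow_one, h4]
    ring
  refine (hrad.const_mul ((α ^ (3 / 2 : ℝ) / Real.sqrt (8 * Real.pi)) ^ 2)).mono'
    (hcont.norm.pow 2).aestronglyMeasurable ?_
  filter_upwards with x
  have hx : (x j) ^ 2 ≤ ‖x‖ ^ 2 := by
    rw [← sq_abs, ← Real.norm_eq_abs]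
    exact pow_le_pow_left₀ (norm_nonneg _) (PiLp.norm_apply_le x j) 2
  have he : Real.exp (-α * ‖x‖) = Real.exp (-α * ‖x‖ / 2) ^ 2 := by
    rw [← Real.exp_nat_mul]
    congr 1
    push_cast
    ring
  rw [Complex.norm_real, Real.norm_eq_abs, Real.norm_eq_abs, abs_of_nonneg (by positivity),
    sq_abs]
  unfold groundState
  simp only [he]
  calc (x j * (α ^ (3 / 2 : ℝ) / Real.sqrt (8 * Real.pi) * Real.exp (-α * ‖x‖ / 2))) ^ 2
      = (α ^ (3 / 2 : ℝ) / Real.sqrt (8 * Real.pi)) ^ 2 *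
          ((x j) ^ 2 * Real.exp (-α * ‖x‖ / 2) ^ 2) := by ring
    _ ≤ _ := by gcongr

/-- The `j`-th component `x_j u_α` of the vector `x u_α ∈ L²(ℝ³) ⊗ ℂ³`. -/
def positionGroundState (α : ℝ) (hα : 0 < α) (j : Fin 3) : L2R3 :=
  (memLp_position_mul_groundState hα j).toLp

/-! ### Functional calculus of an unbounded self-adjoint operator -/

/-- `μ` is the spectral measure of the self-adjoint operator `T` in the vector `v`: a finite
measure on `ℝ` with `⟨v, (T - z)⁻¹ v⟩ = ∫ (t - z)⁻¹ dμ(t)` for all non-real `z`. -/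
def IsSpectralMeasure {H : Type*} [NormedAddCommGroup H] [InnerProductSpace ℂ H]
    (T : H →ₗ.[ℂ] H) (v : H) (μ : Measure ℝ) : Prop :=
  IsFiniteMeasure μ ∧ ∀ z : ℂ, z.im ≠ 0 →
    ∃ w : T.domain, T w - z • (w : H) = v ∧ ⟪v, (w : H)⟫_ℂ = ∫ t : ℝ, ((t : ℂ) - z)⁻¹ ∂μ

open Classical in
/-- The spectral measure `μ_v(B) = ⟨v, 1_B(T) v⟩` of `T` in the vector `v`. For self-adjoint `T`
it exists by the spectral theorem and it is unique, because a finite measure on `ℝ` is determined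
by its Cauchy-Stieltjes transform. -/
def spectralMeasure {H : Type*} [NormedAddCommGroup H] [InnerProductSpace ℂ H]
    (T : H →ₗ.[ℂ] H) (v : H) : Measure ℝ :=
  if h : ∃ μ : Measure ℝ, IsSpectralMeasure T v μ then h.choose else 0

/-- The expectation `⟨v | φ(T) | v⟩ = ∫ φ(t) dμ_v(t)` given by the functional calculus of a
self-adjoint operator `T`. -/
def expectation {H : Type*} [NormedAddCommGroup H] [InnerProductSpace ℂ H]
    (T : H →ₗ.[ℂ] H) (φ : ℝ → ℝ) (v : H) : ℝ :=
  ∫ t, φ t ∂(spectralMeasure T v)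

/-- The expectation `⟨x u_α | φ(h_β) | x u_α⟩`, summed over the three components of `x`. -/
def dipoleExpectation (β : ℝ) (φ : ℝ → ℝ) (α : ℝ) (hα : 0 < α) : ℝ :=
  ∑ j : Fin 3, expectation (hydrogen β) φ (positionGroundState α hα j)

/-! ### The quantities of the oscillatory integral -/

/-- A radial ultraviolet cut-off profile `χ ∈ C₀^∞(ℝ₊; [0, 1])` with `χ(r) = 1` for `r < 1/2` and
`χ(r) = 0` for `r > 1`. Only the values on `r > 0` matter. -/
structure IsCutoff (χ : ℝ → ℝ) : Prop where
  smooth : ContDiffOn ℝ ∞ χ (Ioi 0)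
  mem_Icc : ∀ r, 0 < r → χ r ∈ Icc (0 : ℝ) 1
  eq_one : ∀ r, 0 < r → r < 1 / 2 → χ r = 1
  eq_zero : ∀ r, 1 < r → χ r = 0

/-- The function
`f_y(k) = (2π²)⁻¹ χ_Λ(k)² |k|⁻¹ (-1 - k̂₁² + k̂₂² + k̂₃²) cos(2 k₁ y)`,
with `χ_Λ(k) = χ(|k| / Λ)` and `k̂ = k / |k|`. -/
def oscillatory (χ : ℝ → ℝ) (Λ y : ℝ) (k : R3) : ℝ :=
  1 / (2 * Real.pi ^ 2) * (χ (‖k‖ / Λ) ^ 2 / ‖k‖) *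
    (-1 - (k 0 / ‖k‖) ^ 2 + (k 1 / ‖k‖) ^ 2 + (k 2 / ‖k‖) ^ 2) * Real.cos (2 * k 0 * y)

/-- The expectation `⟨x u_α | (h_α - e_α) |k| / (3 (h_α - e_α + |k|)) | x u_α⟩`. -/
def dipoleFactor (α : ℝ) (hα : 0 < α) (k : R3) : ℝ :=
  dipoleExpectation α
    (fun t => (t - groundEnergy α) * ‖k‖ / (3 * (t - groundEnergy α + ‖k‖))) α hα

/-- The coefficient
`ℵ_{α,L} = (6π)⁻¹ ⟨x u₁ | α L arctan(1 / (α L (h₁ - e₁))) | x u₁⟩`. -/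
def aleph (α L : ℝ) : ℝ :=
  1 / (6 * Real.pi) * dipoleExpectation 1
    (fun t => α * L * Real.arctan (1 / (α * L * (t - groundEnergy 1)))) 1 one_pos

end CasimirPolder

end

noncomputable section

namespace CasimirPolder

open scoped SchwartzMap FourierTransform Laplacian LineDeriv
open Filter Topology

/-! The integral and the claimed main term are each bounded by the error, so the two are estimated
separately and never compared.

Main term: for `x > 0`, `arctan (1/x) = π/2 - arctan x`. Since `‖x u₁‖² = 12`, the constant `π/2`
contributes exactly `α L` to `ℵ` and cancels `α²/L³`. What remains is `α²/L³` times `(6π)⁻¹ ⟨arctan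
(α L (h₁ - e₁))⟩`. By `arctan x ≤ x` and a first moment bound this is at most `α³/L²` (`aleph_eq`,
`abs_main_term_le`).

Integral: for a fixed spectral value `a = t - e_α ≥ 0`, integration over spheres reduces the
`k`-integral to one over `r = |k|`. Oscillation in `k₁` gives a factor `y⁻²`, at the price of `∫
a/(a+r) dr` over the support of the cut-off (`exists_oscillatory_bound`). This is the source of the
logarithm. Fubini and the moments of the spectral measure of `h_α` at `x_j u_α` then give `y⁻² (1 +
log (1 + 2Λ/α²))` (`exists_integral_dipoleFactor_bound`), and `α y⁻² = α³/L²`.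

All information about the functional calculus comes from the Cauchy-Stieltjes identity defining
`IsSpectralMeasure`. The measure exists because `h_α` is symmetric, bounded below by `e_α`, and has
a surjective shift `h_α + c`. Its imaginary part at `E + iη` expresses `‖(T - E - iη)⁻¹ v‖²` as a
Poisson-type integral. From this follow the absence of mass below `e_α`, the absence of an atom at
`e₁`, the total mass `‖v‖²` and the second moment bound. The vectors needed are the explicit
functions `x_j (p + q r) e^{-α r/2}`, on which `exists_hydrogen_profile` computes `h_α - e_α`. -/

/-! ### Resolvent of `-Δ` on Schwartz functions and the relative bound of `|x|⁻¹`. -/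

lemma fourier_smul_sub_laplacian (c : ℝ) (ψ : 𝓢(R3, ℂ)) (ξ : R3) :
    𝓕 ((c : ℂ) • ψ - Δ ψ) ξ = ((c + (2 * Real.pi) ^ 2 * ‖ξ‖ ^ 2 : ℝ) : ℂ) * 𝓕 ψ ξ := by
  have h : 𝓕 (Δ ψ) = -(2 * Real.pi) ^ 2 • SchwartzMap.smulLeftCLM ℂ (‖·‖ ^ 2 : R3 → ℝ) (𝓕 ψ) := by
    rw [SchwartzMap.laplacian_eq_fourierMultiplierCLM, FourierTransform.fourier_smul,
      SchwartzMap.fourierMultiplierCLM_apply, FourierTransform.fourier_fourierInv_eq]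
  rw [sub_eq_add_neg, FourierTransform.fourier_add, FourierTransform.fourier_neg,
    FourierTransform.fourier_smul, h]
  have hg : Function.HasTemperateGrowth (‖·‖ ^ 2 : R3 → ℝ) := by fun_prop
  simp only [_root_.add_apply, _root_.neg_apply, _root_.smul_apply,
    SchwartzMap.smulLeftCLM_apply_apply hg, smul_eq_mul, Complex.real_smul]
  push_cast
  ring

lemma hasTemperateGrowth_resolventSymbol {c : ℝ} (hc : 0 < c) :
    Function.HasTemperateGrowth (fun ξ : R3 => (c + (2 * Real.pi) ^ 2 * ‖ξ‖ ^ 2)⁻¹) := by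
  have h := (Function.hasTemperateGrowth_one_add_norm_sq_rpow R3 (-1)).comp
    (((2 * Real.pi / √c) • ContinuousLinearMap.id ℝ R3).hasTemperateGrowth)
  have h2 := (Function.HasTemperateGrowth.const (E := R3) c⁻¹).mul h
  have he : (fun ξ : R3 => (c + (2 * Real.pi) ^ 2 * ‖ξ‖ ^ 2)⁻¹) = (fun _ => c⁻¹) *
      (fun x : R3 => (1 + ‖x‖ ^ 2) ^ (-1 : ℝ)) ∘
        ⇑((2 * Real.pi / √c) • ContinuousLinearMap.id ℝ R3) := by
    ext ξ
    rw [Pi.mul_apply, Function.comp_apply, _root_.smul_apply, ContinuousLinearMap.id_apply,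
      norm_smul, Real.rpow_neg_one, ← mul_inv, Real.norm_eq_abs, mul_pow _ ‖ξ‖, sq_abs, div_pow,
      Real.sq_sqrt hc.le]
    congr 1
    field_simp
  rw [he]
  exact h2

/-- On the Fourier side one divides by `c + |2πξ|²`, whose inverse has temperate growth and so
preserves Schwartz functions. -/
lemma exists_smul_sub_laplacian_eq {c : ℝ} (hc : 0 < c) (f : 𝓢(R3, ℂ)) :
    ∃ ψ : 𝓢(R3, ℂ), (c : ℂ) • ψ - Δ ψ = f := by
  refine ⟨𝓕⁻ (SchwartzMap.smulLeftCLM ℂ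
    (fun ξ : R3 => (c + (2 * Real.pi) ^ 2 * ‖ξ‖ ^ 2)⁻¹) (𝓕 f)), ?_⟩
  have hinj : Function.Injective (𝓕 : 𝓢(R3, ℂ) → 𝓢(R3, ℂ)) := fun a b h => by
    simpa using congrArg (𝓕⁻ : 𝓢(R3, ℂ) → 𝓢(R3, ℂ)) h
  apply hinj
  ext ξ
  rw [fourier_smul_sub_laplacian, FourierTransform.fourier_fourierInv_eq,
    SchwartzMap.smulLeftCLM_apply_apply (hasTemperateGrowth_resolventSymbol hc), Complex.real_smul,
    ← mul_assoc, ← Complex.ofReal_mul, mul_inv_cancel₀ (by positivity), Complex.ofReal_one, one_mul]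

lemma integrable_norm_sq (f : 𝓢(R3, ℂ)) : Integrable (fun x => ‖f x‖ ^ 2) :=
  (memLp_two_iff_integrable_sq_norm f.continuous.aestronglyMeasurable).1 (f.memLp 2)

lemma norm_toLp_sq (f : 𝓢(R3, ℂ)) : ‖f.toLp 2‖ ^ 2 = ∫ x, ‖f x‖ ^ 2 := by
  have h := SchwartzMap.inner_toL2_toL2_eq f f
  rw [← @inner_self_eq_norm_sq ℂ, h, ← integral_re]
  · exact integral_congr_ae (Filter.Eventually.of_forall fun x => inner_self_eq_norm_sq (𝕜 := ℂ) _)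
  · refine (integrable_norm_sq f).ofReal.congr (Filter.Eventually.of_forall fun x => ?_)
    simp [inner_self_eq_norm_sq_to_K]

lemma mul_norm_toLp_le {c : ℝ} (hc : 0 < c) (ψ : 𝓢(R3, ℂ)) :
    c * ‖ψ.toLp 2‖ ≤ ‖((c : ℂ) • ψ - Δ ψ).toLp 2‖ := by
  refine le_of_sq_le_sq ?_ (norm_nonneg _)
  rw [mul_pow, norm_toLp_sq, norm_toLp_sq, ← SchwartzMap.integral_norm_sq_fourier ψ,
    ← SchwartzMap.integral_norm_sq_fourier (_ - _), ← integral_const_mul]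
  refine integral_mono ((integrable_norm_sq _).const_mul _) (integrable_norm_sq _) fun ξ => ?_
  simp only
  rw [fourier_smul_sub_laplacian, norm_mul, mul_pow, Complex.norm_real, Real.norm_eq_abs, sq_abs]
  gcongr
  nlinarith [sq_nonneg (2 * Real.pi * ‖ξ‖)]

/-- The constant `∫ (c + |2 π ξ|²)⁻² dξ` of the embedding `H² ⊂ L^∞`. -/
def embeddingConst (c : ℝ) : ℝ := ∫ ξ : R3, ((c + (2 * Real.pi) ^ 2 * ‖ξ‖ ^ 2)⁻¹) ^ 2

lemma symbol_sq_le {c : ℝ} (hc : 1 ≤ c) (ξ : R3) :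
    ((c + (2 * Real.pi) ^ 2 * ‖ξ‖ ^ 2)⁻¹) ^ 2 ≤ (1 + ‖ξ‖ ^ 2) ^ (-(4 : ℝ) / 2) := by
  rw [show (-(4 : ℝ) / 2) = -(2 : ℕ) by norm_num, Real.rpow_neg (by positivity),
    Real.rpow_natCast, inv_pow]
  have := Real.pi_gt_three
  gcongr
  have : 1 ≤ (2 * Real.pi) ^ 2 := by nlinarith
  nlinarith [sq_nonneg ‖ξ‖]

lemma continuous_symbol {c : ℝ} (hc : 0 < c) :
    Continuous (fun ξ : R3 => ((c + (2 * Real.pi) ^ 2 * ‖ξ‖ ^ 2)⁻¹)) :=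
  (hasTemperateGrowth_resolventSymbol hc).1.continuous

lemma integrable_weight : Integrable (fun ξ : R3 => (1 + ‖ξ‖ ^ 2) ^ (-(4 : ℝ) / 2)) :=
  integrable_rpow_neg_one_add_norm_sq (by simp; norm_num)

lemma integrable_symbol_sq {c : ℝ} (hc : 1 ≤ c) :
    Integrable (fun ξ : R3 => ((c + (2 * Real.pi) ^ 2 * ‖ξ‖ ^ 2)⁻¹) ^ 2) := by
  refine integrable_weight.mono' ((continuous_symbol (by linarith)).pow 2).aestronglyMeasurable
    (Filter.Eventually.of_forall fun ξ => ?_)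
  rw [Real.norm_eq_abs, abs_of_nonneg (by positivity)]
  exact symbol_sq_le hc ξ

/-- Dominated convergence. This limit is what makes the relative bound of the Coulomb potential as
small as desired, for any coupling `α`. -/
lemma tendsto_embeddingConst : Filter.Tendsto embeddingConst Filter.atTop (nhds 0) := by
  have h0 : (∫ _ : R3, (0 : ℝ)) = 0 := by simp
  rw [← h0]
  refine tendsto_integral_filter_of_dominated_convergence _ ?_ ?_ integrable_weight ?_
  · filter_upwards [Filter.eventually_ge_atTop 1] with c hc
    exact (integrable_symbol_sq hc).aestronglyMeasurable
  · filter_upwards [Filter.eventually_ge_atTop 1] with c hc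
    refine Filter.Eventually.of_forall fun ξ => ?_
    rw [Real.norm_eq_abs, abs_of_nonneg (by positivity)]
    exact symbol_sq_le hc ξ
  · refine Filter.Eventually.of_forall fun ξ => ?_
    have : Filter.Tendsto (fun c : ℝ => c + (2 * Real.pi) ^ 2 * ‖ξ‖ ^ 2) Filter.atTop Filter.atTop :=
      Filter.tendsto_atTop_add_const_right _ _ Filter.tendsto_id
    simpa using (this.inv_tendsto_atTop).pow 2

lemma norm_apply_le_integral_fourier (ψ : 𝓢(R3, ℂ)) (x : R3) : ‖ψ x‖ ≤ ∫ ξ, ‖𝓕 ψ ξ‖ := by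
  have h : ψ = 𝓕⁻ (𝓕 ψ) := by simp
  conv_lhs => rw [h]
  rw [SchwartzMap.fourierInv_coe, Real.fourierInv_eq']
  refine (norm_integral_le_integral_norm _).trans (le_of_eq ?_)
  refine integral_congr_ae (Filter.Eventually.of_forall fun ξ => ?_)
  simp only [norm_smul, Complex.norm_exp_ofReal_mul_I, one_mul]

/-- Sobolev embedding with an explicit constant: bound `|ψ|` by the `L¹` norm of its Fourier
transform, insert the symbol and its inverse, and apply Cauchy-Schwarz. -/
lemma norm_apply_sq_le {c : ℝ} (hc : 1 ≤ c) (ψ : 𝓢(R3, ℂ)) (x : R3) :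
    ‖ψ x‖ ^ 2 ≤ embeddingConst c * ‖((c : ℂ) • ψ - Δ ψ).toLp 2‖ ^ 2 := by
  have hc0 : 0 < c := by linarith
  have h1 : ∫ ξ, ‖𝓕 ψ ξ‖ =
      ∫ ξ : R3, (c + (2 * Real.pi) ^ 2 * ‖ξ‖ ^ 2)⁻¹ * ‖𝓕 ((c : ℂ) • ψ - Δ ψ) ξ‖ := by
    refine integral_congr_ae (Filter.Eventually.of_forall fun ξ => ?_)
    have : 0 < c + (2 * Real.pi) ^ 2 * ‖ξ‖ ^ 2 := by positivity
    simp only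
    rw [fourier_smul_sub_laplacian, norm_mul, Complex.norm_real, Real.norm_eq_abs,
      abs_of_pos this, ← mul_assoc, inv_mul_cancel₀ this.ne', one_mul]
  have h2 := integral_mul_le_Lp_mul_Lq_of_nonneg (μ := (volume : Measure R3))
    (p := 2) (q := 2) Real.HolderConjugate.two_two
    (f := fun ξ : R3 => (c + (2 * Real.pi) ^ 2 * ‖ξ‖ ^ 2)⁻¹)
    (g := fun ξ : R3 => ‖𝓕 ((c : ℂ) • ψ - Δ ψ) ξ‖)
    (Filter.Eventually.of_forall fun ξ => by positivity)
    (Filter.Eventually.of_forall fun ξ => by positivity)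
    (by
      rw [ENNReal.ofReal_ofNat]
      rw [memLp_two_iff_integrable_sq (continuous_symbol hc0).aestronglyMeasurable]
      exact integrable_symbol_sq hc)
    (by rw [ENNReal.ofReal_ofNat]; exact ((𝓕 ((c : ℂ) • ψ - Δ ψ)).memLp 2).norm)
  have h3 : ‖ψ x‖ ≤ _ := (norm_apply_le_integral_fourier ψ x).trans (h1.le.trans h2)
  have h4 := pow_le_pow_left₀ (norm_nonneg _) h3 2
  simp only [Real.rpow_ofNat, ← Real.sqrt_eq_rpow] at h4
  rw [mul_pow, Real.sq_sqrt (integral_nonneg fun _ => by positivity),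
    Real.sq_sqrt (integral_nonneg fun _ => by positivity)] at h4
  rw [norm_toLp_sq, ← SchwartzMap.integral_norm_sq_fourier]
  exact h4

/-- The constant `∫_{|x| < 1} |x|⁻² dx`. -/
def coulombConst : ℝ := ∫ x in Metric.ball (0 : R3) 1, (‖x‖⁻¹) ^ 2

lemma integrableOn_inv_norm_sq (R : ℝ) :
    IntegrableOn (fun x : R3 => (‖x‖⁻¹) ^ 2) (Metric.ball 0 R) := by
  refine (integrableOn_fun_norm_addHaar volume (f := fun r : ℝ => (r⁻¹) ^ 2)).2 ?_
  have h : IntegrableOn (fun _ : ℝ => (1 : ℝ)) (Ioo 0 R) := integrableOn_const (by simp)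
  refine h.congr_fun (fun r hr => ?_) measurableSet_Ioo
  have : r ≠ 0 := hr.1.ne'
  simp only [finrank_euclideanSpace, Fintype.card_fin, smul_eq_mul]
  field_simp

lemma measurable_inv_norm : Measurable (fun x : R3 => ‖x‖⁻¹) := measurable_norm.inv

/-- Inside the unit ball the sup bound on `ψ` is used against the locally integrable `|x|⁻²`.
Outside, `|x|⁻¹ ≤ 1`. -/
lemma sq_norm_coulomb_le {M : ℝ} {ψ : R3 → ℂ} (hM : ∀ x, ‖ψ x‖ ^ 2 ≤ M) (x : R3) :
    ‖((‖x‖⁻¹ : ℝ) : ℂ) * ψ x‖ ^ 2 ≤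
      M * (Metric.ball (0 : R3) 1).indicator (fun x => (‖x‖⁻¹) ^ 2) x + ‖ψ x‖ ^ 2 := by
  rw [norm_mul, mul_pow, Complex.norm_real, Real.norm_eq_abs, sq_abs]
  by_cases hx : x ∈ Metric.ball (0 : R3) 1
  · rw [indicator_of_mem hx]
    nlinarith [mul_le_mul_of_nonneg_left (hM x) (sq_nonneg ‖x‖⁻¹), sq_nonneg ‖ψ x‖]
  · rw [indicator_of_notMem hx, mul_zero, zero_add]
    have h1 : 1 ≤ ‖x‖ := by simpa using hx
    have h2 : (‖x‖⁻¹) ^ 2 ≤ 1 := pow_le_one₀ (by positivity) (inv_le_one_of_one_le₀ h1)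
    nlinarith [sq_nonneg ‖ψ x‖]

lemma integrable_coulomb_majorant (M : ℝ) (ψ : 𝓢(R3, ℂ)) :
    Integrable (fun x =>
      M * (Metric.ball (0 : R3) 1).indicator (fun x => (‖x‖⁻¹) ^ 2) x + ‖ψ x‖ ^ 2) :=
  (((integrable_indicator_iff Metric.isOpen_ball.measurableSet).2
    (integrableOn_inv_norm_sq 1)).const_mul M).add (integrable_norm_sq ψ)

lemma aestronglyMeasurable_coulomb (ψ : 𝓢(R3, ℂ)) :
    AEStronglyMeasurable (fun x => ((‖x‖⁻¹ : ℝ) : ℂ) * ψ x) volume :=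
  (Complex.measurable_ofReal.comp measurable_inv_norm).aestronglyMeasurable.mul
    ψ.continuous.aestronglyMeasurable

lemma integrable_sq_norm_coulomb (ψ : 𝓢(R3, ℂ)) :
    Integrable (fun x => ‖((‖x‖⁻¹ : ℝ) : ℂ) * ψ x‖ ^ 2) := by
  refine (integrable_coulomb_majorant (embeddingConst 1 * ‖(((1 : ℝ) : ℂ) • ψ - Δ ψ).toLp 2‖ ^ 2)
    ψ).mono' ((aestronglyMeasurable_coulomb ψ).norm.pow 2) (Filter.Eventually.of_forall fun x => ?_)
  rw [Real.norm_eq_abs, abs_of_nonneg (by positivity)]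
  exact sq_norm_coulomb_le (norm_apply_sq_le le_rfl ψ) x

lemma memLp_inv_norm_mul (ψ : 𝓢(R3, ℂ)) : MemLp (fun x => ((‖x‖⁻¹ : ℝ) : ℂ) * ψ x) 2 volume :=
  (memLp_two_iff_integrable_sq_norm (aestronglyMeasurable_coulomb ψ)).2
    (integrable_sq_norm_coulomb ψ)

/-- The squared norm bound of `|x|⁻¹ (-Δ + c)⁻¹`. -/
def relativeBound (c : ℝ) : ℝ := coulombConst * embeddingConst c + (c⁻¹) ^ 2

lemma tendsto_relativeBound : Filter.Tendsto relativeBound Filter.atTop (nhds 0) := by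
  unfold relativeBound
  simpa using (tendsto_embeddingConst.const_mul coulombConst).add
    ((tendsto_inv_atTop_zero (𝕜 := ℝ)).pow 2)

lemma integral_sq_norm_coulomb_le {c : ℝ} (hc : 1 ≤ c) (ψ : 𝓢(R3, ℂ)) :
    ∫ x, ‖((‖x‖⁻¹ : ℝ) : ℂ) * ψ x‖ ^ 2 ≤
      relativeBound c * ‖((c : ℂ) • ψ - Δ ψ).toLp 2‖ ^ 2 := by
  have hc0 : 0 < c := by linarith
  set N := ‖((c : ℂ) • ψ - Δ ψ).toLp 2‖
  refine (integral_mono (integrable_sq_norm_coulomb ψ)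
    (integrable_coulomb_majorant (embeddingConst c * N ^ 2) ψ)
    (sq_norm_coulomb_le (norm_apply_sq_le hc ψ))).trans ?_
  rw [integral_add (((integrable_indicator_iff Metric.isOpen_ball.measurableSet).2
    (integrableOn_inv_norm_sq 1)).const_mul _) (integrable_norm_sq ψ), integral_const_mul,
    integral_indicator Metric.isOpen_ball.measurableSet, ← norm_toLp_sq]
  have h : ‖ψ.toLp 2‖ ≤ c⁻¹ * N := by
    rw [le_inv_mul_iff₀ hc0]
    exact mul_norm_toLp_le hc0 ψ
  have h2 := pow_le_pow_left₀ (norm_nonneg _) h 2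
  rw [relativeBound, ← coulombConst]
  rw [mul_pow] at h2
  linarith

/-! ### Passage from Schwartz functions to `H²` by closure. -/

/-- Multiplication operators are closed: along a common subsequence both limits hold almost
everywhere, and pointwise multiplication identifies them. -/
lemma mulOperator_of_tendsto {V : R3 → ℝ} {ψ : ℕ → mulDomain V} {ψ₀ χ : L2R3}
    (h1 : Tendsto (fun n => (ψ n : L2R3)) atTop (𝓝 ψ₀))
    (h2 : Tendsto (fun n => mulOperator V (ψ n)) atTop (𝓝 χ)) :
    ∃ h : ψ₀ ∈ mulDomain V, mulOperator V ⟨ψ₀, h⟩ = χ := by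
  obtain ⟨ns, hns, hae⟩ := (tendstoInMeasure_of_tendsto_Lp h1).exists_seq_tendsto_ae
  obtain ⟨ms, hms, hae'⟩ :=
    (tendstoInMeasure_of_tendsto_Lp (h2.comp hns.tendsto_atTop)).exists_seq_tendsto_ae
  have heq : ∀ᵐ x, ∀ n, mulOperator V (ψ n) x = (V x : ℂ) * (ψ n : L2R3) x :=
    ae_all_iff.2 fun n => MemLp.coeFn_toLp (mem_mulDomain.1 (ψ n).2)
  have hlim : (fun x => (V x : ℂ) * ψ₀ x) =ᵐ[volume] χ := by
    filter_upwards [hae, hae', heq] with x hx hx' he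
    refine tendsto_nhds_unique ?_ hx'
    simp only [Function.comp_apply, he]
    exact (hx.comp hms.tendsto_atTop).const_mul _
  have hmem : ψ₀ ∈ mulDomain V := mem_mulDomain.2 ((Lp.memLp χ).ae_eq hlim.symm)
  refine ⟨hmem, Lp.ext ?_⟩
  exact (MemLp.coeFn_toLp (mem_mulDomain.1 hmem)).trans hlim

lemma exists_mem_sobolevTwo {ψ g : L2R3} (h : Δ (toDistribution ψ) = toDistribution g) :
    ∃ hψ : ψ ∈ sobolevTwo, laplacianL2 ⟨ψ, hψ⟩ = g := by
  have hmem : ψ ∈ sobolevTwo := by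
    -- The Bessel multiplier of order two is `1 + |ξ|²`, and `Δ` has symbol `-(2π)²|ξ|²`, so the
    -- multiplier is `1 - (2π)⁻² Δ`.
    refine ⟨ψ - ((((2 * Real.pi) ^ 2)⁻¹ : ℝ) : ℂ) • g, ?_⟩
    have hπ : ((2 * Real.pi) ^ 2 : ℝ) ≠ 0 := by positivity
    change _ = toDistribution _
    rw [map_sub, map_smul, ← h, TemperedDistribution.laplacian_eq_fourierMultiplierCLM,
      TemperedDistribution.besselPotential]
    have hfun : (fun x : R3 => (((1 + ‖x‖ ^ 2) ^ ((2 : ℝ) / 2) : ℝ) : ℂ)) =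
        fun x => ∑ i : Fin 2, (![fun _ : R3 => (1 : ℂ), fun x => ((‖x‖ ^ 2 : ℝ) : ℂ)] i) x := by
      ext x
      rw [Fin.sum_univ_two, div_self two_ne_zero, Real.rpow_one]
      simp
    rw [hfun, TemperedDistribution.fourierMultiplierCLM_sum, Fin.sum_univ_two]
    · simp only [Matrix.cons_val_zero, Matrix.cons_val_one,
        TemperedDistribution.fourierMultiplierCLM_const, one_smul, _root_.add_apply,
        ContinuousLinearMap.id_apply]
      rw [← Complex.coe_smul (-(2 * Real.pi) ^ 2), smul_smul, ← Complex.ofReal_mul, mul_neg,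
        inv_mul_cancel₀ hπ, Complex.ofReal_neg, Complex.ofReal_one, neg_one_smul, sub_neg_eq_add]
    · intro i _
      fin_cases i
      · simp only [Fin.zero_eta, Matrix.cons_val_zero]; fun_prop
      · simp only [Fin.mk_one, Matrix.cons_val_one, Matrix.cons_val_fin_one]; fun_prop
  refine ⟨hmem, toDistribution_injective ?_⟩
  rw [laplacianL2_spec, TemperedDistribution.laplacianCLM_apply, h]

lemma laplacian_toDistribution (ψ : sobolevTwo) :
    Δ (toDistribution ψ.1) = toDistribution (laplacianL2 ψ) := by
  rw [laplacianL2_spec, TemperedDistribution.laplacianCLM_apply]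

lemma laplacian_toDistribution_schwartz (φ : 𝓢(R3, ℂ)) :
    Δ (toDistribution (φ.toLp 2)) = toDistribution ((Δ φ).toLp 2) := by
  simp only [Lp.toTemperedDistributionCLM_apply, Lp.toTemperedDistribution_toLp_eq,
    TemperedDistribution.laplacian_toTemperedDistributionCLM_eq]

/-- The `L²` function `|x|⁻¹ φ` of a Schwartz function `φ`. -/
def coulombLp (φ : 𝓢(R3, ℂ)) : L2R3 := (memLp_inv_norm_mul φ).toLp

lemma toLp_mem_mulDomain (φ : 𝓢(R3, ℂ)) : φ.toLp 2 volume ∈ mulDomain (fun x : R3 => ‖x‖⁻¹) := by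
  refine mem_mulDomain.2 ((memLp_inv_norm_mul φ).ae_eq ?_)
  filter_upwards [φ.coeFn_toLp 2] with x hx
  rw [hx]

lemma mulOperator_toLp (φ : 𝓢(R3, ℂ)) :
    mulOperator (fun x : R3 => ‖x‖⁻¹) ⟨φ.toLp 2 volume, toLp_mem_mulDomain φ⟩ = coulombLp φ := by
  refine MemLp.toLp_congr (mem_mulDomain.1 (toLp_mem_mulDomain φ)) (memLp_inv_norm_mul φ) ?_
  filter_upwards [φ.coeFn_toLp 2] with x hx
  rw [hx]

lemma norm_toLp_sq_eq {f : R3 → ℂ} (hf : MemLp f 2 volume) :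
    ‖hf.toLp‖ ^ 2 = ∫ x, ‖f x‖ ^ 2 := by
  rw [← @inner_self_eq_norm_sq ℂ, L2.inner_def, ← integral_re (L2.integrable_inner _ _)]
  refine integral_congr_ae ?_
  filter_upwards [hf.coeFn_toLp] with x hx
  rw [hx, inner_self_eq_norm_sq]

lemma norm_coulombLp_sq (φ : 𝓢(R3, ℂ)) :
    ‖coulombLp φ‖ ^ 2 = ∫ x, ‖((‖x‖⁻¹ : ℝ) : ℂ) * φ x‖ ^ 2 :=
  norm_toLp_sq_eq _

lemma coulombLp_sub (φ ψ : 𝓢(R3, ℂ)) : coulombLp (φ - ψ) = coulombLp φ - coulombLp ψ := by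
  rw [coulombLp, coulombLp, coulombLp, ← MemLp.toLp_sub]
  refine MemLp.toLp_congr _ _ (Eventually.of_forall fun x => ?_)
  simp [mul_sub]

lemma cauchySeq_of_dist_le {X Y : Type*} [PseudoMetricSpace X] [PseudoMetricSpace Y]
    {a : ℕ → X} {b : ℕ → Y} {K : ℝ} (hK : ∀ n m, dist (a n) (a m) ≤ K * dist (b n) (b m))
    (hb : CauchySeq b) : CauchySeq a := by
  rw [Metric.cauchySeq_iff] at hb ⊢
  intro ε hε
  obtain ⟨N, hN⟩ := hb (ε / (|K| + 1)) (by positivity)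
  refine ⟨N, fun m hm n hn => (hK m n).trans_lt ?_⟩
  have h1 := hN m hm n hn
  rw [lt_div_iff₀ (by positivity)] at h1
  nlinarith [le_abs_self K, dist_nonneg (x := b m) (y := b n), abs_nonneg K]

/-- Schwartz functions `φ n` approximate `ψ` in the graph norms of `-Δ` and of `|x|⁻¹`. -/
structure GraphApprox (φ : ℕ → 𝓢(R3, ℂ)) (ψ g χ : L2R3) : Prop where
  tendsto : Tendsto (fun n => (φ n).toLp 2) atTop (𝓝 ψ)
  tendsto_laplacian : Tendsto (fun n => (Δ (φ n)).toLp 2) atTop (𝓝 g)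
  tendsto_coulomb : Tendsto (fun n => coulombLp (φ n)) atTop (𝓝 χ)

/-- Solve `(c - Δ) φ_n = f_n` for Schwartz `f_n → f`. The bounds on `(c - Δ)⁻¹` and on `|x|⁻¹ (c -
Δ)⁻¹` make `φ_n` Cauchy in both graph norms. -/
lemma exists_graphApprox {c : ℝ} (hc : 1 ≤ c) (f : L2R3) :
    ∃ φ ψ g χ, GraphApprox φ ψ g χ ∧ (c : ℂ) • ψ - g = f := by
  have hc0 : 0 < c := by linarith
  have hd := SchwartzMap.denseRange_toLpCLM (E := R3) (F := ℂ) (p := 2) (μ := volume)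
    ENNReal.ofNat_ne_top f
  obtain ⟨F, hF, hlim⟩ := mem_closure_iff_seq_limit.1 hd
  choose f' hf' using hF
  choose φ hφ using fun n => exists_smul_sub_laplacian_eq hc0 (f' n)
  have hF' : ∀ n, F n = (f' n).toLp 2 := fun n => (hf' n).symm
  have hsub : ∀ a b : 𝓢(R3, ℂ), a.toLp 2 volume - b.toLp 2 volume = ((a - b).toLp 2 : L2R3) := fun a b =>
    (map_sub (SchwartzMap.toLpCLM ℂ ℂ 2 volume) a b).symm
  have hsmul : ∀ (a : 𝓢(R3, ℂ)), ((c : ℂ) • a).toLp 2 = (c : ℂ) • (a.toLp 2 : L2R3) := fun a =>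
    (map_smul (SchwartzMap.toLpCLM ℂ ℂ 2 volume) (c : ℂ) a)
  have hres : ∀ n m, (c : ℂ) • (φ n - φ m) - Δ (φ n - φ m) = f' n - f' m := fun n m => by
    rw [← hφ n, ← hφ m, ← SchwartzMap.laplacianCLM_eq (𝕜 := ℂ), map_sub, SchwartzMap.laplacianCLM_eq,
      SchwartzMap.laplacianCLM_eq, smul_sub]
    abel
  have h1 : CauchySeq fun n => ((φ n).toLp 2 : L2R3) := by
    refine cauchySeq_of_dist_le (K := c⁻¹) (fun n m => ?_) hlim.cauchySeq
    rw [dist_eq_norm, dist_eq_norm, hF', hF', hsub, hsub, le_inv_mul_iff₀ hc0, ← hres]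
    exact mul_norm_toLp_le hc0 _
  have h2 : CauchySeq fun n => coulombLp (φ n) := by
    refine cauchySeq_of_dist_le (K := √(relativeBound c)) (fun n m => ?_) hlim.cauchySeq
    rw [dist_eq_norm, dist_eq_norm, hF', hF', hsub, ← coulombLp_sub, ← hres]
    have h := Real.le_sqrt_of_sq_le
      ((norm_coulombLp_sq (φ n - φ m)).le.trans (integral_sq_norm_coulomb_le hc (φ n - φ m)))
    rwa [Real.sqrt_mul' _ (sq_nonneg _), Real.sqrt_sq (norm_nonneg _)] at h
  obtain ⟨ψ, hψ⟩ := cauchySeq_tendsto_of_complete h1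
  obtain ⟨χ, hχ⟩ := cauchySeq_tendsto_of_complete h2
  refine ⟨φ, ψ, (c : ℂ) • ψ - f, χ, ⟨hψ, ?_, hχ⟩, sub_sub_cancel _ _⟩
  refine ((hψ.const_smul (c : ℂ)).sub hlim).congr fun n => ?_
  rw [hF', ← hφ n, ← hsmul, hsub, sub_sub_cancel]

lemma GraphApprox.laplacian {φ : ℕ → 𝓢(R3, ℂ)} {ψ g χ : L2R3} (h : GraphApprox φ ψ g χ) :
    Δ (toDistribution ψ) = toDistribution g := by
  have h1 := (toDistribution.continuous.tendsto _).comp h.tendsto_laplacian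
  have h2 := ((LineDeriv.laplacianCLM ℂ R3 (TemperedDistribution R3 ℂ)).continuous.tendsto _).comp
    ((toDistribution.continuous.tendsto _).comp h.tendsto)
  rw [TemperedDistribution.laplacianCLM_apply] at h2
  refine tendsto_nhds_unique h2 (h1.congr fun n => ?_)
  simp only [Function.comp_apply]
  rw [← laplacian_toDistribution_schwartz, TemperedDistribution.laplacianCLM_apply]

lemma GraphApprox.coulomb {φ : ℕ → 𝓢(R3, ℂ)} {ψ g χ : L2R3} (h : GraphApprox φ ψ g χ) :
    ∃ hψ : ψ ∈ mulDomain (fun x : R3 => ‖x‖⁻¹), mulOperator (fun x : R3 => ‖x‖⁻¹) ⟨ψ, hψ⟩ = χ := by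
  refine mulOperator_of_tendsto (ψ := fun n => ⟨(φ n).toLp 2, toLp_mem_mulDomain (φ n)⟩)
    h.tendsto ?_
  exact h.tendsto_coulomb.congr fun n => (mulOperator_toLp (φ n)).symm

/-- Uniqueness for the resolvent equation, by duality: `ψ` annihilates every `(c - Δ) φ`, and these
are all the Schwartz functions. -/
lemma eq_zero_of_laplacian_eq_smul {c : ℝ} (hc : 0 < c) {ψ : L2R3}
    (h : Δ (toDistribution ψ) = toDistribution ((c : ℂ) • ψ)) : ψ = 0 := by
  refine toDistribution_injective ?_
  rw [map_zero]
  ext u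
  obtain ⟨φ, rfl⟩ := exists_smul_sub_laplacian_eq hc u
  rw [map_sub, ← TemperedDistribution.laplacian_apply_apply, h, map_smul, map_smul]
  simp

/-- Schwartz functions are dense in `H²(ℝ³)` for the graph norm, and `H² ⊂ D(|x|⁻¹)`. -/
lemma exists_graphApprox_of_mem {ψ : L2R3} (hψ : ψ ∈ sobolevTwo) :
    ∃ (hV : ψ ∈ mulDomain (fun x : R3 => ‖x‖⁻¹)) (φ : ℕ → 𝓢(R3, ℂ)),
      GraphApprox φ ψ (laplacianL2 ⟨ψ, hψ⟩) (mulOperator (fun x : R3 => ‖x‖⁻¹) ⟨ψ, hV⟩) := by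
  obtain ⟨φ, ψ', g, χ, h, hf⟩ := exists_graphApprox (le_refl (1 : ℝ)) (ψ - laplacianL2 ⟨ψ, hψ⟩)
  -- The limit of the approximants solves the same equation `(1 - Δ) ψ' = (1 - Δ) ψ`.
  have hψ' : ψ' = ψ := by
    rw [← sub_eq_zero]
    refine eq_zero_of_laplacian_eq_smul one_pos ?_
    have h1 : Δ (toDistribution (ψ' - ψ)) = Δ (toDistribution ψ') - Δ (toDistribution ψ) := by
      simp only [← TemperedDistribution.laplacianCLM_apply, map_sub]
    rw [h1, h.laplacian, laplacian_toDistribution ⟨ψ, hψ⟩, ← map_sub]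
    congr 1
    rw [Complex.ofReal_one, one_smul] at hf ⊢
    rw [← sub_eq_zero] at hf ⊢
    rw [← neg_eq_zero, ← hf]
    abel
  subst hψ'
  have hg : g = laplacianL2 ⟨ψ', hψ⟩ := toDistribution_injective (by
    rw [← h.laplacian, laplacian_toDistribution ⟨ψ', hψ⟩])
  obtain ⟨hV, rfl⟩ := h.coulomb
  exact ⟨hV, φ, hg ▸ h⟩

lemma sobolevTwo_le_mulDomain : sobolevTwo ≤ mulDomain (fun x : R3 => ‖x‖⁻¹) := fun _ hψ =>
  (exists_graphApprox_of_mem hψ).1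

lemma hydrogen_domain (α : ℝ) : (hydrogen α).domain = sobolevTwo :=
  inf_eq_left.2 sobolevTwo_le_mulDomain

lemma mem_hydrogen_domain {α : ℝ} {ψ : L2R3} : ψ ∈ (hydrogen α).domain ↔ ψ ∈ sobolevTwo := by
  rw [hydrogen_domain]

lemma hydrogen_apply {α : ℝ} {ψ : L2R3} (h : ψ ∈ (hydrogen α).domain) (h1 : ψ ∈ sobolevTwo)
    (h2 : ψ ∈ mulDomain (fun x : R3 => ‖x‖⁻¹)) :
    hydrogen α ⟨ψ, h⟩ =
      -laplacianL2 ⟨ψ, h1⟩ - (α : ℂ) • mulOperator (fun x : R3 => ‖x‖⁻¹) ⟨ψ, h2⟩ := by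
  change (negLaplacian - (α : ℂ) • mulOperator (fun x => ‖x‖⁻¹)) ⟨ψ, h⟩ = _
  rw [LinearPMap.sub_apply]
  rfl

/-- The Hamiltonian `h_α` on a Schwartz function. -/
def hydrogenSchwartz (α : ℝ) (φ : 𝓢(R3, ℂ)) : L2R3 :=
  -(Δ φ).toLp 2 - (α : ℂ) • coulombLp φ

lemma exists_seq_hydrogenSchwartz {α : ℝ} (ψ : (hydrogen α).domain) :
    ∃ φ : ℕ → 𝓢(R3, ℂ), Tendsto (fun n => (φ n).toLp 2) atTop (𝓝 (ψ : L2R3)) ∧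
      Tendsto (fun n => hydrogenSchwartz α (φ n)) atTop (𝓝 (hydrogen α ψ)) := by
  have h1 := mem_hydrogen_domain.1 ψ.2
  obtain ⟨h2, φ, hφ⟩ := exists_graphApprox_of_mem h1
  refine ⟨φ, hφ.tendsto, ?_⟩
  have h3 : hydrogen α ψ = _ := hydrogen_apply ψ.2 h1 h2
  rw [h3]
  exact hφ.tendsto_laplacian.neg.sub (hφ.tendsto_coulomb.const_smul _)

/-! ### Symmetry of `h_α` and surjectivity of `h_α + c` for large `c`. -/

lemma inner_toLp_laplacian (φ ψ : 𝓢(R3, ℂ)) :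
    ⟪((Δ φ).toLp 2 : L2R3), ψ.toLp 2⟫_ℂ = ⟪(φ.toLp 2 : L2R3), (Δ ψ).toLp 2⟫_ℂ := by
  have h1 := SchwartzMap.inner_toL2_toL2_eq (Δ φ) ψ
  have h2 := SchwartzMap.inner_toL2_toL2_eq φ (Δ ψ)
  rw [h1, h2]
  have h3 := SchwartzMap.integral_bilinear_laplacian_right_eq_left (μ := volume) φ ψ
    ((ContinuousLinearMap.mul ℝ ℂ).comp Complex.conjCLE.toContinuousLinearMap)
  simp only [RCLike.inner_apply]
  simpa [mul_comm] using h3.symm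

lemma inner_mulOperator {V : R3 → ℝ} (φ ψ : mulDomain V) :
    ⟪mulOperator V φ, (ψ : L2R3)⟫_ℂ = ⟪(φ : L2R3), mulOperator V ψ⟫_ℂ := by
  rw [L2.inner_def, L2.inner_def]
  refine integral_congr_ae ?_
  have h1 : mulOperator V φ =ᵐ[volume] fun x => (V x : ℂ) * (φ : L2R3) x :=
    MemLp.coeFn_toLp (mem_mulDomain.1 φ.2)
  have h2 : mulOperator V ψ =ᵐ[volume] fun x => (V x : ℂ) * (ψ : L2R3) x :=
    MemLp.coeFn_toLp (mem_mulDomain.1 ψ.2)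
  filter_upwards [h1, h2] with x hx1 hx2
  rw [hx1, hx2, RCLike.inner_apply, RCLike.inner_apply, map_mul, Complex.conj_ofReal]
  ring

lemma inner_coulombLp (φ ψ : 𝓢(R3, ℂ)) :
    ⟪coulombLp φ, (ψ.toLp 2 : L2R3)⟫_ℂ = ⟪(φ.toLp 2 : L2R3), coulombLp ψ⟫_ℂ := by
  rw [← mulOperator_toLp, ← mulOperator_toLp]
  exact inner_mulOperator ⟨_, toLp_mem_mulDomain φ⟩ ⟨_, toLp_mem_mulDomain ψ⟩

lemma inner_hydrogenSchwartz (α : ℝ) (φ ψ : 𝓢(R3, ℂ)) :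
    ⟪hydrogenSchwartz α φ, (ψ.toLp 2 : L2R3)⟫_ℂ =
      ⟪(φ.toLp 2 : L2R3), hydrogenSchwartz α ψ⟫_ℂ := by
  simp only [hydrogenSchwartz, inner_sub_left, inner_sub_right, inner_neg_left, inner_neg_right,
    inner_smul_left, inner_smul_right, inner_toLp_laplacian, inner_coulombLp, Complex.conj_ofReal]

lemma hydrogen_symmetric {α : ℝ} (φ ψ : (hydrogen α).domain) :
    ⟪hydrogen α φ, (ψ : L2R3)⟫_ℂ = ⟪(φ : L2R3), hydrogen α ψ⟫_ℂ := by
  obtain ⟨f, hf, hf'⟩ := exists_seq_hydrogenSchwartz φ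
  obtain ⟨g, hg, hg'⟩ := exists_seq_hydrogenSchwartz ψ
  refine tendsto_nhds_unique (hf'.inner hg) ((hf.inner hg').congr fun n => ?_)
  rw [inner_hydrogenSchwartz]

lemma norm_mulOperator_le {c : ℝ} (hc : 1 ≤ c) {ψ : L2R3} (h1 : ψ ∈ sobolevTwo)
    (h2 : ψ ∈ mulDomain (fun x : R3 => ‖x‖⁻¹)) :
    ‖mulOperator (fun x : R3 => ‖x‖⁻¹) ⟨ψ, h2⟩‖ ≤
      √(relativeBound c) * ‖(c : ℂ) • ψ - laplacianL2 ⟨ψ, h1⟩‖ := by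
  obtain ⟨h2, φ, hφ⟩ := exists_graphApprox_of_mem h1
  refine le_of_tendsto_of_tendsto' hφ.tendsto_coulomb.norm
    (((hφ.tendsto.const_smul (c : ℂ)).sub hφ.tendsto_laplacian).norm.const_mul _) fun n => ?_
  have h := Real.le_sqrt_of_sq_le
      ((norm_coulombLp_sq (φ n)).le.trans (integral_sq_norm_coulomb_le hc (φ n)))
  rw [Real.sqrt_mul' _ (sq_nonneg _), Real.sqrt_sq (norm_nonneg _)] at h
  exact h

lemma exists_resolvent {c : ℝ} (hc : 1 ≤ c) (f : L2R3) :
    ∃ ψ : sobolevTwo, (c : ℂ) • (ψ : L2R3) - laplacianL2 ψ = f := by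
  obtain ⟨φ, ψ, g, χ, h, hf⟩ := exists_graphApprox hc f
  obtain ⟨hψ, rfl⟩ := exists_mem_sobolevTwo h.laplacian
  exact ⟨⟨ψ, hψ⟩, hf⟩

lemma laplacianL2_sub (φ ψ : sobolevTwo) :
    laplacianL2 (φ - ψ) = laplacianL2 φ - laplacianL2 ψ := by
  have h := negLaplacian.map_sub φ ψ
  change -laplacianL2 (φ - ψ) = -laplacianL2 φ - -laplacianL2 ψ at h
  rw [← neg_inj, h]
  abel

/-- With `R = (c - Δ)⁻¹` and `g = (c - Δ) ψ`, the equation `(h_α + c) ψ = f` reads `g = f + α |x|⁻¹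
R g`. The right side is a contraction in `g` with factor `1/2`, so Banach's fixed point theorem
applies. -/
lemma exists_hydrogen_add_smul_eq {α c : ℝ} (hα : 0 < α) (hc : 1 ≤ c)
    (hαc : α * √(relativeBound c) ≤ 1 / 2) (f : L2R3) :
    ∃ ψ : (hydrogen α).domain, hydrogen α ψ + (c : ℂ) • (ψ : L2R3) = f := by
  choose R hR using exists_resolvent hc
  let W : sobolevTwo → L2R3 := fun ψ =>
    mulOperator (fun x : R3 => ‖x‖⁻¹) ⟨ψ, sobolevTwo_le_mulDomain ψ.2⟩
  let Φ : L2R3 → L2R3 := fun g => f + (α : ℂ) • W (R g)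
  have hΦ : ContractingWith (1 / 2 : NNReal) Φ := by
    refine ⟨by rw [one_div]; exact NNReal.inv_lt_one_iff (by norm_num) |>.2 (by norm_num),
      LipschitzWith.of_dist_le_mul fun g g' => ?_⟩
    have hW : W (R g) - W (R g') = W (R g - R g') :=
      ((mulOperator (fun x : R3 => ‖x‖⁻¹)).map_sub ⟨R g, sobolevTwo_le_mulDomain (R g).2⟩
        ⟨R g', sobolevTwo_le_mulDomain (R g').2⟩).symm
    have hb : ‖W (R g - R g')‖ ≤ √(relativeBound c) * ‖g - g'‖ := by
      have h := norm_mulOperator_le hc (R g - R g').2 (sobolevTwo_le_mulDomain (R g - R g').2)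
      refine h.trans (le_of_eq ?_)
      congr 2
      conv_rhs => rw [← hR g, ← hR g']
      rw [Subtype.coe_eta, laplacianL2_sub, Submodule.coe_sub, smul_sub]
      abel
    rw [dist_eq_norm, dist_eq_norm, add_sub_add_left_eq_sub, ← smul_sub, hW, norm_smul,
      Complex.norm_real, Real.norm_eq_abs, abs_of_pos hα]
    calc α * ‖W (R g - R g')‖ ≤ α * (√(relativeBound c) * ‖g - g'‖) := by gcongr
      _ = (α * √(relativeBound c)) * ‖g - g'‖ := by ring
      _ ≤ 1 / 2 * ‖g - g'‖ := by gcongr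
      _ = _ := by norm_num
  have hfix : Φ hΦ.fixedPoint = hΦ.fixedPoint := hΦ.fixedPoint_isFixedPt
  set g := hΦ.fixedPoint
  have hmem := mem_hydrogen_domain (α := α).2 (R g).2
  refine ⟨⟨R g, hmem⟩, ?_⟩
  rw [hydrogen_apply hmem (R g).2 (sobolevTwo_le_mulDomain (R g).2)]
  have h1 : f + (α : ℂ) • W (R g) = g := hfix
  have h2 : f = g - (α : ℂ) • W (R g) := eq_sub_of_add_eq h1
  change -laplacianL2 (R g) - (α : ℂ) • W (R g) + (c : ℂ) • (R g : L2R3) = f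
  rw [h2, sub_add_eq_add_sub, neg_add_eq_sub, hR g]

/-! ### The lower bound `h_α ≥ e_α`, by completing the square. -/

/-- The `i`-th standard basis vector of `ℝ³`. -/
abbrev basisVec (i : Fin 3) : R3 := EuclideanSpace.basisFun (Fin 3) ℝ i

/-- The regularised radius `√(|x|² + ε²)`. -/
def regRadius (ε : ℝ) (x : R3) : ℝ := √(‖x‖ ^ 2 + ε ^ 2)

lemma basisVec_apply (i j : Fin 3) : basisVec i j = if i = j then 1 else 0 := by
  simp [basisVec, eq_comm]

lemma hasDerivAt_coord (x : R3) (i j : Fin 3) :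
    HasDerivAt (fun t : ℝ => (x + t • basisVec i) j) (if i = j then 1 else 0) 0 := by
  have h : (fun t : ℝ => (x + t • basisVec i) j) = fun t => x j + t * (if i = j then 1 else 0) := by
    ext t
    rw [PiLp.add_apply, PiLp.smul_apply, basisVec_apply, smul_eq_mul]
  rw [h]
  simpa using ((hasDerivAt_id (0 : ℝ)).mul_const (if i = j then (1 : ℝ) else 0)).const_add (x j)

lemma regRadius_pos {ε : ℝ} (hε : 0 < ε) (x : R3) : 0 < regRadius ε x :=
  Real.sqrt_pos.2 (by positivity)

lemma norm_le_regRadius (ε : ℝ) (x : R3) : ‖x‖ ≤ regRadius ε x :=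
  Real.le_sqrt_of_sq_le (by nlinarith [sq_nonneg ε])

lemma le_regRadius (ε : ℝ) (x : R3) : ε ≤ regRadius ε x :=
  Real.le_sqrt_of_sq_le (by nlinarith [sq_nonneg ‖x‖])

lemma abs_coord_le_norm (x : R3) (i : Fin 3) : |x i| ≤ ‖x‖ := by
  rw [← Real.norm_eq_abs]; exact PiLp.norm_apply_le x i

lemma continuous_regRadius (ε : ℝ) : Continuous (regRadius ε) := by
  unfold regRadius; fun_prop

lemma hasDerivAt_regRadius {ε : ℝ} (hε : 0 < ε) (x : R3) (i : Fin 3) :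
    HasDerivAt (fun t : ℝ => regRadius ε (x + t • basisVec i)) (x i / regRadius ε x) 0 := by
  have h0 : HasDerivAt (fun t : ℝ => x + t • basisVec i) (basisVec i) 0 := by
    simpa using ((hasDerivAt_id (0 : ℝ)).smul_const (basisVec i)).const_add x
  have h := (h0.norm_sq.add_const (ε ^ 2)).sqrt (by positivity)
  simp only [zero_smul, add_zero] at h
  refine h.congr_deriv ?_
  change _ = x i / √(‖x‖ ^ 2 + ε ^ 2)
  have : ⟪x, basisVec i⟫_ℝ = x i := by
    rw [real_inner_comm]; simp [basisVec, EuclideanSpace.inner_single_left]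
  rw [this]
  field_simp

lemma sum_sq_eq_norm_sq (x : R3) : ∑ i : Fin 3, x i ^ 2 = ‖x‖ ^ 2 :=
  (EuclideanSpace.real_norm_sq_eq x).symm

/-- Integration by parts, identifying the kinetic energy with the Dirichlet form in which the square
is completed. -/
lemma sum_norm_sq_lineDeriv (ψ : 𝓢(R3, ℂ)) :
    ∑ i : Fin 3, ∫ x, ‖(∂_{basisVec i} ψ) x‖ ^ 2 =
      -RCLike.re ⟪(ψ.toLp 2 : L2R3), (Δ ψ).toLp 2⟫_ℂ := by
  have h1 := SchwartzMap.inner_toL2_toL2_eq ψ (Δ ψ)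
  rw [h1]
  have hint : ∀ φ : 𝓢(R3, ℂ), Integrable (fun x => ⟪ψ x, φ x⟫_ℂ) := fun φ => by
    have := L2.integrable_inner (𝕜 := ℂ) (ψ.toLp 2 : L2R3) (φ.toLp 2)
    refine this.congr ?_
    filter_upwards [ψ.coeFn_toLp 2, φ.coeFn_toLp 2] with x hx hx'
    rw [hx, hx']
  rw [← integral_re (hint _)]
  have h2 : ∀ x, RCLike.re ⟪ψ x, (Δ ψ) x⟫_ℂ =
      ∑ i : Fin 3, RCLike.re ⟪ψ x, (∂_{basisVec i} (∂_{basisVec i} ψ)) x⟫_ℂ := fun x => by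
    rw [SchwartzMap.laplacian_eq_sum (EuclideanSpace.basisFun (Fin 3) ℝ), _root_.sum_apply,
      inner_sum, map_sum]
  simp only [h2]
  rw [integral_finsetSum _ (fun i _ => (hint _).re), ← Finset.sum_neg_distrib]
  refine Finset.sum_congr rfl fun i _ => ?_
  have h3 := SchwartzMap.integral_bilinear_lineDerivOp_right_eq_neg_left (μ := volume) ψ
    (∂_{basisVec i} ψ) (innerSL ℝ) (basisVec i)
  have h4 : ∀ x, innerSL ℝ ((∂_{basisVec i} ψ) x) ((∂_{basisVec i} ψ) x) =
      ‖(∂_{basisVec i} ψ) x‖ ^ 2 := fun x => by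
    rw [innerSL_apply_apply]; exact real_inner_self_eq_norm_sq _
  simp only [h4] at h3
  rw [← neg_eq_iff_eq_neg, ← h3]
  rfl

lemma integrable_deriv_normSq (ψ : 𝓢(R3, ℂ)) (i : Fin 3) :
    Integrable (fun x => 2 * ⟪ψ x, (∂_{basisVec i} ψ) x⟫_ℝ) := by
  refine ((integrable_norm_sq ψ).add (integrable_norm_sq (∂_{basisVec i} ψ))).mono'
    ((ψ.continuous.inner (∂_{basisVec i} ψ).continuous).const_mul 2).aestronglyMeasurable
    (Eventually.of_forall fun x => ?_)
  rw [Real.norm_eq_abs, abs_mul, abs_two, Pi.add_apply]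
  have := abs_real_inner_le_norm (ψ x) ((∂_{basisVec i} ψ) x)
  nlinarith [sq_nonneg (‖ψ x‖ - ‖(∂_{basisVec i} ψ) x‖)]

/-- The derivative `∂ᵢ (xᵢ / ρ)`. -/
def regDiv (ε : ℝ) (i : Fin 3) (x : R3) : ℝ := (regRadius ε x)⁻¹ - x i ^ 2 / regRadius ε x ^ 3

lemma hasDerivAt_coord_div_regRadius {ε : ℝ} (hε : 0 < ε) (x : R3) (i : Fin 3) :
    HasDerivAt (fun t : ℝ => (x + t • basisVec i) i / regRadius ε (x + t • basisVec i))
      (regDiv ε i x) 0 := by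
  have hρ := regRadius_pos hε x
  have h := (hasDerivAt_coord x i i).div (hasDerivAt_regRadius hε x i)
    (by simpa using hρ.ne')
  simp only [zero_smul, add_zero, if_true] at h
  refine h.congr_deriv ?_
  rw [regDiv]
  field_simp

lemma abs_regDiv_le {ε : ℝ} (hε : 0 < ε) (x : R3) (i : Fin 3) : |regDiv ε i x| ≤ ε⁻¹ := by
  have hρ := regRadius_pos hε x
  have h1 : x i ^ 2 ≤ regRadius ε x ^ 2 := by
    rw [← sq_abs]
    exact pow_le_pow_left₀ (abs_nonneg _) ((abs_coord_le_norm x i).trans (norm_le_regRadius ε x)) 2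
  have h2 : x i ^ 2 / regRadius ε x ^ 3 ≤ (regRadius ε x)⁻¹ := by
    rw [div_le_iff₀ (by positivity)]
    calc x i ^ 2 ≤ regRadius ε x ^ 2 := h1
      _ = _ := by field_simp
  have h3 : (regRadius ε x)⁻¹ ≤ ε⁻¹ := inv_anti₀ hε (le_regRadius ε x)
  rw [regDiv, abs_of_nonneg (by linarith)]
  have : 0 ≤ x i ^ 2 / regRadius ε x ^ 3 := by positivity
  linarith

lemma continuous_regDiv {ε : ℝ} (hε : 0 < ε) (i : Fin 3) : Continuous (regDiv ε i) := by
  unfold regDiv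
  have h := continuous_regRadius ε
  refine (h.inv₀ fun x => (regRadius_pos hε x).ne').sub
    (Continuous.div (by fun_prop) (by fun_prop) fun x => by have := regRadius_pos hε x; positivity)

/-- The divergence of `x/ρ` is `3/ρ - |x|²/ρ³`, and `|x| ≤ ρ`. -/
lemma two_div_regRadius_le {ε : ℝ} (hε : 0 < ε) (x : R3) :
    2 * (regRadius ε x)⁻¹ ≤ ∑ i : Fin 3, regDiv ε i x := by
  have hρ := regRadius_pos hε x
  simp only [regDiv]
  rw [Finset.sum_sub_distrib, ← Finset.sum_div, sum_sq_eq_norm_sq, Finset.sum_const,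
    Finset.card_univ, Fintype.card_fin, nsmul_eq_mul]
  have : ‖x‖ ^ 2 / regRadius ε x ^ 3 ≤ (regRadius ε x)⁻¹ := by
    rw [div_le_iff₀ (by positivity)]
    calc ‖x‖ ^ 2 ≤ regRadius ε x ^ 2 := pow_le_pow_left₀ (norm_nonneg _) (norm_le_regRadius ε x) 2
      _ = _ := by field_simp
  push_cast
  linarith

lemma abs_coord_div_regRadius_le {ε : ℝ} (hε : 0 < ε) (x : R3) (i : Fin 3) :
    |x i / regRadius ε x| ≤ 1 := by
  have hρ := regRadius_pos hε x
  rw [abs_div, abs_of_pos hρ, div_le_one hρ]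
  exact (abs_coord_le_norm x i).trans (norm_le_regRadius ε x)

lemma continuous_coord_div_regRadius {ε : ℝ} (hε : 0 < ε) (i : Fin 3) :
    Continuous (fun x : R3 => x i / regRadius ε x) :=
  Continuous.div (by fun_prop) (continuous_regRadius ε) fun x => (regRadius_pos hε x).ne'

lemma integrable_regDiv_mul {ε : ℝ} (hε : 0 < ε) (i : Fin 3) {g : R3 → ℝ} (hg : Integrable g) :
    Integrable (fun x => regDiv ε i x * g x) :=
  hg.bdd_mul (continuous_regDiv hε i).aestronglyMeasurable
    (Eventually.of_forall fun x => abs_regDiv_le hε x i)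

lemma integrable_coord_div_mul {ε : ℝ} (hε : 0 < ε) (i : Fin 3) {g : R3 → ℝ} (hg : Integrable g) :
    Integrable (fun x => x i / regRadius ε x * g x) :=
  hg.bdd_mul (continuous_coord_div_regRadius hε i).aestronglyMeasurable
    (Eventually.of_forall fun x => abs_coord_div_regRadius_le hε x i)

lemma integral_coord_div_mul_deriv {ε : ℝ} (hε : 0 < ε) (ψ : 𝓢(R3, ℂ)) (i : Fin 3) :
    ∫ x, x i / regRadius ε x * (2 * ⟪ψ x, (∂_{basisVec i} ψ) x⟫_ℝ) =
      -∫ x, regDiv ε i x * ‖ψ x‖ ^ 2 := by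
  refine integral_bilinear_hasLineDerivAt_right_eq_neg_left_of_integrable (v := basisVec i)
    (B := ContinuousLinearMap.mul ℝ ℝ) (f := fun x : R3 => x i / regRadius ε x)
    (g := fun x => ‖ψ x‖ ^ 2) (integrable_regDiv_mul hε i (integrable_norm_sq ψ))
    (integrable_coord_div_mul hε i (integrable_deriv_normSq ψ i))
    (integrable_coord_div_mul hε i (integrable_norm_sq ψ))
    (fun x _ => hasDerivAt_coord_div_regRadius hε x i) (fun x _ => ?_)
  have h : HasLineDerivAt ℝ ψ ((∂_{basisVec i} ψ) x) x (basisVec i) :=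
    (ψ.hasFDerivAt x).hasLineDerivAt (basisVec i)
  have h2 := HasDerivAt.norm_sq (f := fun t : ℝ => ψ (x + t • basisVec i)) h
  simpa [HasLineDerivAt] using h2

/-- Expand `0 ≤ ∫ ‖∇ψ + (α/2)(x/ρ) ψ‖²`. Integrating the cross term by parts produces `-(α/2) ∫
div(x/ρ) |ψ|²`, and `div(x/ρ) ≥ 2/ρ`. The regularisation keeps the field `x/ρ` and its derivatives
bounded. -/
lemma integral_inv_regRadius_le {α ε : ℝ} (hα : 0 < α) (hε : 0 < ε) (ψ : 𝓢(R3, ℂ)) :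
    α * ∫ x, (regRadius ε x)⁻¹ * ‖ψ x‖ ^ 2 ≤
      (∑ i : Fin 3, ∫ x, ‖(∂_{basisVec i} ψ) x‖ ^ 2) + α ^ 2 / 4 * ∫ x, ‖ψ x‖ ^ 2 := by
  have hInv : Integrable (fun x => (regRadius ε x)⁻¹ * ‖ψ x‖ ^ 2) := by
    refine (integrable_norm_sq ψ).bdd_mul (c := ε⁻¹)
      ((continuous_regRadius ε).inv₀ fun x => (regRadius_pos hε x).ne').aestronglyMeasurable
      (Eventually.of_forall fun x => ?_)
    rw [Real.norm_eq_abs, abs_of_nonneg (inv_nonneg.2 (regRadius_pos hε x).le)]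
    exact inv_anti₀ hε (le_regRadius ε x)
  have h1 : 2 * ∫ x, (regRadius ε x)⁻¹ * ‖ψ x‖ ^ 2 ≤
      ∑ i : Fin 3, ∫ x, regDiv ε i x * ‖ψ x‖ ^ 2 := by
    rw [← integral_finsetSum _ fun i _ => integrable_regDiv_mul hε i (integrable_norm_sq ψ),
      ← integral_const_mul]
    refine integral_mono (hInv.const_mul 2) (integrable_finsetSum _ fun i _ =>
      integrable_regDiv_mul hε i (integrable_norm_sq ψ)) fun x => ?_
    simp only
    rw [← mul_assoc, ← Finset.sum_mul]
    exact mul_le_mul_of_nonneg_right (two_div_regRadius_le hε x) (sq_nonneg _)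
  have hI : ∀ i : Fin 3, Integrable (fun x => ‖(∂_{basisVec i} ψ) x‖ ^ 2 +
      α / 2 * (x i / regRadius ε x * (2 * ⟪ψ x, (∂_{basisVec i} ψ) x⟫_ℝ))) := fun i =>
    (integrable_norm_sq _).add
      ((integrable_coord_div_mul hε i (integrable_deriv_normSq ψ i)).const_mul _)
  have h2 : 0 ≤ ∫ x, (∑ i : Fin 3, (‖(∂_{basisVec i} ψ) x‖ ^ 2 +
      α / 2 * (x i / regRadius ε x * (2 * ⟪ψ x, (∂_{basisVec i} ψ) x⟫_ℝ)))) +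
        α ^ 2 / 4 * ‖ψ x‖ ^ 2 := by
    refine integral_nonneg fun x => ?_
    have hρ := regRadius_pos hε x
    have hs : ∑ i : Fin 3, (x i / regRadius ε x) ^ 2 ≤ 1 := by
      simp only [div_pow]
      rw [← Finset.sum_div, sum_sq_eq_norm_sq, div_le_one (by positivity)]
      exact pow_le_pow_left₀ (norm_nonneg _) (norm_le_regRadius ε x) 2
    have hn : ∀ i : Fin 3, 0 ≤ ‖(∂_{basisVec i} ψ) x + (α / 2 * (x i / regRadius ε x)) • ψ x‖ ^ 2 :=
      fun i => sq_nonneg _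
    have hn' := Finset.sum_nonneg fun i (_ : i ∈ Finset.univ) => hn i
    -- The complete square. Replacing `|x/ρ|² ≤ 1` by `1` in its last term only enlarges the sum.
    have he : ∑ i : Fin 3, ‖(∂_{basisVec i} ψ) x + (α / 2 * (x i / regRadius ε x)) • ψ x‖ ^ 2 =
        (∑ i : Fin 3, (‖(∂_{basisVec i} ψ) x‖ ^ 2 +
      α / 2 * (x i / regRadius ε x * (2 * ⟪ψ x, (∂_{basisVec i} ψ) x⟫_ℝ)))) +
        α ^ 2 / 4 * ‖ψ x‖ ^ 2 * ∑ i : Fin 3, (x i / regRadius ε x) ^ 2 := by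
      rw [Finset.mul_sum, ← Finset.sum_add_distrib]
      refine Finset.sum_congr rfl fun i _ => ?_
      rw [norm_add_sq_real, inner_smul_right, norm_smul, mul_pow, Real.norm_eq_abs, sq_abs,
        real_inner_comm]
      ring
    rw [he] at hn'
    have : α ^ 2 / 4 * ‖ψ x‖ ^ 2 * ∑ i : Fin 3, (x i / regRadius ε x) ^ 2 ≤
        α ^ 2 / 4 * ‖ψ x‖ ^ 2 := mul_le_of_le_one_right (by positivity) hs
    simp only [Pi.zero_apply]
    linarith
  rw [integral_add (integrable_finsetSum _ fun i _ => hI i)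
    ((integrable_norm_sq ψ).const_mul _), integral_finsetSum _ fun i _ => hI i,
    integral_const_mul] at h2
  have h3 : ∀ i : Fin 3, ∫ x, (‖(∂_{basisVec i} ψ) x‖ ^ 2 +
      α / 2 * (x i / regRadius ε x * (2 * ⟪ψ x, (∂_{basisVec i} ψ) x⟫_ℝ))) =
      (∫ x, ‖(∂_{basisVec i} ψ) x‖ ^ 2) - α / 2 * ∫ x, regDiv ε i x * ‖ψ x‖ ^ 2 := fun i => by
    rw [integral_add (integrable_norm_sq _)
      ((integrable_coord_div_mul hε i (integrable_deriv_normSq ψ i)).const_mul _),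
      integral_const_mul, integral_coord_div_mul_deriv hε]
    ring
  simp only [h3] at h2
  rw [Finset.sum_sub_distrib, ← Finset.mul_sum] at h2
  nlinarith

/-- The limit `ε → 0⁺`; since `ρ ≥ |x|`, the Coulomb integrand itself dominates. -/
lemma integral_inv_norm_le {α : ℝ} (hα : 0 < α) (ψ : 𝓢(R3, ℂ)) :
    α * ∫ x, ‖x‖⁻¹ * ‖ψ x‖ ^ 2 ≤
      (∑ i : Fin 3, ∫ x, ‖(∂_{basisVec i} ψ) x‖ ^ 2) + α ^ 2 / 4 * ∫ x, ‖ψ x‖ ^ 2 := by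
  have hint : Integrable (fun x => ‖x‖⁻¹ * ‖ψ x‖ ^ 2) := by
    refine ((integrable_sq_norm_coulomb ψ).add (integrable_norm_sq ψ)).mono'
      (measurable_inv_norm.aestronglyMeasurable.mul
        (ψ.continuous.norm.pow 2).aestronglyMeasurable) (Eventually.of_forall fun x => ?_)
    rw [Real.norm_eq_abs, abs_of_nonneg (by positivity), Pi.add_apply, norm_mul, mul_pow,
      Complex.norm_real, Real.norm_eq_abs, sq_abs]
    nlinarith [sq_nonneg ‖ψ x‖, sq_nonneg (‖x‖⁻¹ - 1), inv_nonneg.2 (norm_nonneg x),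
      mul_nonneg (sq_nonneg (‖x‖⁻¹ - 1)) (sq_nonneg ‖ψ x‖),
      mul_nonneg (inv_nonneg.2 (norm_nonneg x)) (sq_nonneg ‖ψ x‖)]
  have hlim : Tendsto (fun ε : ℝ => ∫ x, (regRadius ε x)⁻¹ * ‖ψ x‖ ^ 2) (𝓝[>] 0)
      (𝓝 (∫ x, ‖x‖⁻¹ * ‖ψ x‖ ^ 2)) := by
    refine tendsto_integral_filter_of_dominated_convergence _ ?_ ?_ hint ?_
    · filter_upwards [self_mem_nhdsWithin] with ε hε
      exact ((continuous_regRadius ε).measurable.inv.aestronglyMeasurable.mul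
        (ψ.continuous.norm.pow 2).aestronglyMeasurable)
    · filter_upwards [self_mem_nhdsWithin] with ε hε
      filter_upwards [compl_mem_ae_iff.2 (measure_singleton (0 : R3))] with x hx
      have hx' : 0 < ‖x‖ := norm_pos_iff.2 hx
      have := inv_anti₀ hx' (norm_le_regRadius ε x)
      rw [Real.norm_eq_abs, abs_of_nonneg (mul_nonneg
        (inv_nonneg.2 (regRadius_pos hε x).le) (sq_nonneg _))]
      gcongr
    · filter_upwards [compl_mem_ae_iff.2 (measure_singleton (0 : R3))] with x hx
      have hx' : 0 < ‖x‖ := norm_pos_iff.2 hx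
      refine Tendsto.mul_const _ (Tendsto.inv₀ ?_ hx'.ne')
      have hc : Continuous (fun ε : ℝ => regRadius ε x) := by unfold regRadius; fun_prop
      have := (hc.tendsto 0).mono_left (nhdsWithin_le_nhds (s := Ioi 0))
      simpa [regRadius, Real.sqrt_sq (norm_nonneg x)] using this
  refine le_of_tendsto (hlim.const_mul α) ?_
  filter_upwards [self_mem_nhdsWithin] with ε hε
  exact integral_inv_regRadius_le hα hε ψ

lemma re_inner_hydrogenSchwartz {α : ℝ} (hα : 0 < α) (ψ : 𝓢(R3, ℂ)) :
    groundEnergy α * ‖(ψ.toLp 2 : L2R3)‖ ^ 2 ≤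
      RCLike.re ⟪(ψ.toLp 2 : L2R3), hydrogenSchwartz α ψ⟫_ℂ := by
  have h1 := integral_inv_norm_le hα ψ
  rw [sum_norm_sq_lineDeriv, ← norm_toLp_sq] at h1
  have h2 : RCLike.re ⟪(ψ.toLp 2 : L2R3), coulombLp ψ⟫_ℂ = ∫ x, ‖x‖⁻¹ * ‖ψ x‖ ^ 2 := by
    rw [L2.inner_def, ← integral_re (L2.integrable_inner _ _)]
    refine integral_congr_ae ?_
    filter_upwards [ψ.coeFn_toLp 2, (memLp_inv_norm_mul ψ).coeFn_toLp] with x hx hx'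
    rw [coulombLp, hx, hx', ← smul_eq_mul, inner_smul_right, inner_self_eq_norm_sq_to_K,
      ← RCLike.ofReal_pow]
    exact (Complex.re_ofReal_mul _ _).trans (congrArg _ (Complex.ofReal_re _))
  rw [hydrogenSchwartz, inner_sub_right, inner_neg_right, inner_smul_right, map_sub, map_neg]
  have h3 : RCLike.re ((α : ℂ) * ⟪(ψ.toLp 2 : L2R3), coulombLp ψ⟫_ℂ) =
      α * RCLike.re ⟪(ψ.toLp 2 : L2R3), coulombLp ψ⟫_ℂ := Complex.re_ofReal_mul _ _
  rw [h3, h2, groundEnergy]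
  linarith

lemma hydrogen_bounded_below {α : ℝ} (hα : 0 < α) (ψ : (hydrogen α).domain) :
    groundEnergy α * ‖(ψ : L2R3)‖ ^ 2 ≤ RCLike.re ⟪(ψ : L2R3), hydrogen α ψ⟫_ℂ := by
  obtain ⟨f, hf, hf'⟩ := exists_seq_hydrogenSchwartz ψ
  exact le_of_tendsto_of_tendsto' ((hf.norm.pow 2).const_mul _)
    ((RCLike.continuous_re.tendsto _).comp (hf.inner hf')) fun n =>
      re_inner_hydrogenSchwartz hα (f n)

section SpectralTheory

variable {H : Type*} [NormedAddCommGroup H] [InnerProductSpace ℂ H]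

/-! ### Spectral measures of bounded self-adjoint operators -/

/-- Riesz-Markov on the compact spectrum: `f ↦ Re ⟨v, f(B) v⟩` is positive because `f = (√f)²` and
`√f(B)` is self-adjoint. The measure is then pushed forward to the line. -/
lemma exists_measure_cfc [CompleteSpace H] {B : H →L[ℂ] H} (hB : IsSelfAdjoint B) (v : H) :
    ∃ ρ : Measure ℝ, IsFiniteMeasure ρ ∧ ∀ f : ℝ → ℝ, Continuous f →
      Integrable f ρ ∧ ⟪v, cfc f B v⟫_ℂ = ((∫ s, f s ∂ρ : ℝ) : ℂ) := by
  let Φ : C(spectrum ℝ B, ℝ) →⋆ₐ[ℝ] (H →L[ℂ] H) := cfcHom hB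
  let Λ₀ : CompactlySupportedContinuousMap (spectrum ℝ B) ℝ →ₗ[ℝ] ℝ :=
    { toFun := fun f => RCLike.re ⟪v, Φ f.toContinuousMap v⟫_ℂ
      map_add' := fun f g => by
        have : (f + g).toContinuousMap = f.toContinuousMap + g.toContinuousMap := rfl
        rw [this, map_add, _root_.add_apply, inner_add_right, map_add]
      map_smul' := fun r f => by
        have : (r • f).toContinuousMap = r • f.toContinuousMap := rfl
        rw [this, map_smul, _root_.smul_apply, ← Complex.coe_smul, inner_smul_right]
        exact Complex.re_ofReal_mul _ _ }
  have hΛ₀ : ∀ f, 0 ≤ f → 0 ≤ Λ₀ f := fun f hf => by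
    change 0 ≤ RCLike.re ⟪v, Φ f.toContinuousMap v⟫_ℂ
    set g : C(spectrum ℝ B, ℝ) := ⟨fun s => √(f s), by fun_prop⟩
    have hg : f.toContinuousMap = star g * g := by
      ext s
      exact (Real.mul_self_sqrt (hf s)).symm
    rw [hg, map_mul, map_star, ContinuousLinearMap.star_eq_adjoint,
      mul_apply_eq_comp, ContinuousLinearMap.adjoint_inner_right]
    exact inner_self_nonneg
  let Λ := PositiveLinearMap.mk₀ Λ₀ hΛ₀
  refine ⟨(RealRMK.rieszMeasure Λ).map Subtype.val, inferInstance, fun f hf => ?_⟩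
  have hint : Integrable f ((RealRMK.rieszMeasure Λ).map Subtype.val) := by
    rw [integrable_map_measure hf.aestronglyMeasurable measurable_subtype_coe.aemeasurable]
    have hc : Continuous (f ∘ (Subtype.val : spectrum ℝ B → ℝ)) := by fun_prop
    exact hc.integrable_of_hasCompactSupport (HasCompactSupport.of_compactSpace _)
  refine ⟨hint, ?_⟩
  rw [integral_map measurable_subtype_coe.aemeasurable hf.aestronglyMeasurable]
  let f' : CompactlySupportedContinuousMap (spectrum ℝ B) ℝ :=
    ⟨⟨fun s => f s, by fun_prop⟩, HasCompactSupport.of_compactSpace _⟩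
  have h1 : ∫ s : spectrum ℝ B, f s ∂(RealRMK.rieszMeasure Λ) = Λ f' :=
    RealRMK.integral_rieszMeasure Λ f'
  have h2 : Φ f'.toContinuousMap = cfc f B := (cfc_apply f B hB hf.continuousOn).symm
  have h3 : Λ f' = RCLike.re ⟪v, cfc f B v⟫_ℂ := by
    rw [← h2]; rfl
  rw [h1, h3]
  have h4 : (cfc f B).IsSymmetric :=
    ContinuousLinearMap.isSelfAdjoint_iff_isSymmetric.1 (cfc_predicate f B)
  rw [← inner_conj_symm]
  have h5 : (starRingEnd ℂ) ⟪v, cfc f B v⟫_ℂ = ⟪v, cfc f B v⟫_ℂ := by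
    rw [inner_conj_symm]; exact h4 v v
  rw [inner_conj_symm]
  exact (Complex.conj_eq_iff_re.1 h5).symm

/-! ### Existence of spectral measures -/

/-- Symmetric operators `T : D(T) → H`. -/
def IsSymmetricOp (T : H →ₗ.[ℂ] H) : Prop := ∀ x y : T.domain, ⟪T x, (y : H)⟫_ℂ = ⟪(x : H), T y⟫_ℂ

/-- Coercivity makes `T + c` injective with inverse bounded by `m⁻¹`, and symmetry of `T` passes to
the inverse. -/
lemma exists_bounded_inverse [CompleteSpace H] {T : H →ₗ.[ℂ] H} (hT : IsSymmetricOp T) {c m : ℝ}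
    (hm : 0 < m) (hpos : ∀ x : T.domain, m * ‖(x : H)‖ ^ 2 ≤
      RCLike.re ⟪(x : H), T x + (c : ℂ) • (x : H)⟫_ℂ)
    (hsurj : ∀ f : H, ∃ x : T.domain, T x + (c : ℂ) • (x : H) = f) :
    ∃ B : H →L[ℂ] H, IsSelfAdjoint B ∧
      ∀ f, ∃ x : T.domain, (x : H) = B f ∧ T x + (c : ℂ) • (x : H) = f := by
  have hbound : ∀ x : T.domain, ‖(x : H)‖ ≤ m⁻¹ * ‖T x + (c : ℂ) • (x : H)‖ := fun x => by
    rw [le_inv_mul_iff₀ hm]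
    have h1 := (hpos x).trans ((RCLike.re_le_norm _).trans (norm_inner_le_norm _ _))
    rcases (norm_nonneg (x : H)).eq_or_lt with h | h
    · rw [← h, mul_zero]; exact norm_nonneg _
    · nlinarith
  have hinj : ∀ x y : T.domain, T x + (c : ℂ) • (x : H) = T y + (c : ℂ) • (y : H) → x = y := by
    intro x y h
    have h1 := hbound (x - y)
    have h2 : T (x - y) + (c : ℂ) • ((x - y : T.domain) : H) = 0 := by
      rw [T.map_sub, Submodule.coe_sub, smul_sub, ← sub_eq_zero.2 h]; abel
    rw [h2, norm_zero, mul_zero, norm_le_zero_iff, Submodule.coe_sub, sub_eq_zero] at h1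
    exact Subtype.ext h1
  choose R hR using hsurj
  have hadd : ∀ f g, R (f + g) = R f + R g := fun f g => hinj _ _ (by
    rw [hR, T.map_add, Submodule.coe_add, smul_add, add_add_add_comm, hR, hR])
  have hsmul : ∀ (a : ℂ) f, R (a • f) = a • R f := fun a f => hinj _ _ (by
    rw [hR, T.map_smul, Submodule.coe_smul, smul_comm (c : ℂ) a, ← smul_add, hR])
  let B : H →L[ℂ] H := LinearMap.mkContinuous
    { toFun := fun f => (R f : H)
      map_add' := fun f g => by rw [hadd, Submodule.coe_add]
      map_smul' := fun a f => by rw [hsmul, Submodule.coe_smul, RingHom.id_apply] } m⁻¹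
    (fun f => by
      have h := hbound (R f)
      rw [hR] at h
      exact h)
  refine ⟨B, ContinuousLinearMap.isSelfAdjoint_iff_isSymmetric.2 fun f g => ?_,
    fun f => ⟨R f, rfl, hR f⟩⟩
  change ⟪(R f : H), g⟫_ℂ = ⟪f, (R g : H)⟫_ℂ
  conv_lhs => rw [← hR g]
  conv_rhs => rw [← hR f]
  rw [inner_add_left, inner_add_right, hT, inner_smul_left, inner_smul_right, Complex.conj_ofReal]

/-- The spectral measure of the bounded operator `B = (T + c)⁻¹` is transported by `s ↦ 1/s - c`,
which turns spectral values of `B` into those of `T`. -/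
lemma exists_isSpectralMeasure [CompleteSpace H] {T : H →ₗ.[ℂ] H} (hT : IsSymmetricOp T) {c m : ℝ}
    (hm : 0 < m) (hpos : ∀ x : T.domain, m * ‖(x : H)‖ ^ 2 ≤
      RCLike.re ⟪(x : H), T x + (c : ℂ) • (x : H)⟫_ℂ)
    (hsurj : ∀ f : H, ∃ x : T.domain, T x + (c : ℂ) • (x : H) = f) (v : H) :
    ∃ μ, IsSpectralMeasure T v μ := by
  obtain ⟨B, hB, hBT⟩ := exists_bounded_inverse hT hm hpos hsurj
  obtain ⟨ρ, hρ, hρf⟩ := exists_measure_cfc hB v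
  have hmeas : Measurable (fun s : ℝ => s⁻¹ - c) := by fun_prop
  -- The point `s = 0` corresponds to `t = ∞`. It is removed because `0⁻¹ = 0` would place its mass
  -- at `-c`; the transported resolvent function `s/(1 - ζ s)` vanishes there, so nothing is lost.
  refine ⟨(ρ.restrict {0}ᶜ).map (fun s => s⁻¹ - c), inferInstance, fun z hz => ?_⟩
  set ζ : ℂ := z + c with hζ
  have hζim : ζ.im ≠ 0 := by simpa [hζ] using hz
  -- `p s = |1 - ζ s|²`. The functional calculus of `B` is used for real functions only, so `1/(1 -
  -- ζ s)` is written as `(1 - ζ̄ s)/p s`.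
  set p : ℝ → ℝ := fun s => 1 - 2 * ζ.re * s + (ζ.re ^ 2 + ζ.im ^ 2) * s ^ 2 with hp
  have hp0 : ∀ s, 0 < p s := fun s => by
    have h1 : p s = (1 - ζ.re * s) ^ 2 + (ζ.im * s) ^ 2 := by simp only [hp]; ring
    rw [h1]
    rcases eq_or_ne s 0 with rfl | hs
    · simp
    · have : 0 < (ζ.im * s) ^ 2 := by positivity
      positivity
  have hpc : Continuous p := by fun_prop
  have hpk : ∀ k : ℕ, Continuous (fun s => s ^ k / p s) := fun k =>
    (continuous_pow k).div hpc fun s => (hp0 s).ne'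
  set a : ℕ → H := fun k => cfc (fun s => s ^ k / p s) B v with ha
  have hBa : ∀ k, B (a k) = a (k + 1) := fun k => by
    have h : cfc (fun s => s ^ (k + 1) / p s) B = B * cfc (fun s => s ^ k / p s) B := by
      have h0 := cfc_mul id (fun s => s ^ k / p s) B continuous_id.continuousOn (hpk k).continuousOn
      rw [cfc_id ℝ B hB] at h0
      rw [← h0]
      refine congrArg (fun f => cfc f B) (funext fun s => ?_)
      simp only [id]
      ring
    simp only [ha, h, mul_apply_eq_comp]
  have hsum : a 0 - ((2 * ζ.re : ℝ) : ℂ) • a 1 + ((ζ.re ^ 2 + ζ.im ^ 2 : ℝ) : ℂ) • a 2 = v := by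
    have h1 : cfc (fun s => s ^ 0 / p s - (2 * ζ.re) * (s ^ 1 / p s) +
        (ζ.re ^ 2 + ζ.im ^ 2) * (s ^ 2 / p s)) B = 1 := by
      rw [← cfc_one ℝ B hB]
      refine congrArg (fun f => cfc f B) (funext fun s => ?_)
      have := (hp0 s).ne'
      field_simp
      simp only [hp, Pi.one_apply]
      ring
    have hc1 : Continuous (fun s => (2 * ζ.re) * (s ^ 1 / p s)) := (hpk 1).const_mul _
    have hc2 : Continuous (fun s => (ζ.re ^ 2 + ζ.im ^ 2) * (s ^ 2 / p s)) := (hpk 2).const_mul _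
    rw [cfc_add (a := B) (fun s => s ^ 0 / p s - (2 * ζ.re) * (s ^ 1 / p s))
        (fun s => (ζ.re ^ 2 + ζ.im ^ 2) * (s ^ 2 / p s)) ((hpk 0).sub hc1).continuousOn hc2.continuousOn,
      cfc_sub (a := B) (fun s => s ^ 0 / p s) (fun s => (2 * ζ.re) * (s ^ 1 / p s)) (hpk 0).continuousOn hc1.continuousOn,
      cfc_const_mul _ _ B (hpk 1).continuousOn,
      cfc_const_mul _ _ B (hpk 2).continuousOn] at h1
    have h2 := congrArg (fun A : H →L[ℂ] H => A v) h1
    simp only [_root_.add_apply, _root_.sub_apply, _root_.smul_apply,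
      one_apply_eq_self] at h2
    rw [← Complex.coe_smul, ← Complex.coe_smul] at h2
    exact h2
  set ζ' : ℂ := (starRingEnd ℂ) ζ with hζ'
  -- The argument is `(1 - ζ B)⁻¹ v`, so `w = B (1 - ζ B)⁻¹ v`, which is `(T - z)⁻¹ v` since `z = ζ
  -- - c`.
  obtain ⟨w, hw, hTw⟩ := hBT (a 0 - ζ' • a 1)
  rw [map_sub, map_smul, hBa, hBa] at hw
  have hζsum : ζ + ζ' = ((2 * ζ.re : ℝ) : ℂ) := by
    rw [hζ', Complex.add_conj]
  have hζmul : ζ * ζ' = ((ζ.re ^ 2 + ζ.im ^ 2 : ℝ) : ℂ) := by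
    rw [hζ', Complex.mul_conj, Complex.normSq_apply]; push_cast; ring
  refine ⟨w, ?_, ?_⟩
  · have h1 : T w - z • (w : H) = (T w + (c : ℂ) • (w : H)) - ζ • (w : H) := by
      rw [hζ, add_smul]; abel
    rw [h1, hTw, hw, smul_sub, smul_smul, hζmul]
    conv_rhs => rw [← hsum, ← hζsum, add_smul]
    abel
  · have hcz : ∀ s : ℝ, (p s : ℂ) = (1 - ζ * s) * (1 - ζ' * s) := fun s => by
      have : (1 - ζ * s) * (1 - ζ' * s) = 1 - (ζ + ζ') * s + (ζ * ζ') * s ^ 2 := by ring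
      rw [this, hζsum, hζmul]; simp only [hp]; push_cast; ring
    have hofReal : ∀ f : ℝ → ℝ, ∫ s, (f s : ℂ) ∂ρ = ((∫ s, f s ∂ρ : ℝ) : ℂ) := fun f =>
      integral_ofReal (𝕜 := ℂ)
    have hcm : Measurable (fun t : ℝ => ((t : ℂ) - z)⁻¹) := by fun_prop
    rw [hw, inner_sub_right, inner_smul_right, (hρf _ (hpk 1)).2, (hρf _ (hpk 2)).2,
      integral_map hmeas.aemeasurable hcm.aestronglyMeasurable]
    have hpt : ∀ s : ℝ, s ≠ 0 → (((s⁻¹ - c : ℝ) : ℂ) - z)⁻¹ =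
        ((s ^ 1 / p s : ℝ) : ℂ) - ζ' * ((s ^ 2 / p s : ℝ) : ℂ) := fun s hs => by
      have hs' : (s : ℂ) ≠ 0 := by exact_mod_cast hs
      have hps : (p s : ℂ) ≠ 0 := by exact_mod_cast (hp0 s).ne'
      have h2 : (1 - ζ * s) ≠ 0 := fun h => hps (by rw [hcz, h, zero_mul])
      have h3 : (1 - ζ' * s) ≠ 0 := fun h => hps (by rw [hcz, h, mul_zero])
      have h4 : ((s⁻¹ - c : ℝ) : ℂ) - z = (1 - ζ * s) / s := by
        rw [hζ]; push_cast; field_simp; ring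
      rw [h4, inv_div]
      push_cast
      rw [hcz, div_eq_iff h2, pow_one, mul_div_assoc', ← sub_div, div_mul_eq_mul_div,
        eq_div_iff (mul_ne_zero h2 h3)]
      ring
    rw [setIntegral_congr_fun (measurableSet_singleton (0 : ℝ)).compl fun s hs => hpt s hs,
      setIntegral_eq_integral_of_forall_compl_eq_zero,
      integral_sub (hρf _ (hpk 1)).1.ofReal ((hρf _ (hpk 2)).1.ofReal.const_mul _),
      integral_const_mul, hofReal, hofReal]
    intro s hs
    have : s = 0 := by simpa using hs
    simp [this]

end SpectralTheory

section SpectralConsequences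

variable {H : Type*} [NormedAddCommGroup H] [InnerProductSpace ℂ H] {T : H →ₗ.[ℂ] H}
  {v : H} {μ : Measure ℝ}

/-! ### Consequences of the Cauchy-Stieltjes representation -/

lemma IsSymmetricOp.re_im_inner (hT : IsSymmetricOp T) (E η : ℝ) (w : T.domain) :
    (⟪T w - ((E : ℂ) + η * Complex.I) • (w : H), (w : H)⟫_ℂ).im = η * ‖(w : H)‖ ^ 2 := by
  have h1 : (⟪T w, (w : H)⟫_ℂ).im = 0 := by
    rw [← Complex.conj_eq_iff_im, inner_conj_symm]
    exact (hT w w).symm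
  rw [inner_sub_left, inner_smul_left, Complex.sub_im, h1, inner_self_eq_norm_sq_to_K]
  have h2 : ((starRingEnd ℂ) ((E : ℂ) + η * Complex.I) * ((‖(w : H)‖ : ℂ)) ^ 2) =
      ((E * ‖(w : H)‖ ^ 2 : ℝ) : ℂ) - ((η * ‖(w : H)‖ ^ 2 : ℝ) : ℂ) * Complex.I := by
    simp only [map_add, map_mul, Complex.conj_ofReal, Complex.conj_I]
    push_cast
    ring
  have h3 := congrArg Complex.im h2
  simp only [Complex.sub_im, Complex.ofReal_im, Complex.im_ofReal_mul, Complex.I_im] at h3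
  change 0 - ((starRingEnd ℂ) ((E : ℂ) + η * Complex.I) * ((‖(w : H)‖ : ℂ)) ^ 2).im = _
  rw [h3]; ring

lemma IsSymmetricOp.mul_norm_le (hT : IsSymmetricOp T) (E : ℝ) {η : ℝ} (hη : 0 < η)
    (w : T.domain) :
    η * ‖(w : H)‖ ≤ ‖T w - ((E : ℂ) + η * Complex.I) • (w : H)‖ := by
  have h1 := hT.re_im_inner E η w
  have h2 := (Complex.abs_im_le_norm _).trans
    (norm_inner_le_norm (𝕜 := ℂ) (T w - ((E : ℂ) + η * Complex.I) • (w : H)) (w : H))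
  rw [h1, abs_of_nonneg (by positivity)] at h2
  rcases (norm_nonneg (w : H)).eq_or_lt with h | h
  · rw [← h, mul_zero]; exact norm_nonneg _
  · nlinarith

lemma integrable_inv_sq_add_sq [IsFiniteMeasure μ] (E : ℝ) {η : ℝ} (hη : 0 < η) :
    Integrable (fun t : ℝ => ((t - E) ^ 2 + η ^ 2)⁻¹) μ := by
  have hc : Continuous (fun t : ℝ => ((t - E) ^ 2 + η ^ 2)⁻¹) :=
    Continuous.inv₀ (by fun_prop) fun t => by positivity
  refine (integrable_const ((η ^ 2)⁻¹)).mono' hc.aestronglyMeasurable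
    (Eventually.of_forall fun t => ?_)
  rw [Real.norm_eq_abs, abs_of_nonneg (by positivity)]
  exact inv_anti₀ (by positivity) (by nlinarith [sq_nonneg (t - E)])

/-- The imaginary part of the Cauchy-Stieltjes identity at `z = E + iη`. Every later property of `μ`
is read off from this formula for `‖w‖²`. -/
lemma IsSpectralMeasure.exists_resolvent (hμ : IsSpectralMeasure T v μ) (hT : IsSymmetricOp T)
    (E : ℝ) {η : ℝ} (hη : 0 < η) :
    ∃ w : T.domain, T w - ((E : ℂ) + η * Complex.I) • (w : H) = v ∧
      (⟪v, (w : H)⟫_ℂ).im = η * ‖(w : H)‖ ^ 2 ∧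
      ‖(w : H)‖ ^ 2 = ∫ t, ((t - E) ^ 2 + η ^ 2)⁻¹ ∂μ := by
  have hfin := hμ.1
  obtain ⟨w, hw, hint⟩ := hμ.2 ((E : ℂ) + η * Complex.I) (by simpa using hη.ne')
  have him : (⟪v, (w : H)⟫_ℂ).im = η * ‖(w : H)‖ ^ 2 := by
    rw [← hT.re_im_inner E η w, hw]
  refine ⟨w, hw, him, ?_⟩
  have hpt : ∀ t : ℝ, ((t : ℂ) - ((E : ℂ) + η * Complex.I))⁻¹.im =
      η * ((t - E) ^ 2 + η ^ 2)⁻¹ := fun t => by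
    rw [Complex.inv_im, Complex.normSq_apply]
    simp
    field_simp
  have hI : Integrable (fun t : ℝ => ((t : ℂ) - ((E : ℂ) + η * Complex.I))⁻¹) μ := by
    have hm : Measurable (fun t : ℝ => ((t : ℂ) - ((E : ℂ) + η * Complex.I))⁻¹) := by fun_prop
    refine (integrable_const (η⁻¹)).mono' hm.aestronglyMeasurable (Eventually.of_forall fun t => ?_)
    rw [norm_inv]
    refine inv_anti₀ hη ?_
    have := Complex.abs_im_le_norm ((t : ℂ) - ((E : ℂ) + η * Complex.I))
    simpa [abs_of_pos hη] using this
  have h2 : (⟪v, (w : H)⟫_ℂ).im = η * ∫ t, ((t - E) ^ 2 + η ^ 2)⁻¹ ∂μ := by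
    rw [hint, ← integral_const_mul]
    have := integral_im (𝕜 := ℂ) hI
    simp only [RCLike.im_eq_complex_im] at this
    rw [← this]
    exact integral_congr_ae (Eventually.of_forall hpt)
  exact mul_left_cancel₀ hη.ne' (him.symm.trans h2)

/-- On the window of half-width `η` the kernel is at least `1/(2η²)`. Hence a resolvent bound
uniform in `η` forces the mass of windows to be `O(η²)`. -/
lemma IsSpectralMeasure.measureReal_Icc_le (hμ : IsSpectralMeasure T v μ) (hT : IsSymmetricOp T)
    {E η K : ℝ} (hη : 0 < η)
    (hK : ∀ w : T.domain, T w - ((E : ℂ) + η * Complex.I) • (w : H) = v → ‖(w : H)‖ ≤ K) :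
    μ.real (Icc (E - η) (E + η)) ≤ 2 * η ^ 2 * K ^ 2 := by
  have hfin := hμ.1
  obtain ⟨w, hw, -, hn⟩ := hμ.exists_resolvent hT E hη
  have h1 : (2 * η ^ 2)⁻¹ * μ.real (Icc (E - η) (E + η)) ≤ ‖(w : H)‖ ^ 2 := by
    rw [hn, mul_comm, ← smul_eq_mul, ← setIntegral_const]
    refine (setIntegral_mono_on (integrable_const _).integrableOn (integrable_inv_sq_add_sq E hη).integrableOn
      measurableSet_Icc fun t ht => ?_).trans
      (setIntegral_le_integral (integrable_inv_sq_add_sq E hη)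
        (Eventually.of_forall fun t => by positivity))
    have : (t - E) ^ 2 ≤ η ^ 2 := by
      rw [← sq_abs (t - E)]
      exact pow_le_pow_left₀ (abs_nonneg _) (abs_le.2 ⟨by linarith [ht.1], by linarith [ht.2]⟩) 2
    exact inv_anti₀ (by positivity) (by linarith)
  have h2 := pow_le_pow_left₀ (norm_nonneg _) (hK w hw) 2
  rw [inv_mul_le_iff₀ (by positivity)] at h1
  exact h1.trans (by gcongr)

/-- Cover the interval by `n + 1` windows of equal width: the total mass is at most `(n + 1) · O((n
+ 1)⁻²)`. -/
lemma measure_eq_zero_of_local_sq {μ : Measure ℝ} [IsFiniteMeasure μ] {a b C : ℝ} (hab : a < b)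
    (h : ∀ E η : ℝ, 0 < η → a ≤ E - η → E + η ≤ b → μ.real (Icc (E - η) (E + η)) ≤ C * η ^ 2) :
    μ (Ico a b) = 0 := by
  rw [← measureReal_eq_zero_iff]
  have key : ∀ n : ℕ, ∀ η : ℝ, 0 < η → a + n * (2 * η) ≤ b →
      μ.real (Ico a (a + n * (2 * η))) ≤ n * (C * η ^ 2) := by
    intro n η hη
    induction n with
    | zero => intro _; simp
    | succ n ih =>
      intro hn
      push_cast at hn ⊢
      have h1 := ih (by linarith)
      have h2 := h (a + n * (2 * η) + η) η hη (by nlinarith [n.cast_nonneg (α := ℝ)]) (by linarith)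
      have h3 : Ico a (a + (n + 1) * (2 * η)) ⊆ Ico a (a + n * (2 * η)) ∪
          Icc (a + n * (2 * η) + η - η) (a + n * (2 * η) + η + η) := by
        intro t ht
        by_cases htn : t < a + n * (2 * η)
        · exact Or.inl ⟨ht.1, htn⟩
        · exact Or.inr ⟨by linarith, by linarith [ht.2]⟩
      have h4 := (measureReal_mono h3 (μ := μ)).trans (measureReal_union_le _ _)
      linarith
  have hlim : Tendsto (fun n : ℕ => C * ((b - a) / 2) ^ 2 / ((n : ℝ) + 1)) atTop (𝓝 0) :=
    tendsto_const_nhds.div_atTop (tendsto_natCast_atTop_atTop.atTop_add tendsto_const_nhds)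
  refine le_antisymm (ge_of_tendsto' hlim fun n => ?_) measureReal_nonneg
  have h1 := key (n + 1) ((b - a) / (2 * ((n : ℝ) + 1))) (by
    have : 0 < b - a := by linarith
    positivity) (by push_cast; field_simp; linarith)
  have h2 : a + ((n + 1 : ℕ) : ℝ) * (2 * ((b - a) / (2 * ((n : ℝ) + 1)))) = b := by
    push_cast; field_simp; ring
  rw [h2] at h1
  refine h1.trans (le_of_eq ?_)
  push_cast
  field_simp

/-- For `E < e` the form bound gives `‖w‖ ≤ ‖v‖/(e - E)` uniformly in `η`, so windows away from `e`
have mass `O(η²)`. Countably many intervals exhaust the half-line. -/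
lemma IsSpectralMeasure.measure_Iio_eq_zero (hμ : IsSpectralMeasure T v μ) (hT : IsSymmetricOp T)
    {e : ℝ} (he : ∀ x : T.domain, e * ‖(x : H)‖ ^ 2 ≤ RCLike.re ⟪(x : H), T x⟫_ℂ) :
    μ (Iio e) = 0 := by
  have hfin := hμ.1
  have hK : ∀ E η : ℝ, E < e → ∀ w : T.domain,
      T w - ((E : ℂ) + η * Complex.I) • (w : H) = v → ‖(w : H)‖ ≤ ‖v‖ / (e - E) := by
    intro E η hE w hw
    have hTw : T w = v + ((E : ℂ) + η * Complex.I) • (w : H) := eq_add_of_sub_eq hw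
    have h1 := he w
    rw [hTw, inner_add_right, inner_smul_right, inner_self_eq_norm_sq_to_K, map_add] at h1
    have h2 : RCLike.re (((E : ℂ) + η * Complex.I) * ((‖(w : H)‖ : ℂ)) ^ 2) =
        E * ‖(w : H)‖ ^ 2 := by
      rw [← Complex.ofReal_pow, mul_comm]
      refine (Complex.re_ofReal_mul _ _).trans ?_
      simp [mul_comm]
    rw [show RCLike.re (((E : ℂ) + η * Complex.I) * ((RCLike.ofReal ‖(w : H)‖ : ℂ)) ^ 2) =
        E * ‖(w : H)‖ ^ 2 from h2] at h1
    have h3 := (RCLike.re_le_norm _).trans (norm_inner_le_norm (𝕜 := ℂ) (w : H) v)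
    rw [le_div_iff₀ (by linarith)]
    rcases (norm_nonneg (w : H)).eq_or_lt with h | h
    · rw [← h, zero_mul]; exact norm_nonneg _
    · nlinarith
  have hIco : ∀ n : ℕ, μ (Ico (e - (n + 2)) (e - 1 / ((n : ℝ) + 1))) = 0 := by
    intro n
    have hn : (0 : ℝ) < 1 / ((n : ℝ) + 1) := by positivity
    have hn1 : 1 / ((n : ℝ) + 1) ≤ 1 := by
      rw [div_le_one (by positivity)]; linarith [n.cast_nonneg (α := ℝ)]
    refine measure_eq_zero_of_local_sq (C := 2 * (‖v‖ * (n + 1)) ^ 2)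
      (by linarith [n.cast_nonneg (α := ℝ)]) fun E η hη h1 h2 => ?_
    have h3 := hμ.measureReal_Icc_le hT (E := E) (K := ‖v‖ * (n + 1)) hη fun w hw => by
      refine (hK E η (by linarith) w hw).trans ?_
      rw [div_le_iff₀ (by linarith), mul_assoc]
      refine le_mul_of_one_le_right (norm_nonneg _) ?_
      have : 1 / ((n : ℝ) + 1) ≤ e - E := by linarith
      rwa [div_le_iff₀' (by positivity)] at this
    linarith
  have hU : Iio e ⊆ ⋃ n : ℕ, Ico (e - (n + 2)) (e - 1 / ((n : ℝ) + 1)) := by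
    intro t ht
    have ht : t < e := ht
    obtain ⟨n₁, hn₁⟩ := exists_nat_gt (e - t)
    obtain ⟨n₂, hn₂⟩ := exists_nat_one_div_lt (sub_pos.2 ht)
    rw [mem_iUnion]
    refine ⟨max n₁ n₂, ?_, ?_⟩
    · have : (n₁ : ℝ) ≤ ((max n₁ n₂ : ℕ) : ℝ) := by exact_mod_cast le_max_left _ _
      linarith
    · have h1 : (n₂ : ℝ) ≤ ((max n₁ n₂ : ℕ) : ℝ) := by exact_mod_cast le_max_right _ _
      have h2 : 1 / (((max n₁ n₂ : ℕ) : ℝ) + 1) ≤ 1 / ((n₂ : ℝ) + 1) := by gcongr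
      linarith
  exact measure_mono_null hU (measure_iUnion_null hIco)

/-- If `v = (T - e) u`, then `(T - e - iη)(w - u) = iη u`, so `‖w - u‖ ≤ ‖u‖` for every `η`. The
window around `e` has mass `O(η²)`, and `η → 0`. -/
lemma IsSpectralMeasure.measure_singleton_eq_zero (hμ : IsSpectralMeasure T v μ)
    (hT : IsSymmetricOp T) {e : ℝ} (u : T.domain) (hu : T u - (e : ℂ) • (u : H) = v) :
    μ {e} = 0 := by
  have hfin := hμ.1
  have h1 : ∀ n : ℕ, μ.real {e} ≤ 2 * (2 * ‖(u : H)‖) ^ 2 * (1 / ((n : ℝ) + 1)) ^ 2 := by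
    intro n
    have hn : (0 : ℝ) < 1 / ((n : ℝ) + 1) := by positivity
    refine (measureReal_mono ?_).trans
      ((hμ.measureReal_Icc_le hT (E := e) (K := 2 * ‖(u : H)‖) hn fun w hw => ?_).trans
        (le_of_eq (by ring)))
    · rintro t rfl
      exact ⟨by linarith, by linarith⟩
    · set η := 1 / ((n : ℝ) + 1)
      have h2 := hT.mul_norm_le e hn (w - u)
      have h3 : T (w - u) - ((e : ℂ) + η * Complex.I) • ((w - u : T.domain) : H) =
          ((η : ℂ) * Complex.I) • (u : H) := by
        rw [T.map_sub, Submodule.coe_sub, smul_sub, sub_sub_sub_comm, hw, add_smul,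
          ← sub_sub, hu]
        abel
      rw [h3, norm_smul, norm_mul, Complex.norm_I, mul_one, Complex.norm_real, Real.norm_eq_abs,
        abs_of_pos hn, mul_le_mul_iff_right₀ hn, Submodule.coe_sub] at h2
      have h4 := norm_add_le ((w : H) - u) (u : H)
      rw [sub_add_cancel] at h4
      linarith
  have h2 := ((tendsto_one_div_add_atTop_nhds_zero_nat (𝕜 := ℝ)).pow 2).const_mul
    (2 * (2 * ‖(u : H)‖) ^ 2)
  rw [zero_pow two_ne_zero, mul_zero] at h2
  rw [← measureReal_eq_zero_iff]
  exact le_antisymm (ge_of_tendsto' h2 h1) measureReal_nonneg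

/-- The defect equals `‖v + iη w‖²`, and `(T - E - iη)(v + iη w) = (T - E) v`; the factor `1/η²` is
the resolvent bound. -/
lemma IsSpectralMeasure.defect (hμ : IsSpectralMeasure T v μ) (hT : IsSymmetricOp T)
    (hv : v ∈ T.domain) (E : ℝ) {η : ℝ} (hη : 0 < η) :
    0 ≤ ‖v‖ ^ 2 - ∫ t, η ^ 2 * ((t - E) ^ 2 + η ^ 2)⁻¹ ∂μ ∧
      ‖v‖ ^ 2 - ∫ t, η ^ 2 * ((t - E) ^ 2 + η ^ 2)⁻¹ ∂μ ≤
        ‖T ⟨v, hv⟩ - (E : ℂ) • v‖ ^ 2 / η ^ 2 := by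
  obtain ⟨w, hw, him, hn⟩ := hμ.exists_resolvent hT E hη
  have h1 : ‖v + ((η : ℂ) * Complex.I) • (w : H)‖ ^ 2 =
      ‖v‖ ^ 2 - ∫ t, η ^ 2 * ((t - E) ^ 2 + η ^ 2)⁻¹ ∂μ := by
    rw [integral_const_mul, ← hn, @norm_add_sq ℂ, inner_smul_right, norm_smul, norm_mul,
      Complex.norm_I, mul_one, Complex.norm_real, Real.norm_eq_abs, abs_of_pos hη, mul_pow]
    have : RCLike.re ((η : ℂ) * Complex.I * ⟪v, (w : H)⟫_ℂ) = -(η * (⟪v, (w : H)⟫_ℂ).im) := by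
      rw [mul_assoc]
      refine (Complex.re_ofReal_mul _ _).trans ?_
      simp
    rw [this, him]
    ring
  rw [← h1]
  refine ⟨by positivity, ?_⟩
  set vd : T.domain := ⟨v, hv⟩
  have h2 := hT.mul_norm_le E hη (vd + ((η : ℂ) * Complex.I) • w)
  have hTw : T w = v + ((E : ℂ) + η * Complex.I) • (w : H) := eq_add_of_sub_eq hw
  have h3 : T (vd + ((η : ℂ) * Complex.I) • w) - ((E : ℂ) + η * Complex.I) •
      ((vd + ((η : ℂ) * Complex.I) • w : T.domain) : H) = T vd - (E : ℂ) • v := by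
    rw [T.map_add, T.map_smul, Submodule.coe_add, Submodule.coe_smul, hTw]
    module
  rw [h3, Submodule.coe_add, Submodule.coe_smul] at h2
  rw [le_div_iff₀ (by positivity), ← mul_pow]
  refine pow_le_pow_left₀ (by positivity) ?_ 2
  rw [mul_comm]
  exact h2

/-- Let `η → ∞` in the defect at `E = 0`: the kernel tends to `1` boundedly. -/
lemma IsSpectralMeasure.measureReal_univ (hμ : IsSpectralMeasure T v μ) (hT : IsSymmetricOp T)
    (hv : v ∈ T.domain) : μ.real univ = ‖v‖ ^ 2 := by
  have hfin := hμ.1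
  have hlim : Tendsto (fun n : ℕ => ∫ t, ((n : ℝ) + 1) ^ 2 *
      ((t - 0) ^ 2 + ((n : ℝ) + 1) ^ 2)⁻¹ ∂μ) atTop (𝓝 (∫ _, (1 : ℝ) ∂μ)) := by
    refine tendsto_integral_of_dominated_convergence (fun _ => (1 : ℝ)) (fun n => ?_)
      (integrable_const _) (fun n => Eventually.of_forall fun t => ?_)
      (Eventually.of_forall fun t => ?_)
    · exact ((integrable_inv_sq_add_sq (0 : ℝ) (by positivity)).const_mul _).aestronglyMeasurable
    · rw [Real.norm_eq_abs, abs_of_nonneg (by positivity), mul_inv_le_iff₀ (by positivity)]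
      nlinarith [sq_nonneg (t - 0)]
    · have h0 : Tendsto (fun n : ℕ => (1 : ℝ) / ((n : ℝ) + 1)) atTop (𝓝 0) :=
        tendsto_one_div_add_atTop_nhds_zero_nat
      have h1 : Tendsto (fun n : ℕ => (((t - 0) * (1 / ((n : ℝ) + 1))) ^ 2 + 1)⁻¹) atTop
          (𝓝 ((((t - 0) * 0) ^ 2 + 1)⁻¹)) :=
        ((((h0.const_mul (t - 0)).pow 2).add_const 1).inv₀ (by simp))
      rw [mul_zero, zero_pow two_ne_zero, zero_add, inv_one] at h1
      refine h1.congr fun n => ?_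
      field_simp
  have hlim2 : Tendsto (fun n : ℕ => ‖v‖ ^ 2 - ∫ t, ((n : ℝ) + 1) ^ 2 *
      ((t - 0) ^ 2 + ((n : ℝ) + 1) ^ 2)⁻¹ ∂μ) atTop (𝓝 0) := by
    have h0 := ((tendsto_one_div_add_atTop_nhds_zero_nat (𝕜 := ℝ)).pow 2).const_mul
      (‖T ⟨v, hv⟩ - ((0 : ℝ) : ℂ) • v‖ ^ 2)
    rw [zero_pow two_ne_zero, mul_zero] at h0
    refine squeeze_zero (fun n => (hμ.defect hT hv 0 (by positivity)).1) (fun n =>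
      ((hμ.defect hT hv 0 (by positivity)).2.trans (le_of_eq ?_))) h0
    rw [one_div, inv_pow, div_eq_mul_inv]
  have := tendsto_nhds_unique hlim2 (hlim.const_sub (‖v‖ ^ 2))
  simp only [integral_const, smul_eq_mul, mul_one] at this
  linarith

/-- Multiply the defect by `η²`: the integrand becomes `(t - E)² η²/((t - E)² + η²)`, which tends to
`(t - E)²`. Fatou's lemma concludes. -/
lemma IsSpectralMeasure.memLp_two (hμ : IsSpectralMeasure T v μ) (hT : IsSymmetricOp T)
    (hv : v ∈ T.domain) (E : ℝ) :
    Integrable (fun t => (t - E) ^ 2) μ ∧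
      ∫ t, (t - E) ^ 2 ∂μ ≤ ‖T ⟨v, hv⟩ - (E : ℂ) • v‖ ^ 2 := by
  have hfin := hμ.1
  set K := ‖T ⟨v, hv⟩ - (E : ℂ) • v‖ ^ 2
  set F : ℕ → ℝ → ℝ := fun n t =>
    ((n : ℝ) + 1) ^ 2 * (1 - ((n : ℝ) + 1) ^ 2 * ((t - E) ^ 2 + ((n : ℝ) + 1) ^ 2)⁻¹) with hF
  have hFint : ∀ n, Integrable (F n) μ := fun n =>
    ((integrable_const _).sub
      ((integrable_inv_sq_add_sq E (by positivity)).const_mul _)).const_mul _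
  have hF0 : ∀ n t, F n t =
      (t - E) ^ 2 * (((n : ℝ) + 1) ^ 2 * ((t - E) ^ 2 + ((n : ℝ) + 1) ^ 2)⁻¹) := fun n t => by
    have : (t - E) ^ 2 + ((n : ℝ) + 1) ^ 2 ≠ 0 := by positivity
    simp only [hF]
    field_simp
    ring
  have hFnn : ∀ n t, 0 ≤ F n t := fun n t => by rw [hF0]; positivity
  have hFle : ∀ n, ∫ t, F n t ∂μ ≤ K := fun n => by
    have hn : (0 : ℝ) < (n : ℝ) + 1 := by positivity
    have h := (hμ.defect hT hv E hn).2
    simp only [hF]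
    rw [integral_const_mul, integral_sub (integrable_const _)
      ((integrable_inv_sq_add_sq E hn).const_mul _), integral_const, smul_eq_mul, mul_one,
      hμ.measureReal_univ hT hv]
    rwa [le_div_iff₀' (by positivity)] at h
  have hlim : ∀ t, Tendsto (fun n => F n t) atTop (𝓝 ((t - E) ^ 2)) := fun t => by
    have h0 : Tendsto (fun n : ℕ => (1 : ℝ) / ((n : ℝ) + 1)) atTop (𝓝 0) :=
      tendsto_one_div_add_atTop_nhds_zero_nat
    have h1 : Tendsto (fun n : ℕ => (t - E) ^ 2 * (((t - E) * (1 / ((n : ℝ) + 1))) ^ 2 + 1)⁻¹) atTop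
        (𝓝 ((t - E) ^ 2 * (((t - E) * 0) ^ 2 + 1)⁻¹)) :=
      ((((h0.const_mul (t - E)).pow 2).add_const 1).inv₀ (by simp)).const_mul _
    rw [mul_zero, zero_pow two_ne_zero, zero_add, inv_one, mul_one] at h1
    refine h1.congr fun n => ?_
    rw [hF0]
    field_simp
  have hlint : ∫⁻ t, ENNReal.ofReal ((t - E) ^ 2) ∂μ ≤ ENNReal.ofReal K := by
    have h1 : ∀ t, ENNReal.ofReal ((t - E) ^ 2) =
        liminf (fun n => ENNReal.ofReal (F n t)) atTop := fun t =>
      (((ENNReal.continuous_ofReal.tendsto _).comp (hlim t)).liminf_eq).symm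
    simp only [h1]
    refine (lintegral_liminf_le' fun n =>
      (hFint n).aestronglyMeasurable.aemeasurable.ennreal_ofReal).trans ?_
    refine liminf_le_of_le (by isBoundedDefault) fun b hb => ?_
    obtain ⟨n, hn⟩ := hb.exists
    refine hn.trans ?_
    rw [← ofReal_integral_eq_lintegral_ofReal (hFint n) (Eventually.of_forall (hFnn n))]
    exact ENNReal.ofReal_le_ofReal (hFle n)
  have hm : AEStronglyMeasurable (fun t => (t - E) ^ 2) μ :=
    (by fun_prop : Continuous fun t : ℝ => (t - E) ^ 2).aestronglyMeasurable
  have hnn : 0 ≤ᵐ[μ] fun t => (t - E) ^ 2 := Eventually.of_forall fun t => sq_nonneg _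
  refine ⟨⟨hm, ?_⟩, ?_⟩
  · rw [hasFiniteIntegral_iff_ofReal hnn]
    exact hlint.trans_lt ENNReal.ofReal_lt_top
  · rw [integral_eq_lintegral_of_nonneg_ae hnn hm]
    exact ENNReal.toReal_le_of_le_ofReal (by positivity) hlint

end SpectralConsequences

/-! ### Functions `xⱼ P(|x|)` with an exponentially decaying profile -/

/-- A profile `P` with derivatives `P'`, `P''` and exponential decay of rate `β`. -/
structure RadialProfile (P P' P'' : ℝ → ℝ) (M β : ℝ) : Prop where
  hasDerivAt : ∀ s, HasDerivAt P (P' s) s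
  hasDerivAt' : ∀ s, HasDerivAt P' (P'' s) s
  continuous'' : Continuous P''
  rate_pos : 0 < β
  bound : ∀ s, 0 ≤ s → (1 + s) * |P s| ≤ M * Real.exp (-β * s)
  bound' : ∀ s, 0 ≤ s → (1 + s) * |P' s| ≤ M * Real.exp (-β * s)
  bound'' : ∀ s, 0 ≤ s → (1 + s) * |P'' s| ≤ M * Real.exp (-β * s)

/-- Half of the decay rate `α/2` is spent on two factors `1 + s ≤ const · e^{α s/8}`, one for the
weight and one for the affine factor. -/
lemma one_add_mul_abs_le {α : ℝ} (hα : 0 < α) (a b : ℝ) {s : ℝ} (hs : 0 ≤ s) :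
    (1 + s) * |(a + b * s) * Real.exp (-α * s / 2)| ≤
      (|a| + |b|) * ((min 1 (α / 8))⁻¹) ^ 2 * Real.exp (-(α / 4) * s) := by
  have hm : 0 < min 1 (α / 8) := lt_min one_pos (by positivity)
  have h1 : 1 + s ≤ (min 1 (α / 8))⁻¹ * Real.exp (α / 8 * s) := by
    rw [le_inv_mul_iff₀ hm]
    have h2 := Real.add_one_le_exp (α / 8 * s)
    have h3 : min 1 (α / 8) * s ≤ α / 8 * s := by gcongr; exact min_le_right _ _
    have h4 : min 1 (α / 8) ≤ 1 := min_le_left _ _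
    linarith
  have h2 : |a + b * s| ≤ (|a| + |b|) * (1 + s) := by
    refine (abs_add_le _ _).trans ?_
    rw [abs_mul, abs_of_nonneg hs]
    nlinarith [abs_nonneg a, abs_nonneg b]
  have h3 : (1 + s) ^ 2 ≤ ((min 1 (α / 8))⁻¹ * Real.exp (α / 8 * s)) ^ 2 :=
    pow_le_pow_left₀ (by linarith) h1 2
  rw [abs_mul, abs_of_pos (Real.exp_pos _)]
  calc (1 + s) * (|a + b * s| * Real.exp (-α * s / 2))
      ≤ (1 + s) * ((|a| + |b|) * (1 + s) * Real.exp (-α * s / 2)) := by gcongr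
    _ = (|a| + |b|) * (1 + s) ^ 2 * Real.exp (-α * s / 2) := by ring
    _ ≤ (|a| + |b|) * ((min 1 (α / 8))⁻¹ * Real.exp (α / 8 * s)) ^ 2 * Real.exp (-α * s / 2) := by
        gcongr
    _ = _ := by
        rw [mul_pow, ← Real.exp_nat_mul, mul_assoc, mul_assoc, mul_assoc, ← Real.exp_add]
        congr 3
        push_cast
        ring

lemma hasDerivAt_affine_mul_exp (α a b s : ℝ) :
    HasDerivAt (fun s => (a + b * s) * Real.exp (-α * s / 2))
      (((b - α / 2 * a) + (-(α / 2) * b) * s) * Real.exp (-α * s / 2)) s := by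
  have h1 : HasDerivAt (fun s => a + b * s) b s := by
    simpa using ((hasDerivAt_id s).const_mul b).const_add a
  have h2 : HasDerivAt (fun s => Real.exp (-α * s / 2)) (Real.exp (-α * s / 2) * (-α / 2)) s := by
    have := (((hasDerivAt_id s).const_mul (-α)).div_const 2).exp
    simpa using this
  refine (h1.mul h2).congr_deriv ?_
  ring

/-- Affine functions times `e^{-α s/2}` are closed under differentiation, so one decay estimate
serves all three bounds. -/
lemma exists_radialProfile {α : ℝ} (hα : 0 < α) (p q : ℝ) :
    ∃ M, RadialProfile (fun s => (p + q * s) * Real.exp (-α * s / 2))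
      (fun s => ((q - α / 2 * p) + (-(α / 2) * q) * s) * Real.exp (-α * s / 2))
      (fun s => ((-(α / 2) * q - α / 2 * (q - α / 2 * p)) +
        (-(α / 2) * (-(α / 2) * q)) * s) * Real.exp (-α * s / 2)) M (α / 4) := by
  set K := ((min 1 (α / 8))⁻¹) ^ 2
  have hK : 0 ≤ K := by positivity
  set c1 := |p| + |q|
  set c2 := |q - α / 2 * p| + |-(α / 2) * q|
  set c3 := |-(α / 2) * q - α / 2 * (q - α / 2 * p)| + |-(α / 2) * (-(α / 2) * q)|
  have h1 : 0 ≤ c1 := by positivity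
  have h2 : 0 ≤ c2 := by positivity
  have h3 : 0 ≤ c3 := by positivity
  refine ⟨(c1 + c2 + c3) * K, fun s => hasDerivAt_affine_mul_exp α p q s,
    fun s => hasDerivAt_affine_mul_exp α _ _ s, by fun_prop, by positivity, fun s hs => ?_,
    fun s hs => ?_, fun s hs => ?_⟩ <;>
  refine (one_add_mul_abs_le hα _ _ hs).trans (mul_le_mul_of_nonneg_right
    (mul_le_mul_of_nonneg_right ?_ hK) (Real.exp_pos _).le) <;>
  linarith

lemma memLp_of_norm_le_exp {f : R3 → ℝ} (hf : AEStronglyMeasurable f volume) {C β : ℝ}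
    (hβ : 0 < β) (hC : ∀ x, |f x| ≤ C * Real.exp (-β * ‖x‖)) :
    MemLp (fun x => (f x : ℂ)) 2 volume := by
  have hm : AEStronglyMeasurable (fun x => (f x : ℂ)) volume :=
    Complex.continuous_ofReal.comp_aestronglyMeasurable hf
  rw [memLp_two_iff_integrable_sq_norm hm]
  have hrad : Integrable (fun x : R3 => (fun r : ℝ => Real.exp (-(2 * β) * r)) ‖x‖) volume := by
    rw [integrable_fun_norm_addHaar volume (f := fun r : ℝ => Real.exp (-(2 * β) * r))]
    have h := integrableOn_rpow_mul_exp_neg_mul_rpow (p := 1) (s := 2) (b := 2 * β)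
      (by norm_num) (by norm_num) (by positivity)
    refine h.congr_fun ?_ measurableSet_Ioi
    intro r hr
    simp
  refine (hrad.const_mul (C ^ 2)).mono' (hm.norm.pow 2) (Eventually.of_forall fun x => ?_)
  rw [Real.norm_eq_abs, abs_of_nonneg (by positivity), Complex.norm_real, Real.norm_eq_abs]
  refine (pow_le_pow_left₀ (abs_nonneg _) (hC x) 2).trans (le_of_eq ?_)
  rw [mul_pow, ← Real.exp_nat_mul]
  congr 2
  push_cast
  ring

section Profile

variable {P P' P'' : ℝ → ℝ} {M β : ℝ}

lemma RadialProfile.const_nonneg (h : RadialProfile P P' P'' M β) : 0 ≤ M := by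
  have := h.bound 0 le_rfl
  simp only [mul_zero, Real.exp_zero, mul_one, add_zero, one_mul] at this
  exact (abs_nonneg _).trans this

lemma RadialProfile.continuous (h : RadialProfile P P' P'' M β) : Continuous P :=
  continuous_iff_continuousAt.2 fun s => (h.hasDerivAt s).continuousAt

lemma RadialProfile.continuous' (h : RadialProfile P P' P'' M β) : Continuous P' :=
  continuous_iff_continuousAt.2 fun s => (h.hasDerivAt' s).continuousAt

lemma abs_coord_mul_le {F : ℝ → ℝ} (hF : ∀ s, 0 ≤ s → (1 + s) * |F s| ≤ M * Real.exp (-β * s))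
    (hβ : 0 < β) (hM : 0 ≤ M) (x : R3) (j : Fin 3) {s : ℝ} (hs : ‖x‖ ≤ s) :
    |x j| * |F s| ≤ M ∧ |F s| ≤ M := by
  have hs0 : 0 ≤ s := (norm_nonneg x).trans hs
  have h1 : M * Real.exp (-β * s) ≤ M :=
    mul_le_of_le_one_right hM (Real.exp_le_one_iff.2 (by nlinarith))
  have h2 := (hF s hs0).trans h1
  have h3 : |x j| * |F s| ≤ s * |F s| := by
    gcongr; exact (abs_coord_le_norm x j).trans hs
  constructor <;> nlinarith [abs_nonneg (F s)]

/-- The first derivative `∂ᵢ (xⱼ P(ρ))`. -/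
def profileDeriv (P P' : ℝ → ℝ) (ε : ℝ) (i j : Fin 3) (x : R3) : ℝ :=
  (if i = j then 1 else 0) * P (regRadius ε x) +
    x j * P' (regRadius ε x) * (x i / regRadius ε x)

/-- The second derivative `∂ᵢ² (xⱼ P(ρ))`. -/
def profileDeriv2 (P' P'' : ℝ → ℝ) (ε : ℝ) (i j : Fin 3) (x : R3) : ℝ :=
  2 * ((if i = j then 1 else 0) * P' (regRadius ε x) * (x i / regRadius ε x)) +
    x j * P'' (regRadius ε x) * (x i / regRadius ε x) ^ 2 +
    x j * P' (regRadius ε x) * regDiv ε i x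

lemma RadialProfile.hasDerivAt_line (h : RadialProfile P P' P'' M β) {ε : ℝ} (hε : 0 < ε)
    (i j : Fin 3) (x : R3) :
    HasDerivAt (fun t : ℝ => (x + t • basisVec i) j * P (regRadius ε (x + t • basisVec i)))
      (profileDeriv P P' ε i j x) 0 := by
  have h1 := (h.hasDerivAt (regRadius ε (x + (0 : ℝ) • basisVec i))).comp (0 : ℝ)
    (hasDerivAt_regRadius hε x i)
  have h2 := (hasDerivAt_coord x i j).mul h1
  refine h2.congr_deriv ?_
  simp only [zero_smul, add_zero, profileDeriv, Function.comp_apply]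
  ring

lemma RadialProfile.hasDerivAt_line' (h : RadialProfile P P' P'' M β) {ε : ℝ} (hε : 0 < ε)
    (i j : Fin 3) (x : R3) :
    HasDerivAt (fun t : ℝ => profileDeriv P P' ε i j (x + t • basisVec i))
      (profileDeriv2 P' P'' ε i j x) 0 := by
  have h1 := (h.hasDerivAt (regRadius ε (x + (0 : ℝ) • basisVec i))).comp (0 : ℝ)
    (hasDerivAt_regRadius hε x i)
  have h2 := (h.hasDerivAt' (regRadius ε (x + (0 : ℝ) • basisVec i))).comp (0 : ℝ)
    (hasDerivAt_regRadius hε x i)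
  have h3 := (h1.const_mul (if i = j then (1 : ℝ) else 0)).add
    (((hasDerivAt_coord x i j).mul h2).mul (hasDerivAt_coord_div_regRadius hε x i))
  refine h3.congr_deriv ?_
  simp only [zero_smul, add_zero, profileDeriv2, Function.comp_apply, Pi.mul_apply]
  ring

/-- The bound is uniform in `ε`, unlike that of `regDiv` alone; it supplies the dominating function
when `ε → 0`. -/
lemma abs_coord_mul_regDiv_le {ε : ℝ} (hε : 0 < ε) (x : R3) (i j : Fin 3) :
    |x j| * |regDiv ε i x| ≤ 1 := by
  have hρ := regRadius_pos hε x
  have h1 : x i ^ 2 ≤ regRadius ε x ^ 2 := by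
    rw [← sq_abs]
    exact pow_le_pow_left₀ (abs_nonneg _) ((abs_coord_le_norm x i).trans (norm_le_regRadius ε x)) 2
  have h2 : x i ^ 2 / regRadius ε x ^ 3 ≤ (regRadius ε x)⁻¹ := by
    rw [div_le_iff₀ (by positivity)]
    calc x i ^ 2 ≤ regRadius ε x ^ 2 := h1
      _ = _ := by field_simp
  have h3 : 0 ≤ x i ^ 2 / regRadius ε x ^ 3 := by positivity
  have h4 : |regDiv ε i x| ≤ (regRadius ε x)⁻¹ := by
    rw [regDiv, abs_of_nonneg (by linarith)]; linarith
  calc |x j| * |regDiv ε i x| ≤ regRadius ε x * (regRadius ε x)⁻¹ := by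
        gcongr; exact (abs_coord_le_norm x j).trans (norm_le_regRadius ε x)
    _ = 1 := mul_inv_cancel₀ hρ.ne'

lemma RadialProfile.abs_profileDeriv_le (h : RadialProfile P P' P'' M β) {ε : ℝ} (hε : 0 < ε)
    (i j : Fin 3) (x : R3) : |profileDeriv P P' ε i j x| ≤ 2 * M := by
  have h1 := (abs_coord_mul_le h.bound h.rate_pos h.const_nonneg x j (norm_le_regRadius ε x)).2
  have h2 := (abs_coord_mul_le h.bound' h.rate_pos h.const_nonneg x j (norm_le_regRadius ε x)).1
  have h3 := abs_coord_div_regRadius_le hε x i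
  have h4 : |if i = j then (1 : ℝ) else 0| ≤ 1 := by split_ifs <;> simp
  refine (abs_add_le _ _).trans ?_
  rw [abs_mul, abs_mul, abs_mul]
  have h5 := mul_le_mul h4 h1 (abs_nonneg _) zero_le_one
  have h6 := mul_le_mul h2 h3 (abs_nonneg _) h.const_nonneg
  linarith

lemma RadialProfile.abs_profileDeriv2_le (h : RadialProfile P P' P'' M β) {ε : ℝ} (hε : 0 < ε)
    (i j : Fin 3) (x : R3) : |profileDeriv2 P' P'' ε i j x| ≤ 4 * M := by
  have h1 := (abs_coord_mul_le h.bound' h.rate_pos h.const_nonneg x j (norm_le_regRadius ε x)).2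
  have h2 := (abs_coord_mul_le h.bound'' h.rate_pos h.const_nonneg x j (norm_le_regRadius ε x)).1
  have h3 := abs_coord_div_regRadius_le hε x i
  have h4 : |if i = j then (1 : ℝ) else 0| ≤ 1 := by split_ifs <;> simp
  have h5 := mul_le_mul h4 h1 (abs_nonneg _) zero_le_one
  have h6 := mul_le_mul h5 h3 (abs_nonneg _) (by linarith [h.const_nonneg])
  have h7 := mul_le_mul h2 (pow_le_pow_left₀ (abs_nonneg _) h3 2) (by positivity) h.const_nonneg
  have h8 := mul_le_mul h1 (abs_coord_mul_regDiv_le hε x i j) (by positivity) h.const_nonneg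
  refine (abs_add_le _ _).trans ((add_le_add_left (abs_add_le _ _) _).trans ?_)
  rw [abs_mul, abs_mul, abs_mul, abs_mul, abs_mul, abs_mul, abs_mul, abs_pow, abs_two]
  nlinarith

lemma RadialProfile.continuous_profile (h : RadialProfile P P' P'' M β) (ε : ℝ) (j : Fin 3) :
    Continuous (fun x : R3 => x j * P (regRadius ε x)) := by
  have h1 := h.continuous
  have h2 := continuous_regRadius ε
  fun_prop

lemma RadialProfile.continuous_profileDeriv (h : RadialProfile P P' P'' M β) {ε : ℝ} (hε : 0 < ε)
    (i j : Fin 3) : Continuous (profileDeriv P P' ε i j) := by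
  have h1 := h.continuous
  have h2 := continuous_regRadius ε
  have h3 := h.continuous'
  have h4 := continuous_coord_div_regRadius hε i
  unfold profileDeriv
  fun_prop

lemma RadialProfile.continuous_profileDeriv2 (h : RadialProfile P P' P'' M β) {ε : ℝ} (hε : 0 < ε)
    (i j : Fin 3) : Continuous (profileDeriv2 P' P'' ε i j) := by
  have h1 := h.continuous''
  have h2 := continuous_regRadius ε
  have h3 := h.continuous'
  have h4 := continuous_coord_div_regRadius hε i
  have h5 := continuous_regDiv hε i
  unfold profileDeriv2
  fun_prop

lemma integrable_bdd_smul_schwartz {f : R3 → ℝ} (hf : Continuous f) {C : ℝ}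
    (hC : ∀ x, |f x| ≤ C) (φ : 𝓢(R3, ℂ)) : Integrable (fun x => f x • φ x) :=
  (φ.integrable (μ := volume)).bdd_smul C hf.aestronglyMeasurable (Eventually.of_forall hC)

lemma integral_smul_lineDerivOp {f f' : R3 → ℝ} (hf : Continuous f) (hf' : Continuous f')
    {C C' : ℝ} (hC : ∀ x, |f x| ≤ C) (hC' : ∀ x, |f' x| ≤ C') (v : R3)
    (hd : ∀ x, HasLineDerivAt ℝ f (f' x) x v) (φ : 𝓢(R3, ℂ)) :
    ∫ x, f x • (∂_{v} φ : 𝓢(R3, ℂ)) x = -∫ x, f' x • φ x := by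
  have hline : ∀ x : R3, HasLineDerivAt ℝ (φ : R3 → ℂ) ((∂_{v} φ : 𝓢(R3, ℂ)) x) x v := fun x =>
    (φ.hasFDerivAt x).hasLineDerivAt v
  exact integral_bilinear_hasLineDerivAt_right_eq_neg_left_of_integrable
    (μ := (volume : Measure R3)) (v := v) (B := ContinuousLinearMap.lsmul ℝ ℝ)
    (f := f) (f' := f') (g := (φ : R3 → ℂ)) (g' := ((∂_{v} φ : 𝓢(R3, ℂ)) : R3 → ℂ))
    (integrable_bdd_smul_schwartz hf' hC' φ) (integrable_bdd_smul_schwartz hf hC _)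
    (integrable_bdd_smul_schwartz hf hC φ) (fun x _ => hd x) (fun x _ => hline x)

lemma RadialProfile.integral_regularised (h : RadialProfile P P' P'' M β) {ε : ℝ} (hε : 0 < ε)
    (j : Fin 3) (φ : 𝓢(R3, ℂ)) :
    ∫ x : R3, (x j * P (regRadius ε x)) • (Δ φ : 𝓢(R3, ℂ)) x =
      ∫ x : R3, (∑ i : Fin 3, profileDeriv2 P' P'' ε i j x) • φ x := by
  have hb : ∀ x : R3, |x j * P (regRadius ε x)| ≤ M := fun x => by
    rw [abs_mul]
    exact (abs_coord_mul_le h.bound h.rate_pos h.const_nonneg x j (norm_le_regRadius ε x)).1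
  have h1 : ∀ i, ∫ x : R3, (x j * P (regRadius ε x)) •
        (∂_{basisVec i} (∂_{basisVec i} φ : 𝓢(R3, ℂ)) : 𝓢(R3, ℂ)) x =
      ∫ x, profileDeriv2 P' P'' ε i j x • φ x := fun i => by
    rw [integral_smul_lineDerivOp (h.continuous_profile ε j) (h.continuous_profileDeriv hε i j) hb
        (h.abs_profileDeriv_le hε i j) _ (h.hasDerivAt_line hε i j),
      integral_smul_lineDerivOp (h.continuous_profileDeriv hε i j)
        (h.continuous_profileDeriv2 hε i j) (h.abs_profileDeriv_le hε i j)
        (h.abs_profileDeriv2_le hε i j) _ (h.hasDerivAt_line' hε i j), neg_neg]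
  simp only [SchwartzMap.laplacian_eq_sum (EuclideanSpace.basisFun (Fin 3) ℝ), _root_.sum_apply,
    Finset.smul_sum, Finset.sum_smul]
  rw [integral_finsetSum _ fun i _ =>
      integrable_bdd_smul_schwartz (h.continuous_profile ε j) hb _,
    integral_finsetSum _ fun i _ => integrable_bdd_smul_schwartz
      (h.continuous_profileDeriv2 hε i j) (h.abs_profileDeriv2_le hε i j) _]
  exact Finset.sum_congr rfl fun i _ => h1 i

/-- At `ε = 0` the bracket is `P'' + 4 P'/r`: the coefficient `2` of the radial Laplacian is raised
by `2` from the cross term with `x_j`. -/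
lemma sum_profileDeriv2 {ε : ℝ} (hε : 0 < ε) (j : Fin 3) (x : R3) :
    ∑ i : Fin 3, profileDeriv2 P' P'' ε i j x =
      x j * (P'' (regRadius ε x) * (‖x‖ ^ 2 / regRadius ε x ^ 2) + P' (regRadius ε x) *
        (5 / regRadius ε x - ‖x‖ ^ 2 / regRadius ε x ^ 3)) := by
  have hρ := regRadius_pos hε x
  simp only [profileDeriv2, regDiv]
  rw [Finset.sum_add_distrib, Finset.sum_add_distrib, ← Finset.mul_sum, ← Finset.mul_sum,
    ← Finset.mul_sum, Finset.sum_sub_distrib]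
  simp only [div_pow]
  rw [← Finset.sum_div, ← Finset.sum_div, sum_sq_eq_norm_sq]
  simp only [ite_mul, one_mul, zero_mul, Finset.sum_ite_eq', Finset.mem_univ, if_true,
    Finset.sum_const, Finset.card_univ, Fintype.card_fin, nsmul_eq_mul]
  push_cast
  ring

lemma tendsto_regRadius (x : R3) : Tendsto (fun ε => regRadius ε x) (𝓝[>] 0) (𝓝 ‖x‖) := by
  have hc : Continuous (fun ε : ℝ => regRadius ε x) := by unfold regRadius; fun_prop
  have := (hc.tendsto 0).mono_left (nhdsWithin_le_nhds (s := Ioi 0))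
  simpa [regRadius, Real.sqrt_sq (norm_nonneg x)] using this

/-- The profile need not be smooth at the origin, so integration by parts is done with the smooth
radius `ρ` and `ε → 0⁺` is taken by dominated convergence. -/
lemma RadialProfile.integral_smul_laplacian (h : RadialProfile P P' P'' M β) (j : Fin 3)
    (φ : 𝓢(R3, ℂ)) :
    ∫ x : R3, (x j * P ‖x‖) • (Δ φ : 𝓢(R3, ℂ)) x =
      ∫ x : R3, (x j * (P'' ‖x‖ + 4 * P' ‖x‖ / ‖x‖)) • φ x := by
  have hne : ∀ᵐ x : R3, x ≠ 0 := compl_mem_ae_iff.2 (measure_singleton (0 : R3))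
  have h1 : Tendsto (fun ε => ∫ x : R3, (x j * P (regRadius ε x)) • (Δ φ : 𝓢(R3, ℂ)) x) (𝓝[>] 0)
      (𝓝 (∫ x : R3, (x j * P ‖x‖) • (Δ φ : 𝓢(R3, ℂ)) x)) := by
    refine tendsto_integral_filter_of_dominated_convergence (fun x => M * ‖(Δ φ : 𝓢(R3, ℂ)) x‖) ?_ ?_
      ((Δ φ : 𝓢(R3, ℂ)).integrable.norm.const_mul M) ?_
    · filter_upwards with ε
      exact ((h.continuous_profile ε j).smul (Δ φ : 𝓢(R3, ℂ)).continuous).aestronglyMeasurable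
    · filter_upwards with ε
      refine Eventually.of_forall fun x => ?_
      rw [norm_smul, Real.norm_eq_abs, abs_mul]
      gcongr
      exact (abs_coord_mul_le h.bound h.rate_pos h.const_nonneg x j (norm_le_regRadius ε x)).1
    · refine Eventually.of_forall fun x => ?_
      exact (((h.continuous.tendsto _).comp (tendsto_regRadius x)).const_mul _).smul_const _
  have h2 : Tendsto (fun ε => ∫ x : R3, (∑ i : Fin 3, profileDeriv2 P' P'' ε i j x) • φ x) (𝓝[>] 0)
      (𝓝 (∫ x : R3, (x j * (P'' ‖x‖ + 4 * P' ‖x‖ / ‖x‖)) • φ x)) := by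
    refine tendsto_integral_filter_of_dominated_convergence (fun x => (∑ _i : Fin 3, 4 * M) * ‖φ x‖)
      ?_ ?_ (φ.integrable.norm.const_mul _) ?_
    · filter_upwards [self_mem_nhdsWithin] with ε hε
      exact ((continuous_finsetSum _ fun i _ => h.continuous_profileDeriv2 hε i j).smul
        φ.continuous).aestronglyMeasurable
    · filter_upwards [self_mem_nhdsWithin] with ε hε
      refine Eventually.of_forall fun x => ?_
      rw [norm_smul, Real.norm_eq_abs]
      gcongr
      exact (Finset.abs_sum_le_sum_abs _ _).trans
        (Finset.sum_le_sum fun i _ => h.abs_profileDeriv2_le hε i j x)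
    · filter_upwards [hne] with x hx
      have hx' : ‖x‖ ≠ 0 := norm_ne_zero_iff.2 hx
      have hr := tendsto_regRadius x
      have e1 : Tendsto (fun ε => x j * (P'' (regRadius ε x) * (‖x‖ ^ 2 / regRadius ε x ^ 2) +
          P' (regRadius ε x) * (5 / regRadius ε x - ‖x‖ ^ 2 / regRadius ε x ^ 3))) (𝓝[>] 0)
          (𝓝 (x j * (P'' ‖x‖ * (‖x‖ ^ 2 / ‖x‖ ^ 2) +
            P' ‖x‖ * (5 / ‖x‖ - ‖x‖ ^ 2 / ‖x‖ ^ 3)))) := by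
        refine Tendsto.const_mul _ (Tendsto.add (Tendsto.mul
          ((h.continuous''.tendsto _).comp hr) (tendsto_const_nhds.div (hr.pow 2) (by positivity)))
          (Tendsto.mul ((h.continuous'.tendsto _).comp hr) (Tendsto.sub
          (tendsto_const_nhds.div hr hx')
          (tendsto_const_nhds.div (hr.pow 3) (by positivity)))))
      have e2 : x j * (P'' ‖x‖ * (‖x‖ ^ 2 / ‖x‖ ^ 2) + P' ‖x‖ * (5 / ‖x‖ - ‖x‖ ^ 2 / ‖x‖ ^ 3)) =
          x j * (P'' ‖x‖ + 4 * P' ‖x‖ / ‖x‖) := by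
        field_simp
        ring
      rw [e2] at e1
      refine Tendsto.smul_const (e1.congr' ?_) _
      filter_upwards [self_mem_nhdsWithin] with ε hε
      exact (sum_profileDeriv2 hε j x).symm
  refine tendsto_nhds_unique h1 (h2.congr' ?_)
  filter_upwards [self_mem_nhdsWithin] with ε hε
  exact (h.integral_regularised hε j φ).symm

lemma RadialProfile.memLp (h : RadialProfile P P' P'' M β) (j : Fin 3) :
    MemLp (fun x : R3 => ((x j * P ‖x‖ : ℝ) : ℂ)) 2 volume := by
  have hc := h.continuous
  refine memLp_of_norm_le_exp (C := M) (by fun_prop : Continuous _).aestronglyMeasurable h.rate_pos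
    fun x => ?_
  rw [abs_mul]
  refine le_trans ?_ (h.bound ‖x‖ (norm_nonneg x))
  gcongr
  linarith [abs_coord_le_norm x j]

lemma RadialProfile.memLp_laplacian (h : RadialProfile P P' P'' M β) (j : Fin 3) :
    MemLp (fun x : R3 => ((x j * (P'' ‖x‖ + 4 * P' ‖x‖ / ‖x‖) : ℝ) : ℂ)) 2 volume := by
  have h1 := h.continuous''.measurable
  have h2 := h.continuous'.measurable
  have h3 : Measurable (fun x : R3 => x j) := by fun_prop
  refine memLp_of_norm_le_exp (C := 5 * M)
    (h3.mul ((h1.comp measurable_norm).add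
      (((h2.comp measurable_norm).const_mul 4).div measurable_norm))).aestronglyMeasurable
    h.rate_pos fun x => ?_
  have b1 := h.bound'' ‖x‖ (norm_nonneg x)
  have b2 := h.bound' ‖x‖ (norm_nonneg x)
  have hx := abs_coord_le_norm x j
  have e1 : |x j| * |4 * P' ‖x‖ / ‖x‖| ≤ 4 * |P' ‖x‖| := by
    rw [abs_div, abs_mul, abs_norm, abs_of_pos (by norm_num : (0 : ℝ) < 4)]
    rcases (norm_nonneg x).eq_or_lt with h0 | h0
    · rw [← h0]; simp
    · rw [← mul_div_assoc, div_le_iff₀ h0]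
      nlinarith [abs_nonneg (P' ‖x‖)]
  rw [abs_mul]
  have e2 := mul_le_mul_of_nonneg_left (abs_add_le (P'' ‖x‖) (4 * P' ‖x‖ / ‖x‖)) (abs_nonneg (x j))
  have e3 := mul_le_mul_of_nonneg_right hx (abs_nonneg (P'' ‖x‖))
  nlinarith [abs_nonneg (P' ‖x‖), abs_nonneg (P'' ‖x‖), norm_nonneg x,
    mul_nonneg (norm_nonneg x) (abs_nonneg (P' ‖x‖))]

lemma RadialProfile.laplacian (h : RadialProfile P P' P'' M β) (j : Fin 3) :
    Δ (toDistribution (h.memLp j).toLp) = toDistribution (h.memLp_laplacian j).toLp := by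
  ext u
  rw [TemperedDistribution.laplacian_apply_apply, Lp.toTemperedDistributionCLM_apply,
    Lp.toTemperedDistributionCLM_apply, Lp.toTemperedDistribution_apply,
    Lp.toTemperedDistribution_apply]
  have h1 : ∫ x, (Δ u : 𝓢(R3, ℂ)) x • ((h.memLp j).toLp : L2R3) x =
      ∫ x : R3, (x j * P ‖x‖) • (Δ u : 𝓢(R3, ℂ)) x := by
    refine integral_congr_ae ?_
    filter_upwards [(h.memLp j).coeFn_toLp] with x hx
    rw [hx, smul_eq_mul, Complex.real_smul, mul_comm]
  have h2 : ∫ x, u x • ((h.memLp_laplacian j).toLp : L2R3) x =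
      ∫ x : R3, (x j * (P'' ‖x‖ + 4 * P' ‖x‖ / ‖x‖)) • u x := by
    refine integral_congr_ae ?_
    filter_upwards [(h.memLp_laplacian j).coeFn_toLp] with x hx
    rw [hx, smul_eq_mul, Complex.real_smul, mul_comm]
  rw [h1, h2, h.integral_smul_laplacian]

end Profile

/-- `(h_α - e_α) (xⱼ (p + q r) e^{-α r / 2}) = xⱼ (2 α q + (α p - 4 q) / r) e^{-α r / 2}`. -/
lemma exists_hydrogen_profile {α : ℝ} (hα : 0 < α) (p q : ℝ) (j : Fin 3) :
    ∃ V : (hydrogen α).domain,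
      ((V : L2R3) =ᵐ[volume] fun x : R3 =>
        ((x j * ((p + q * ‖x‖) * Real.exp (-α * ‖x‖ / 2)) : ℝ) : ℂ)) ∧
      ((hydrogen α V - (groundEnergy α : ℂ) • (V : L2R3) : L2R3) =ᵐ[volume] fun x : R3 =>
        ((x j * ((2 * α * q + (α * p - 4 * q) / ‖x‖) * Real.exp (-α * ‖x‖ / 2)) : ℝ) : ℂ)) := by
  obtain ⟨M, h⟩ := exists_radialProfile hα p q
  obtain ⟨hS, hL⟩ := exists_mem_sobolevTwo (h.laplacian j)
  have hD := mem_hydrogen_domain (α := α).2 hS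
  have hV := sobolevTwo_le_mulDomain hS
  refine ⟨⟨_, hD⟩, (h.memLp j).coeFn_toLp, ?_⟩
  rw [hydrogen_apply hD hS hV, hL]
  have hne : ∀ᵐ x : R3, x ≠ 0 := compl_mem_ae_iff.2 (measure_singleton (0 : R3))
  set A : L2R3 := (h.memLp_laplacian j).toLp
  set V : L2R3 := (h.memLp j).toLp
  set W : L2R3 := mulOperator (fun x : R3 => ‖x‖⁻¹) ⟨V, hV⟩
  have hW : W =ᵐ[volume] fun x => ((‖x‖⁻¹ : ℝ) : ℂ) * V x :=
    MemLp.coeFn_toLp (mem_mulDomain.1 hV)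
  filter_upwards [hne, Lp.coeFn_sub (-A - (α : ℂ) • W) ((groundEnergy α : ℂ) • V),
    Lp.coeFn_sub (-A) ((α : ℂ) • W), Lp.coeFn_neg A, Lp.coeFn_smul (α : ℂ) W,
    Lp.coeFn_smul (groundEnergy α : ℂ) V, hW, (h.memLp j).coeFn_toLp,
    (h.memLp_laplacian j).coeFn_toLp] with x hx e1 e2 e3 e4 e5 e6 e7 e8
  rw [e1, Pi.sub_apply, e2, Pi.sub_apply, e3, Pi.neg_apply, e4, Pi.smul_apply, e5, Pi.smul_apply,
    e6, e7, e8, smul_eq_mul, smul_eq_mul]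
  have hx' : ‖x‖ ≠ 0 := norm_ne_zero_iff.2 hx
  norm_cast
  rw [groundEnergy]
  field_simp
  ring

/-! ### The spectral measures of the hydrogen Hamiltonian at `x u_α` -/

/-- A large `c` satisfies both the contraction condition and `e_α + c > 0`. -/
lemma exists_hydrogen_shift {α : ℝ} (hα : 0 < α) :
    ∃ c m : ℝ, 0 < m ∧ (∀ x : (hydrogen α).domain, m * ‖(x : L2R3)‖ ^ 2 ≤
        RCLike.re ⟪(x : L2R3), hydrogen α x + (c : ℂ) • (x : L2R3)⟫_ℂ) ∧
      ∀ f : L2R3, ∃ x : (hydrogen α).domain, hydrogen α x + (c : ℂ) • (x : L2R3) = f := by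
  have hlim : Tendsto (fun c => α * √(relativeBound c)) atTop (𝓝 0) := by
    have := (tendsto_relativeBound.sqrt).const_mul α
    simpa using this
  obtain ⟨c, hc, hc1, hc2⟩ := ((hlim.eventually (ge_mem_nhds (by norm_num : (0 : ℝ) < 1 / 2))).and
    ((eventually_ge_atTop 1).and (eventually_gt_atTop (α ^ 2 / 4)))).exists
  refine ⟨c, groundEnergy α + c, by rw [groundEnergy]; linarith, fun x => ?_,
    exists_hydrogen_add_smul_eq hα hc1 hc⟩
  rw [inner_add_right, inner_smul_right, map_add, inner_self_eq_norm_sq_to_K, add_mul]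
  refine add_le_add (hydrogen_bounded_below hα x) (le_of_eq ?_)
  norm_cast
  exact (RCLike.re_ofReal_mul (K := ℂ) c _).trans (by norm_cast) |>.symm

/-- Ensures that the choice in `spectralMeasure` is not its default value `0`. -/
lemma isSpectralMeasure_hydrogen {α : ℝ} (hα : 0 < α) (v : L2R3) :
    IsSpectralMeasure (hydrogen α) v (spectralMeasure (hydrogen α) v) := by
  obtain ⟨c, m, hm, hpos, hsurj⟩ := exists_hydrogen_shift hα
  have h := exists_isSpectralMeasure hydrogen_symmetric hm hpos hsurj v
  rw [spectralMeasure, dif_pos h]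
  exact h.choose_spec

lemma integral_radial (f : ℝ → ℝ) :
    ∫ x : R3, f ‖x‖ = 4 * Real.pi * ∫ r in Ioi (0 : ℝ), r ^ 2 * f r := by
  rw [integral_fun_norm_addHaar volume f, finrank_euclideanSpace, Fintype.card_fin,
    measureReal_def, EuclideanSpace.volume_ball_fin_three]
  simp only [smul_eq_mul, nsmul_eq_mul, ENNReal.ofReal_one, one_pow, one_mul]
  rw [ENNReal.toReal_ofReal (by positivity)]
  push_cast
  ring

/-- Summation over `j` replaces `x_j²` by `r²`, leaving a radial integral. -/
lemma sum_norm_sq_of_ae_eq {W : Fin 3 → L2R3} {G : ℝ → ℝ}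
    (hW : ∀ j, W j =ᵐ[volume] fun x : R3 => ((x j * G ‖x‖ : ℝ) : ℂ)) :
    ∑ j, ‖W j‖ ^ 2 = 4 * Real.pi * ∫ r in Ioi (0 : ℝ), r ^ 4 * G r ^ 2 := by
  have h1 : ∀ j, Integrable (fun x : R3 => (x j * G ‖x‖) ^ 2) ∧
      ‖W j‖ ^ 2 = ∫ x : R3, (x j * G ‖x‖) ^ 2 := by
    intro j
    have hae : (fun x => ‖W j x‖ ^ 2) =ᵐ[volume] fun x : R3 => (x j * G ‖x‖) ^ 2 := by
      filter_upwards [hW j] with x hx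
      rw [hx, Complex.norm_real, Real.norm_eq_abs, sq_abs]
    have h2 := norm_toLp_sq_eq (Lp.memLp (W j))
    rw [Lp.toLp_coeFn] at h2
    exact ⟨((memLp_two_iff_integrable_sq_norm (Lp.memLp (W j)).1).1 (Lp.memLp (W j))).congr hae,
      h2.trans (integral_congr_ae hae)⟩
  rw [Finset.sum_congr rfl fun j _ => (h1 j).2, ← integral_finsetSum _ fun j _ => (h1 j).1]
  have h3 : ∀ x : R3, ∑ j, (x j * G ‖x‖) ^ 2 = (fun r : ℝ => r ^ 2 * G r ^ 2) ‖x‖ := fun x => by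
    simp only [mul_pow]
    rw [← Finset.sum_mul, sum_sq_eq_norm_sq]
  simp only [h3]
  rw [integral_radial (fun r : ℝ => r ^ 2 * G r ^ 2)]
  congr 2
  ext r
  ring

lemma integral_pow_mul_exp {α : ℝ} (hα : 0 < α) (n : ℕ) :
    ∫ r in Ioi (0 : ℝ), r ^ n * Real.exp (-α * r) = n.factorial / α ^ (n + 1) := by
  have h := Real.integral_rpow_mul_exp_neg_mul_Ioi (a := (n : ℝ) + 1) (r := α) (by positivity) hα
  rw [Real.Gamma_nat_eq_factorial, add_sub_cancel_right] at h
  have h2 : (1 / α) ^ ((n : ℝ) + 1) = (1 / α) ^ (n + 1) := by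
    rw [← Real.rpow_natCast]; push_cast; rfl
  rw [h2] at h
  simp only [Real.rpow_natCast] at h
  simp only [neg_mul]
  rw [h, one_div, inv_pow, ← div_eq_inv_mul]

/-- The normalisation `α^{3/2} (8π)^{-1/2}` of the ground state. -/
def groundNorm (α : ℝ) : ℝ := α ^ (3 / 2 : ℝ) / Real.sqrt (8 * Real.pi)

lemma groundNorm_sq {α : ℝ} (hα : 0 < α) : groundNorm α ^ 2 = α ^ 3 / (8 * Real.pi) := by
  rw [groundNorm, div_pow, Real.sq_sqrt (by positivity), ← Real.rpow_mul_natCast hα.le]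
  norm_num

lemma exp_half_sq (α r : ℝ) : Real.exp (-α * r / 2) ^ 2 = Real.exp (-α * r) := by
  rw [← Real.exp_nat_mul]
  congr 1
  push_cast
  ring

lemma positionGroundState_ae {α : ℝ} (hα : 0 < α) (j : Fin 3) :
    positionGroundState α hα j =ᵐ[volume] fun x : R3 =>
      ((x j * (groundNorm α * Real.exp (-α * ‖x‖ / 2)) : ℝ) : ℂ) :=
  (memLp_position_mul_groundState hα j).coeFn_toLp

lemma sum_norm_sq_positionGroundState {α : ℝ} (hα : 0 < α) :
    ∑ j, ‖positionGroundState α hα j‖ ^ 2 = 12 / α ^ 2 := by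
  rw [sum_norm_sq_of_ae_eq (G := fun r => groundNorm α * Real.exp (-α * r / 2))
    (positionGroundState_ae hα)]
  have h : ∀ r : ℝ, r ^ 4 * (groundNorm α * Real.exp (-α * r / 2)) ^ 2 =
      groundNorm α ^ 2 * (r ^ 4 * Real.exp (-α * r)) := fun r => by
    rw [mul_pow, exp_half_sq]; ring
  simp only [h]
  rw [integral_const_mul, integral_pow_mul_exp hα, groundNorm_sq hα]
  have : (Nat.factorial 4 : ℝ) = 24 := by norm_num [Nat.factorial]
  rw [this]
  field_simp
  ring

lemma exists_domain_positionGroundState {α : ℝ} (hα : 0 < α) (j : Fin 3) :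
    ∃ hv : positionGroundState α hα j ∈ (hydrogen α).domain,
      (hydrogen α ⟨_, hv⟩ - (groundEnergy α : ℂ) • positionGroundState α hα j : L2R3) =ᵐ[volume]
        fun x : R3 => ((x j * (groundNorm α * α / ‖x‖ * Real.exp (-α * ‖x‖ / 2)) : ℝ) : ℂ) := by
  -- With `p = 1` and `q = 0` this gives `(h_α - e_α) x_j u_α = α x_j u_α / |x|`.
  obtain ⟨V, hV, hV'⟩ := exists_hydrogen_profile hα 1 0 j
  have h1 : positionGroundState α hα j = (((groundNorm α : ℂ) • V : (hydrogen α).domain) : L2R3) := by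
    refine Lp.ext ?_
    rw [Submodule.coe_smul]
    filter_upwards [positionGroundState_ae hα j, Lp.coeFn_smul (groundNorm α : ℂ) (V : L2R3), hV]
      with x e1 e2 e3
    rw [e1, e2, Pi.smul_apply, e3, smul_eq_mul]
    norm_cast
    ring
  have hv : positionGroundState α hα j ∈ (hydrogen α).domain := h1 ▸ Submodule.coe_mem _
  have h2 : (⟨_, hv⟩ : (hydrogen α).domain) = (groundNorm α : ℂ) • V := Subtype.ext h1
  refine ⟨hv, ?_⟩
  have h3 : (hydrogen α ⟨_, hv⟩ - (groundEnergy α : ℂ) • positionGroundState α hα j : L2R3) =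
      (groundNorm α : ℂ) • (hydrogen α V - (groundEnergy α : ℂ) • (V : L2R3)) := by
    rw [h2, LinearPMap.map_smul, h1, Submodule.coe_smul, smul_sub, smul_comm]
  rw [h3]
  filter_upwards [Lp.coeFn_smul (groundNorm α : ℂ)
    (hydrogen α V - (groundEnergy α : ℂ) • (V : L2R3)), hV'] with x e1 e2
  rw [e1, Pi.smul_apply, e2, smul_eq_mul]
  norm_cast
  ring

lemma exists_hydrogen_preimage_positionGroundState (j : Fin 3) :
    ∃ V : (hydrogen 1).domain, hydrogen 1 V - (groundEnergy 1 : ℂ) • (V : L2R3) =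
      positionGroundState 1 one_pos j := by
  -- For `α = 1`, the values `p = 2` and `q = 1/2` solve `2 α q = 1` and `α p = 4 q`.
  obtain ⟨V, -, hV'⟩ := exists_hydrogen_profile one_pos 2 (1 / 2) j
  refine ⟨(groundNorm 1 : ℂ) • V, ?_⟩
  rw [LinearPMap.map_smul, Submodule.coe_smul, smul_comm, ← smul_sub]
  refine Lp.ext ?_
  filter_upwards [positionGroundState_ae one_pos j, Lp.coeFn_smul (groundNorm 1 : ℂ)
    (hydrogen 1 V - (groundEnergy 1 : ℂ) • (V : L2R3)), hV'] with x e1 e2 e3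
  rw [e1, e2, Pi.smul_apply, e3, smul_eq_mul]
  norm_cast
  ring

/-- The spectral measure of `h_α` at `x_j u_α`. -/
def dipoleMeasure (α : ℝ) (hα : 0 < α) (j : Fin 3) : Measure ℝ :=
  spectralMeasure (hydrogen α) (positionGroundState α hα j)

instance (α : ℝ) (hα : 0 < α) (j : Fin 3) : IsFiniteMeasure (dipoleMeasure α hα j) :=
  (isSpectralMeasure_hydrogen hα _).1

lemma dipoleMeasure_ae_ge {α : ℝ} (hα : 0 < α) (j : Fin 3) :
    ∀ᵐ t ∂(dipoleMeasure α hα j), 0 ≤ t - groundEnergy α := by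
  have h := (isSpectralMeasure_hydrogen hα (positionGroundState α hα j)).measure_Iio_eq_zero
    hydrogen_symmetric (hydrogen_bounded_below hα)
  have h2 : ∀ᵐ t ∂(dipoleMeasure α hα j), t ∉ Iio (groundEnergy α) :=
    measure_eq_zero_iff_ae_notMem.1 h
  filter_upwards [h2] with t ht
  exact sub_nonneg.2 (not_lt.1 ht)

/-- `x_j u₁` lies in the range of `h₁ - e₁`, so there is no atom at `e₁`. Strict positivity is
needed for `arctan (1/x) = π/2 - arctan x`, which fails at `x = 0` with the convention `1/0 = 0`. -/
lemma dipoleMeasure_one_ae_pos (j : Fin 3) :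
    ∀ᵐ t ∂(dipoleMeasure 1 one_pos j), 0 < t - groundEnergy 1 := by
  obtain ⟨V, hV⟩ := exists_hydrogen_preimage_positionGroundState j
  have h := (isSpectralMeasure_hydrogen one_pos
    (positionGroundState 1 one_pos j)).measure_singleton_eq_zero hydrogen_symmetric V hV
  have h2 : ∀ᵐ t ∂(dipoleMeasure 1 one_pos j), t ∉ ({groundEnergy 1} : Set ℝ) :=
    measure_eq_zero_iff_ae_notMem.1 h
  filter_upwards [h2, dipoleMeasure_ae_ge one_pos j] with t ht ht'
  exact lt_of_le_of_ne ht' fun h => ht (sub_eq_zero.1 h.symm)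

lemma sum_dipoleMeasure_univ {α : ℝ} (hα : 0 < α) :
    ∑ j, (dipoleMeasure α hα j).real univ = 12 / α ^ 2 := by
  rw [← sum_norm_sq_positionGroundState hα]
  refine Finset.sum_congr rfl fun j _ => ?_
  obtain ⟨hv, -⟩ := exists_domain_positionGroundState hα j
  exact (isSpectralMeasure_hydrogen hα _).measureReal_univ hydrogen_symmetric hv

lemma integrable_dipoleMeasure_sq {α : ℝ} (hα : 0 < α) (j : Fin 3) :
    Integrable (fun t => (t - groundEnergy α) ^ 2) (dipoleMeasure α hα j) := by
  obtain ⟨hv, -⟩ := exists_domain_positionGroundState hα j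
  exact ((isSpectralMeasure_hydrogen hα _).memLp_two hydrogen_symmetric hv _).1

lemma sum_integral_dipoleMeasure_sq_le {α : ℝ} (hα : 0 < α) :
    ∑ j, ∫ t, (t - groundEnergy α) ^ 2 ∂(dipoleMeasure α hα j) ≤ α ^ 2 := by
  choose hv h using exists_domain_positionGroundState hα
  refine (Finset.sum_le_sum fun j _ => ((isSpectralMeasure_hydrogen hα _).memLp_two
    hydrogen_symmetric (hv j) (groundEnergy α)).2).trans (le_of_eq ?_)
  rw [sum_norm_sq_of_ae_eq (G := fun r => groundNorm α * α / r * Real.exp (-α * r / 2)) h]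
  have h2 : ∫ r in Ioi (0 : ℝ), r ^ 4 * (groundNorm α * α / r * Real.exp (-α * r / 2)) ^ 2 =
      ∫ r in Ioi (0 : ℝ), groundNorm α ^ 2 * α ^ 2 * (r ^ 2 * Real.exp (-α * r)) := by
    refine setIntegral_congr_fun measurableSet_Ioi fun r hr => ?_
    have hr' : r ≠ 0 := (mem_Ioi.1 hr).ne'
    simp only [mul_pow, exp_half_sq, div_pow]
    field_simp
  rw [h2, integral_const_mul, integral_pow_mul_exp hα, groundNorm_sq hα]
  have : (Nat.factorial 2 : ℝ) = 2 := by norm_num [Nat.factorial]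
  rw [this]
  field_simp
  ring

lemma integrable_dipoleMeasure {α : ℝ} (hα : 0 < α) (j : Fin 3) :
    Integrable (fun t => t - groundEnergy α) (dipoleMeasure α hα j) := by
  refine ((integrable_const (1 : ℝ)).add (integrable_dipoleMeasure_sq hα j)).mono'
    (by fun_prop) (Eventually.of_forall fun t => ?_)
  rw [Real.norm_eq_abs, abs_le, Pi.add_apply]
  constructor <;> nlinarith [sq_nonneg (t - groundEnergy α - 1), sq_nonneg (t - groundEnergy α + 1)]

/-- With `s = t - e_α`, use `s ≤ α²/2 + s²/(2α²)`. The total mass `12/α²` and the second moment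
bound `α²` give `6 + 1/2`. -/
lemma sum_integral_dipoleMeasure_le {α : ℝ} (hα : 0 < α) :
    ∑ j, ∫ t, (t - groundEnergy α) ∂(dipoleMeasure α hα j) ≤ 13 / 2 := by
  have h1 : ∀ j, ∫ t, (t - groundEnergy α) ∂(dipoleMeasure α hα j) ≤
      α ^ 2 / 2 * (dipoleMeasure α hα j).real univ +
        (2 * α ^ 2)⁻¹ * ∫ t, (t - groundEnergy α) ^ 2 ∂(dipoleMeasure α hα j) := fun j => by
    have e1 : α ^ 2 / 2 * (dipoleMeasure α hα j).real univ =
        ∫ _, α ^ 2 / 2 ∂(dipoleMeasure α hα j) := by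
      rw [integral_const, smul_eq_mul, mul_comm]
    rw [e1, ← integral_const_mul, ← integral_add (integrable_const _)
      ((integrable_dipoleMeasure_sq hα j).const_mul _)]
    refine integral_mono (integrable_dipoleMeasure hα j) ((integrable_const _).add
      ((integrable_dipoleMeasure_sq hα j).const_mul _)) fun t => ?_
    have h2 : (t - groundEnergy α) ≤ α ^ 2 / 2 + (2 * α ^ 2)⁻¹ * (t - groundEnergy α) ^ 2 := by
      have : 0 ≤ (2 * α ^ 2)⁻¹ * (t - groundEnergy α - α ^ 2) ^ 2 := by positivity
      have h3 : (2 * α ^ 2)⁻¹ * (t - groundEnergy α - α ^ 2) ^ 2 = α ^ 2 / 2 +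
        (2 * α ^ 2)⁻¹ * (t - groundEnergy α) ^ 2 - (t - groundEnergy α) := by
        field_simp
        ring
      linarith
    exact h2
  refine (Finset.sum_le_sum fun j _ => h1 j).trans ?_
  rw [Finset.sum_add_distrib, ← Finset.mul_sum, ← Finset.mul_sum, sum_dipoleMeasure_univ hα]
  have h4 := mul_le_mul_of_nonneg_left (sum_integral_dipoleMeasure_sq_le hα)
    (by positivity : 0 ≤ (2 * α ^ 2)⁻¹)
  have h5 : (2 * α ^ 2)⁻¹ * α ^ 2 = 1 / 2 := by field_simp
  have h6 : α ^ 2 / 2 * (12 / α ^ 2) = 6 := by field_simp; norm_num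
  rw [h5] at h4
  rw [h6]
  linarith

/-! ### Integrals of functions of `k₁` and `|k|` -/

/-- The splitting `ℝ × ℝ² ≃ ℝ³`. -/
def splitR3 : ℝ × EuclideanSpace ℝ (Fin 2) ≃ᵐ R3 :=
  ((MeasurableEquiv.refl ℝ).prodCongr (MeasurableEquiv.toLp 2 (Fin 2 → ℝ)).symm).trans
    ((MeasurableEquiv.piFinSuccAbove (fun _ : Fin 3 => ℝ) 0).symm.trans
      (MeasurableEquiv.toLp 2 (Fin 3 → ℝ)))

lemma measurePreserving_splitR3 : MeasurePreserving splitR3 := by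
  have h1 : MeasurePreserving (MeasurableEquiv.toLp 2 (Fin 2 → ℝ)).symm :=
    PiLp.volume_preserving_ofLp (Fin 2)
  have h2 := (MeasurePreserving.id (volume : Measure ℝ)).prod h1
  have h3 := (volume_preserving_piFinSuccAbove (fun _ : Fin 3 => ℝ) 0).symm
  exact (PiLp.volume_preserving_toLp (Fin 3)).comp (h3.comp h2)

lemma splitR3_zero (q : ℝ) (w : EuclideanSpace ℝ (Fin 2)) : splitR3 (q, w) 0 = q := rfl

lemma norm_splitR3 (q : ℝ) (w : EuclideanSpace ℝ (Fin 2)) :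
    ‖splitR3 (q, w)‖ = √(q ^ 2 + ‖w‖ ^ 2) := by
  have h1 : splitR3 (q, w) 1 = w 0 := rfl
  have h2 : splitR3 (q, w) 2 = w 1 := rfl
  rw [EuclideanSpace.norm_eq, Fin.sum_univ_three, splitR3_zero, h1, h2, EuclideanSpace.norm_sq_eq,
    Fin.sum_univ_two]
  simp only [Real.norm_eq_abs, sq_abs]
  rw [add_assoc]

lemma integral_radial_two (f : ℝ → ℝ) :
    ∫ w : EuclideanSpace ℝ (Fin 2), f ‖w‖ = 2 * Real.pi * ∫ r in Ioi (0 : ℝ), r * f r := by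
  rw [integral_fun_norm_addHaar volume f, finrank_euclideanSpace, Fintype.card_fin,
    measureReal_def, EuclideanSpace.volume_ball_fin_two]
  simp only [smul_eq_mul, nsmul_eq_mul, ENNReal.ofReal_one, one_pow, one_mul]
  rw [ENNReal.toReal_ofReal Real.pi_pos.le]
  simp [mul_assoc]

/-- Substitution `r = √(q² + s²)`, for which `r dr = s ds`. -/
lemma integral_sqrt_sq_add (q : ℝ) (Φ : ℝ → ℝ) :
    ∫ s in Ioi (0 : ℝ), s * Φ √(q ^ 2 + s ^ 2) = ∫ r in Ioi |q|, r * Φ r := by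
  have himg : (fun s : ℝ => √(q ^ 2 + s ^ 2)) '' Ioi 0 = Ioi |q| := by
    ext r
    constructor
    · rintro ⟨s, hs, rfl⟩
      rw [mem_Ioi, ← Real.sqrt_sq_eq_abs]
      exact Real.sqrt_lt_sqrt (sq_nonneg _) (by have := pow_pos (mem_Ioi.1 hs) 2; linarith)
    · intro hr
      have hr' : |q| < r := hr
      have h0 : 0 < r := (abs_nonneg q).trans_lt hr'
      have h1 : q ^ 2 < r ^ 2 := sq_lt_sq.2 (by rwa [abs_of_pos h0])
      refine ⟨√(r ^ 2 - q ^ 2), Real.sqrt_pos.2 (by linarith), ?_⟩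
      simp only
      rw [Real.sq_sqrt (by linarith), add_sub_cancel, Real.sqrt_sq h0.le]
  have hpos : ∀ s ∈ Ioi (0 : ℝ), 0 < q ^ 2 + s ^ 2 := fun s hs => by
    have := pow_pos (mem_Ioi.1 hs) 2; positivity
  have hder : ∀ s ∈ Ioi (0 : ℝ), HasDerivWithinAt (fun s : ℝ => √(q ^ 2 + s ^ 2))
      (s / √(q ^ 2 + s ^ 2)) (Ioi 0) s := fun s hs => by
    have h1 : HasDerivAt (fun s : ℝ => q ^ 2 + s ^ 2) (2 * s) s := by
      simpa using ((hasDerivAt_id s).pow 2).const_add (q ^ 2)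
    refine ((h1.sqrt (hpos s hs).ne').congr_deriv ?_).hasDerivWithinAt
    field_simp
  have hinj : InjOn (fun s : ℝ => √(q ^ 2 + s ^ 2)) (Ioi 0) := fun s hs t ht hst => by
    have h1 := (Real.sqrt_inj (hpos s hs).le (hpos t ht).le).1 hst
    exact (pow_left_inj₀ (mem_Ioi.1 hs).le (mem_Ioi.1 ht).le two_ne_zero).1 (by linarith)
  rw [← himg, integral_image_eq_integral_abs_deriv_smul measurableSet_Ioi hder hinj]
  refine setIntegral_congr_fun measurableSet_Ioi fun s hs => ?_
  have h1 := Real.sqrt_pos.2 (hpos s hs)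
  have h2 : (0 : ℝ) < s := hs
  rw [abs_of_pos (by positivity), smul_eq_mul, ← mul_assoc, div_mul_cancel₀ _ h1.ne']

section Radial

variable {g Φ : ℝ → ℝ} {K R : ℝ}

lemma integrable_coord_radial (hg : Continuous g) (hΦ : Measurable Φ)
    (hK : ∀ q r, 0 < r → |q| ≤ r → |g q * Φ r| ≤ K) (hR : ∀ r, R < r → Φ r = 0) :
    Integrable (fun k : R3 => g (k 0) * Φ ‖k‖) := by
  have hne : ∀ᵐ k : R3, k ≠ 0 := compl_mem_ae_iff.2 (measure_singleton (0 : R3))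
  have hb : Integrable ((Metric.closedBall (0 : R3) R).indicator fun _ => K) :=
    (integrable_indicator_iff measurableSet_closedBall).2
      (integrableOn_const measure_closedBall_lt_top.ne)
  have hm : Measurable (fun k : R3 => g (k 0) * Φ ‖k‖) :=
    (hg.measurable.comp (by fun_prop)).mul (hΦ.comp measurable_norm)
  refine hb.mono' hm.aestronglyMeasurable ?_
  filter_upwards [hne] with k hk
  by_cases h : ‖k‖ ≤ R
  · rw [indicator_of_mem (mem_closedBall_zero_iff.2 h), Real.norm_eq_abs]
    exact hK _ _ (norm_pos_iff.2 hk) (abs_coord_le_norm k 0)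
  · rw [hR _ (not_le.1 h), mul_zero, norm_zero]
    exact (indicator_of_notMem (by simpa using h) _).ge

/-- Archimedes' hat-box theorem: on the sphere of radius `r` the coordinate `k₁` is uniformly
distributed on `[-r, r]`. It is obtained from cylindrical coordinates and Fubini. -/
lemma integral_coord_radial (hg : Continuous g) (hΦ : Measurable Φ)
    (hK : ∀ q r, 0 < r → |q| ≤ r → |g q * Φ r| ≤ K) (hR : ∀ r, R < r → Φ r = 0) :
    ∫ k : R3, g (k 0) * Φ ‖k‖ =
      2 * Real.pi * ∫ r in Ioi (0 : ℝ), r * Φ r * ∫ q in (-r)..r, g q := by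
  have h0 := integrable_coord_radial hg hΦ hK hR
  have h1 : ∫ k : R3, g (k 0) * Φ ‖k‖ = ∫ q : ℝ, ∫ w : EuclideanSpace ℝ (Fin 2),
      g q * Φ √(q ^ 2 + ‖w‖ ^ 2) := by
    rw [← measurePreserving_splitR3.integral_comp' (g := fun k : R3 => g (k 0) * Φ ‖k‖),
      Measure.volume_eq_prod, integral_prod]
    · simp only [splitR3_zero, norm_splitR3]
    · exact (measurePreserving_splitR3.integrable_comp_emb splitR3.measurableEmbedding).2 h0
  -- The integrand on the region `|q| < r`. Integrating first in `r` gives the cylindrical form,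
  -- first in `q` the spherical one.
  set H : ℝ → ℝ → ℝ := fun q r => {p : ℝ × ℝ | |p.1| < p.2}.indicator
    (fun p => g p.1 * (p.2 * Φ p.2)) (q, r) with hH
  have hHm : Measurable (Function.uncurry H) :=
    ((hg.measurable.comp measurable_fst).mul (measurable_snd.mul
      (hΦ.comp measurable_snd))).indicator
      (measurableSet_lt (by fun_prop) (by fun_prop))
  have hHi : Integrable (Function.uncurry H) (volume.prod volume) := by
    have hb : Integrable ((Icc (-R) R ×ˢ Icc 0 R).indicator fun _ : ℝ × ℝ => R * K)
        (volume.prod volume) := by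
      refine (integrable_indicator_iff (measurableSet_Icc.prod measurableSet_Icc)).2
        (integrableOn_const ?_)
      rw [Measure.prod_prod]
      exact ENNReal.mul_ne_top measure_Icc_lt_top.ne measure_Icc_lt_top.ne
    refine hb.mono' hHm.aestronglyMeasurable (Eventually.of_forall fun p => ?_)
    obtain ⟨q, r⟩ := p
    simp only [Function.uncurry_apply_pair, hH, indicator_apply, mem_ofPred_eq, mem_prod, mem_Icc]
    split_ifs with h2 h3 h3
    · have hr : 0 < r := (abs_nonneg q).trans_lt h2
      rw [Real.norm_eq_abs, mul_left_comm, abs_mul, abs_of_pos hr]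
      have := hK q r hr h2.le
      have h4 := (abs_nonneg _).trans this
      have h5 := h3.2.2
      have h6 := hr.le.trans h5
      gcongr
    · have hr : R < r := by
        by_contra hr
        have h5 := not_lt.1 hr
        exact h3 ⟨abs_le.1 (h2.le.trans h5), ((abs_nonneg q).trans h2.le), h5⟩
      rw [hR r hr, mul_zero, mul_zero, norm_zero]
    · rw [norm_zero]
      have hr0 : 0 ≤ R := h3.2.1.trans h3.2.2
      exact mul_nonneg hr0 ((abs_nonneg _).trans (hK 0 1 one_pos (by simp)))
    · rw [norm_zero]
  have h2 : ∀ q : ℝ, ∫ w : EuclideanSpace ℝ (Fin 2), g q * Φ √(q ^ 2 + ‖w‖ ^ 2) =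
      2 * Real.pi * ∫ r, H q r := fun q => by
    rw [integral_const_mul, integral_radial_two (fun s => Φ √(q ^ 2 + s ^ 2)),
      integral_sqrt_sq_add, mul_left_comm, ← integral_const_mul,
      ← integral_indicator measurableSet_Ioi]
    congr 2
  have h3 : ∀ r : ℝ, ∫ q, H q r =
      (Ioi (0 : ℝ)).indicator (fun r => r * Φ r * ∫ q in (-r)..r, g q) r := fun r => by
    by_cases hr : 0 < r
    · rw [indicator_of_mem (mem_Ioi.2 hr), intervalIntegral.integral_of_le (by linarith),
        integral_Ioc_eq_integral_Ioo, ← integral_const_mul, ← integral_indicator measurableSet_Ioo]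
      congr 1
      ext q
      simp only [hH, indicator_apply, mem_ofPred_eq, mem_Ioo, abs_lt]
      split_ifs
      · ring
      · rfl
    · rw [indicator_of_notMem (by simpa using hr)]
      have : ∀ q, H q r = 0 := fun q => indicator_of_notMem
        (s := {p : ℝ × ℝ | |p.1| < p.2}) (a := (q, r)) (fun h => hr ((abs_nonneg q).trans_lt h)) _
      simp only [this, integral_zero]
  rw [h1]
  simp only [h2]
  rw [integral_const_mul, integral_integral_swap hHi]
  simp only [h3]
  rw [integral_indicator measurableSet_Ioi]

end Radial

section FixedSpectralParameter

/-! ### The oscillatory integral for a fixed spectral parameter -/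

/-- A cut-off profile that is continuously differentiable on all of `ℝ`. -/
structure IsGlobalCutoff (ψ : ℝ → ℝ) : Prop where
  contDiff : ContDiff ℝ 1 ψ
  nonneg : ∀ r, 0 ≤ ψ r
  le_one : ∀ r, ψ r ≤ 1
  eq_zero : ∀ r, 1 < r → ψ r = 0

/-- Since `χ = 1` on `(0, 1/2)`, extending it by `1` to `r ≤ 0` keeps it smooth. -/
lemma IsCutoff.exists_isGlobalCutoff {χ : ℝ → ℝ} (hχ : IsCutoff χ) :
    ∃ ψ, IsGlobalCutoff ψ ∧ ∀ r, 0 < r → ψ r = χ r := by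
  have hpos : ∀ r, 0 < r → (if r ≤ 0 then 1 else χ r) = χ r := fun r hr => if_neg (not_le.2 hr)
  refine ⟨fun r => if r ≤ 0 then 1 else χ r, ⟨?_, fun r => ?_, fun r => ?_, fun r hr => ?_⟩, hpos⟩
  · refine contDiff_iff_contDiffAt.2 fun r => ?_
    rcases lt_or_ge 0 r with hr | hr
    · refine ((hχ.smooth.contDiffAt (Ioi_mem_nhds hr)).of_le (by norm_cast)).congr_of_eventuallyEq
        ?_
      filter_upwards [Ioi_mem_nhds hr] with s hs using hpos s hs
    · refine (contDiffAt_const (c := (1 : ℝ))).congr_of_eventuallyEq ?_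
      filter_upwards [Iio_mem_nhds (show r < 1 / 2 by linarith)] with s hs
      split_ifs with h
      · rfl
      · exact hχ.eq_one s (not_le.1 h) hs
  · split_ifs with h
    · exact zero_le_one
    · exact (hχ.mem_Icc r (not_le.1 h)).1
  · split_ifs with h
    · exact le_rfl
    · exact (hχ.mem_Icc r (not_le.1 h)).2
  · rw [if_neg (by linarith), hχ.eq_zero r hr]

/-- As `|k̂| = 1`, the angular factor is `-2 k̂₁²`. At `k = 0` both sides vanish by the convention
on division by zero. -/
lemma oscillatory_eq {χ ψ : ℝ → ℝ} (h : ∀ r, 0 < r → ψ r = χ r) {Λ : ℝ} (hΛ : 0 < Λ) (y : ℝ)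
    (k : R3) : oscillatory χ Λ y k =
      -(1 / Real.pi ^ 2) * (ψ (‖k‖ / Λ) ^ 2 * k 0 ^ 2 / ‖k‖ ^ 3 * Real.cos (2 * k 0 * y)) := by
  rcases eq_or_ne k 0 with rfl | hk
  · simp [oscillatory]
  have hk' : 0 < ‖k‖ := norm_pos_iff.2 hk
  have h1 : k 0 ^ 2 + k 1 ^ 2 + k 2 ^ 2 = ‖k‖ ^ 2 := by
    rw [← sum_sq_eq_norm_sq, Fin.sum_univ_three]
  have h2 : -1 - (k 0 / ‖k‖) ^ 2 + (k 1 / ‖k‖) ^ 2 + (k 2 / ‖k‖) ^ 2 =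
      -2 * k 0 ^ 2 / ‖k‖ ^ 2 := by
    field_simp
    linarith
  rw [oscillatory, h2, h _ (by positivity)]
  field_simp

variable {ψ : ℝ → ℝ} {Λ y a : ℝ}

/-- The radial weight of the oscillatory integral at the spectral parameter `a`. -/
def radialWeight (ψ : ℝ → ℝ) (Λ a r : ℝ) : ℝ := ψ (r / Λ) ^ 2 * (a / (3 * (a + r)))

lemma radialWeight_nonneg (ha : 0 < a) {r : ℝ} (hr : 0 ≤ r) : 0 ≤ radialWeight ψ Λ a r := by
  rw [radialWeight]; positivity

lemma IsGlobalCutoff.radialWeight_le (hψ : IsGlobalCutoff ψ) (ha : 0 < a) {r : ℝ} (hr : 0 ≤ r) :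
    radialWeight ψ Λ a r ≤ a / 3 * (a + r)⁻¹ := by
  rw [radialWeight]
  calc _ ≤ 1 * (a / (3 * (a + r))) := by
        gcongr
        exact pow_le_one₀ (hψ.nonneg _) (hψ.le_one _)
    _ = _ := by field_simp

lemma IsGlobalCutoff.continuousOn_radialWeight (hψ : IsGlobalCutoff ψ) (ha : 0 < a) {R : ℝ} :
    ContinuousOn (radialWeight ψ Λ a) (Icc 0 R) := by
  have h1 := hψ.contDiff.continuous
  unfold radialWeight
  refine ContinuousOn.mul (by fun_prop) (continuousOn_const.div (by fun_prop) fun r hr => ?_)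
  have := hr.1
  positivity

/-- The exact value contains `log (1 + R/a)`. The free scale `s` replaces it by a bound affine in
`a`, which can be integrated against the spectral measure with its mass and first moment alone. -/
lemma integral_inv_add_le {R s : ℝ} (ha : 0 < a) (hR : 0 < R) (hs : 0 < s) :
    ∫ r in (0 : ℝ)..R, a / 3 * (a + r)⁻¹ ≤ (a * Real.log (1 + R / s) + s) / 3 := by
  have h1 : ∫ r in (0 : ℝ)..R, (a + r)⁻¹ = Real.log ((a + R) / a) := by
    rw [intervalIntegral.integral_comp_add_left (fun r => r⁻¹), integral_inv_of_pos (by linarith)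
      (by linarith), add_zero]
  have h2 : (a + R) / a ≤ (1 + R / s) * (1 + s / a) := by
    have : (1 + R / s) * (1 + s / a) = (a + R) / a + (R / s + s / a) := by field_simp; ring
    rw [this]
    have : 0 ≤ R / s + s / a := by positivity
    linarith
  have h3 : Real.log ((a + R) / a) ≤ Real.log (1 + R / s) + s / a := by
    refine (Real.log_le_log (by positivity) h2).trans ?_
    rw [Real.log_mul (by positivity) (by positivity)]
    have := Real.log_le_sub_one_of_pos (show 0 < 1 + s / a by positivity)
    linarith
  rw [intervalIntegral.integral_const_mul, h1]
  calc a / 3 * Real.log ((a + R) / a) ≤ a / 3 * (Real.log (1 + R / s) + s / a) := by gcongr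
    _ = _ := by field_simp

lemma IsGlobalCutoff.abs_integral_radialWeight_mul_le (hψ : IsGlobalCutoff ψ) (ha : 0 < a)
    {R s : ℝ} (hR : 0 < R) (hs : 0 < s) {f : ℝ → ℝ} {B : ℝ} (hB : ∀ r, |f r| ≤ B) :
    |∫ r in (0 : ℝ)..R, radialWeight ψ Λ a r * f r| ≤
      B * ((a * Real.log (1 + R / s) + s) / 3) := by
  have hB0 : 0 ≤ B := (abs_nonneg _).trans (hB 0)
  have hi : IntervalIntegrable (fun r => a / 3 * (a + r)⁻¹) volume 0 R := by
    refine ContinuousOn.intervalIntegrable_of_Icc hR.le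
      (continuousOn_const.mul (ContinuousOn.inv₀ (by fun_prop) fun r hr => ?_))
    have := hr.1
    positivity
  rw [← Real.norm_eq_abs]
  refine (intervalIntegral.norm_integral_le_of_norm_le hR.le (g := fun r => B * (a / 3 * (a + r)⁻¹))
    (Eventually.of_forall fun r hr => ?_) (hi.const_mul B)).trans ?_
  · rw [Real.norm_eq_abs, abs_mul, abs_of_nonneg (radialWeight_nonneg ha hr.1.le), mul_comm]
    have h1 := hψ.radialWeight_le (Λ := Λ) ha hr.1.le
    have h2 := radialWeight_nonneg (ψ := ψ) (Λ := Λ) ha hr.1.le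
    exact mul_le_mul (hB r) h1 h2 hB0
  · rw [intervalIntegral.integral_const_mul]
    exact mul_le_mul_of_nonneg_left (integral_inv_add_le ha hR hs) hB0

/-- The derivative of `r ↦ r * radialWeight r`. -/
def radialWeightDeriv (ψ : ℝ → ℝ) (Λ a r : ℝ) : ℝ :=
  2 * ψ (r / Λ) * deriv ψ (r / Λ) / Λ * (a * r / (3 * (a + r))) +
    ψ (r / Λ) ^ 2 * (a ^ 2 / (3 * (a + r) ^ 2))

lemma IsGlobalCutoff.hasDerivAt_mul_radialWeight (hψ : IsGlobalCutoff ψ) (ha : 0 < a) {r : ℝ}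
    (hr : 0 ≤ r) :
    HasDerivAt (fun r => r * radialWeight ψ Λ a r) (radialWeightDeriv ψ Λ a r) r := by
  have hne : a + r ≠ 0 := by positivity
  have h1 : HasDerivAt (fun r => ψ (r / Λ)) (deriv ψ (r / Λ) * Λ⁻¹) r := by
    have h2 := ((hψ.contDiff.differentiable one_ne_zero).differentiableAt (x := r / Λ)).hasDerivAt
    have h3 : HasDerivAt (fun r : ℝ => r / Λ) Λ⁻¹ r := by
      simpa [div_eq_mul_inv] using (hasDerivAt_id r).mul_const Λ⁻¹
    exact h2.comp r h3
  have h4 : HasDerivAt (fun r => 3 * (a + r)) 3 r := by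
    simpa using ((hasDerivAt_id r).const_add a).const_mul 3
  have h5 := (hasDerivAt_id r).mul ((h1.pow 2).mul
    ((hasDerivAt_const r a).div h4 (by positivity)))
  refine h5.congr_deriv ?_
  simp only [radialWeightDeriv, id, Pi.pow_apply, Pi.mul_apply, Pi.div_apply]
  field_simp
  ring

lemma IsGlobalCutoff.exists_abs_deriv_le (hψ : IsGlobalCutoff ψ) :
    ∃ M, 0 ≤ M ∧ ∀ r ∈ Icc (0 : ℝ) 2, |deriv ψ r| ≤ M := by
  obtain ⟨M, hM⟩ := isCompact_Icc.exists_bound_of_continuousOn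
    ((hψ.contDiff.continuous_deriv le_rfl).continuousOn (s := Icc (0 : ℝ) 2))
  exact ⟨M, (norm_nonneg _).trans (hM 0 (by norm_num)), hM⟩

/-- No logarithm appears. The term with `ψ'` is at most `2Ma/(3Λ)` on an interval of length `2Λ`,
and `∫ a²/(3(a + r)²) dr ≤ a/3`. -/
lemma IsGlobalCutoff.abs_integral_radialWeightDeriv_mul_le (hψ : IsGlobalCutoff ψ) {M : ℝ}
    (hM0 : 0 ≤ M) (hM : ∀ r ∈ Icc (0 : ℝ) 2, |deriv ψ r| ≤ M) (hΛ : 0 < Λ) (ha : 0 < a)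
    {f : ℝ → ℝ} {B : ℝ} (hB : ∀ r, |f r| ≤ B) :
    |∫ r in (0 : ℝ)..(2 * Λ), radialWeightDeriv ψ Λ a r * f r| ≤ B * ((4 * M + 1) / 3 * a) := by
  have hB0 : 0 ≤ B := (abs_nonneg _).trans (hB 0)
  have hc : ContinuousOn (fun r => a ^ 2 / (3 * (a + r) ^ 2)) (Icc 0 (2 * Λ)) := by
    refine continuousOn_const.div (by fun_prop) fun r hr => ?_
    have := hr.1
    positivity
  have hi := hc.intervalIntegrable_of_Icc (μ := volume) (by positivity)
  have hint : ∫ r in (0 : ℝ)..(2 * Λ), a ^ 2 / (3 * (a + r) ^ 2) ≤ a / 3 := by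
    have hd : ∀ r ∈ uIcc 0 (2 * Λ), HasDerivAt (fun r => -(a ^ 2 / (3 * (a + r))))
        (a ^ 2 / (3 * (a + r) ^ 2)) r := fun r hr => by
      rw [uIcc_of_le (by positivity)] at hr
      have h0 := hr.1
      have h4 : HasDerivAt (fun r => 3 * (a + r)) 3 r := by
        simpa using ((hasDerivAt_id r).const_add a).const_mul 3
      refine ((hasDerivAt_const r (a ^ 2)).div h4 (by positivity)).neg.congr_deriv ?_
      field_simp
      ring
    rw [intervalIntegral.integral_eq_sub_of_hasDerivAt hd hi]
    have h1 : 0 ≤ a ^ 2 / (3 * (a + 2 * Λ)) := by positivity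
    have h2 : a ^ 2 / (3 * (a + 0)) = a / 3 := by field_simp; ring
    linarith
  rw [← Real.norm_eq_abs]
  refine (intervalIntegral.norm_integral_le_of_norm_le (by positivity)
    (g := fun r => B * (2 * M / (3 * Λ) * a + a ^ 2 / (3 * (a + r) ^ 2)))
    (Eventually.of_forall fun r hr => ?_) ((intervalIntegrable_const.add hi).const_mul B)).trans ?_
  · have hr0 : 0 < r := hr.1
    rw [Real.norm_eq_abs, abs_mul, mul_comm]
    refine mul_le_mul (hB r) ((abs_add_le _ _).trans (add_le_add ?_ ?_)) (abs_nonneg _) hB0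
    · have h1 : |ψ (r / Λ)| ≤ 1 := by rw [abs_of_nonneg (hψ.nonneg _)]; exact hψ.le_one _
      have h2 : |deriv ψ (r / Λ)| ≤ M := hM _ ⟨by positivity, by
        rw [div_le_iff₀ hΛ]; exact hr.2⟩
      have h3 : |a * r / (3 * (a + r))| ≤ a / 3 := by
        rw [abs_of_pos (by positivity), div_le_div_iff₀ (by positivity) (by norm_num)]
        nlinarith
      rw [abs_mul, abs_div, abs_mul, abs_mul, abs_two, abs_of_pos hΛ]
      calc 2 * |ψ (r / Λ)| * |deriv ψ (r / Λ)| / Λ * |a * r / (3 * (a + r))|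
          ≤ 2 * 1 * M / Λ * (a / 3) := by gcongr
        _ = _ := by field_simp
    · rw [abs_of_nonneg (by positivity)]
      exact mul_le_of_le_one_left (by positivity) (pow_le_one₀ (hψ.nonneg _) (hψ.le_one _))
  · rw [intervalIntegral.integral_const_mul, intervalIntegral.integral_add
        intervalIntegrable_const hi,
      intervalIntegral.integral_const]
    refine mul_le_mul_of_nonneg_left ?_ hB0
    have : (2 * Λ - 0) • (2 * M / (3 * Λ) * a) = 4 * M / 3 * a := by
      rw [smul_eq_mul]; field_simp; ring
    rw [this]
    linarith

/-- One integration by parts gains the factor `1/y`. The factor `r` kills the boundary term at `0`,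
the cut-off the one at `2Λ`. -/
lemma IsGlobalCutoff.abs_integral_mul_radialWeight_mul_sin_le (hψ : IsGlobalCutoff ψ) {M : ℝ}
    (hM0 : 0 ≤ M) (hM : ∀ r ∈ Icc (0 : ℝ) 2, |deriv ψ r| ≤ M) (hΛ : 0 < Λ) (ha : 0 < a)
    (hy : 0 < y) :
    |∫ r in (0 : ℝ)..(2 * Λ), r * radialWeight ψ Λ a r * Real.sin (2 * r * y)| ≤
      (4 * M + 1) / (6 * y) * a := by
  have h2Λ : 0 ≤ 2 * Λ := by positivity
  have hv : ∀ r ∈ uIcc 0 (2 * Λ), HasDerivAt (fun r => -Real.cos (2 * r * y) / (2 * y))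
      (Real.sin (2 * r * y)) r := fun r _ => by
    have h1 : HasDerivAt (fun r : ℝ => 2 * r * y) (2 * y) r := by
      simpa using ((hasDerivAt_id r).const_mul 2).mul_const y
    refine (h1.cos.neg.div_const (2 * y)).congr_deriv ?_
    field_simp
  have hu : ∀ r ∈ uIcc 0 (2 * Λ), HasDerivAt (fun r => r * radialWeight ψ Λ a r)
      (radialWeightDeriv ψ Λ a r) r := fun r hr => by
    rw [uIcc_of_le h2Λ] at hr
    exact hψ.hasDerivAt_mul_radialWeight ha hr.1
  have hc : ContinuousOn (radialWeightDeriv ψ Λ a) (Icc 0 (2 * Λ)) := by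
    have h1 := hψ.contDiff.continuous
    have h2 := hψ.contDiff.continuous_deriv le_rfl
    unfold radialWeightDeriv
    refine ContinuousOn.add (ContinuousOn.mul (by fun_prop) (ContinuousOn.div (by fun_prop)
      (by fun_prop) fun r hr => ?_)) (ContinuousOn.mul (by fun_prop) (ContinuousOn.div (by fun_prop)
      (by fun_prop) fun r hr => ?_)) <;>
    · have := hr.1
      positivity
  rw [intervalIntegral.integral_mul_deriv_eq_deriv_mul hu hv
    (hc.intervalIntegrable_of_Icc h2Λ)
    (Continuous.intervalIntegrable (by fun_prop) _ _)]
  have hz : radialWeight ψ Λ a (2 * Λ) = 0 := by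
    -- The endpoint `2Λ` is used because the cut-off is assumed to vanish only strictly beyond `1`.
    rw [radialWeight, hψ.eq_zero _ (by rw [mul_div_assoc, div_self hΛ.ne']; norm_num)]
    ring
  rw [hz, mul_zero, zero_mul, zero_mul, zero_mul, sub_zero, zero_sub, abs_neg]
  refine (hψ.abs_integral_radialWeightDeriv_mul_le hM0 hM hΛ ha (B := 1 / (2 * y))
    fun r => ?_).trans (le_of_eq (by field_simp; ring))
  rw [abs_div, abs_neg, abs_of_pos (by positivity : 0 < 2 * y)]
  exact div_le_div_of_nonneg_right (Real.abs_cos_le_one _) (by positivity)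

lemma integral_sq_mul_cos (hy : 0 < y) (r : ℝ) :
    ∫ q in (-r)..r, q ^ 2 * Real.cos (2 * q * y) =
      r ^ 2 * Real.sin (2 * r * y) / y + r * Real.cos (2 * r * y) / y ^ 2 -
        Real.sin (2 * r * y) / (2 * y ^ 3) := by
  have hd : ∀ q ∈ uIcc (-r) r, HasDerivAt (fun q => q ^ 2 * Real.sin (2 * q * y) / (2 * y) +
      q * Real.cos (2 * q * y) / (2 * y ^ 2) - Real.sin (2 * q * y) / (4 * y ^ 3))
      (q ^ 2 * Real.cos (2 * q * y)) q := fun q _ => by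
    have h1 : HasDerivAt (fun r : ℝ => 2 * r * y) (2 * y) q := by
      simpa using ((hasDerivAt_id q).const_mul 2).mul_const y
    refine ((((((hasDerivAt_id q).pow 2).mul h1.sin).div_const (2 * y)).add
      (((hasDerivAt_id q).mul h1.cos).div_const (2 * y ^ 2))).sub
      (h1.sin.div_const (4 * y ^ 3))).congr_deriv ?_
    simp only [id, Pi.pow_apply]
    field_simp
    ring
  rw [intervalIntegral.integral_eq_sub_of_hasDerivAt hd
    (Continuous.intervalIntegrable (by fun_prop) _ _)]
  have : 2 * -r * y = -(2 * r * y) := by ring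
  rw [this, Real.sin_neg, Real.cos_neg]
  field_simp
  ring

/-- The radial profile multiplying `k₁² cos(2 k₁ y)`. -/
def radialKernel (ψ : ℝ → ℝ) (Λ a r : ℝ) : ℝ := ψ (r / Λ) ^ 2 * a / (3 * r ^ 2 * (a + r))

lemma IsGlobalCutoff.abs_mul_radialKernel_le (hψ : IsGlobalCutoff ψ) (ha : 0 < a) {q r : ℝ}
    (hr : 0 < r) (hq : |q| ≤ r) : |q ^ 2 * Real.cos (2 * q * y) * radialKernel ψ Λ a r| ≤ 1 := by
  have h1 : q ^ 2 ≤ r ^ 2 := by rw [← sq_abs]; exact pow_le_pow_left₀ (abs_nonneg _) hq 2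
  have h0 : 0 ≤ radialKernel ψ Λ a r := by rw [radialKernel]; positivity
  rw [abs_mul, abs_mul, abs_of_nonneg (sq_nonneg q), abs_of_nonneg h0, radialKernel]
  have h2 := Real.abs_cos_le_one (2 * q * y)
  have h3 : ψ (r / Λ) ^ 2 ≤ 1 := pow_le_one₀ (hψ.nonneg _) (hψ.le_one _)
  calc _ ≤ r ^ 2 * 1 * (1 * a / (3 * r ^ 2 * (a + r))) := by gcongr
    _ = a / (3 * (a + r)) := by field_simp
    _ ≤ 1 := by rw [div_le_one (by positivity)]; linarith

lemma IsGlobalCutoff.radialKernel_eq_zero (hψ : IsGlobalCutoff ψ) (hΛ : 0 < Λ) {r : ℝ}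
    (hr : Λ < r) : radialKernel ψ Λ a r = 0 := by
  rw [radialKernel, hψ.eq_zero _ ((one_lt_div hΛ).2 hr)]
  simp

lemma IsGlobalCutoff.measurable_radialKernel (hψ : IsGlobalCutoff ψ) :
    Measurable (radialKernel ψ Λ a) := by
  have := hψ.contDiff.continuous.measurable
  unfold radialKernel
  fun_prop

lemma oscillatory_mul_eq {χ : ℝ → ℝ} (h : ∀ r, 0 < r → ψ r = χ r) (hΛ : 0 < Λ) (y a : ℝ)
    (k : R3) : oscillatory χ Λ y k * (a * ‖k‖ / (3 * (a + ‖k‖))) =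
      -(1 / Real.pi ^ 2) * (k 0 ^ 2 * Real.cos (2 * k 0 * y) * radialKernel ψ Λ a ‖k‖) := by
  rw [oscillatory_eq h hΛ, mul_assoc]
  congr 1
  rcases eq_or_ne k 0 with rfl | hk
  · simp
  have hk' : 0 < ‖k‖ := norm_pos_iff.2 hk
  rw [radialKernel]
  rcases eq_or_ne (a + ‖k‖) 0 with h0 | h0
  · simp [h0]
  · field_simp

/-- In the explicit inner integral two terms already carry `y⁻²`, and the weight bound suffices. The
third carries only `y⁻¹`; its second factor `y⁻¹` comes from the oscillation of `sin (2 r y)`. -/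
lemma IsGlobalCutoff.abs_integral_radialKernel_le (hψ : IsGlobalCutoff ψ) {M : ℝ}
    (hM0 : 0 ≤ M) (hM : ∀ r ∈ Icc (0 : ℝ) 2, |deriv ψ r| ≤ M) (hΛ : 0 < Λ) (ha : 0 < a)
    (hy : 0 < y) {s : ℝ} (hs : 0 < s) :
    |∫ r in Ioi (0 : ℝ), r * radialKernel ψ Λ a r * ∫ q in (-r)..r, q ^ 2 * Real.cos (2 * q * y)| ≤
      (M + 1) / y ^ 2 * (a + (a * Real.log (1 + 2 * Λ / s) + s)) := by
  have h2Λ : 0 < 2 * Λ := by positivity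
  set F : ℝ → ℝ := fun r => Real.cos (2 * r * y) / y ^ 2 - Real.sinc (2 * r * y) / y ^ 2
  have hF : Continuous F := by
    have := Real.continuous_sinc
    fun_prop
  have hFb : ∀ r, |F r| ≤ 2 / y ^ 2 := fun r => by
    have h1 := Real.abs_cos_le_one (2 * r * y)
    have h2 := Real.abs_sinc_le_one (2 * r * y)
    have h3 : F r = (Real.cos (2 * r * y) - Real.sinc (2 * r * y)) / y ^ 2 := by
      simp only [F]; ring
    rw [h3, abs_div, abs_of_pos (by positivity : 0 < y ^ 2)]
    gcongr
    exact (abs_sub _ _).trans (by linarith)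
  -- Here `r * radialKernel = radialWeight / r`, and `sin (2 r y)/(2 r y³) = sinc (2 r y)/y²` stays
  -- bounded at `r = 0`.
  have e1 : ∫ r in Ioi (0 : ℝ), r * radialKernel ψ Λ a r *
        ∫ q in (-r)..r, q ^ 2 * Real.cos (2 * q * y) =
      ∫ r in (0 : ℝ)..(2 * Λ), (y⁻¹ * (r * radialWeight ψ Λ a r * Real.sin (2 * r * y)) +
        radialWeight ψ Λ a r * F r) := by
    rw [intervalIntegral.integral_of_le h2Λ.le]
    refine (setIntegral_eq_of_subset_of_forall_sdiff_eq_zero measurableSet_Ioi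
      (fun r hr => hr.1) fun r hr => ?_).trans
      (setIntegral_congr_fun measurableSet_Ioc fun r hr => ?_)
    · have h1 : Λ < r := by
        by_contra h
        exact hr.2 ⟨hr.1, by linarith⟩
      rw [hψ.radialKernel_eq_zero hΛ h1]
      ring
    · have hr0 : 0 < r := hr.1
      simp only [F]
      rw [integral_sq_mul_cos hy, radialWeight, radialKernel,
        Real.sinc_of_ne_zero (by positivity)]
      field_simp
      ring
  have i1 : IntervalIntegrable (fun r => y⁻¹ * (r * radialWeight ψ Λ a r * Real.sin (2 * r * y)))
      volume 0 (2 * Λ) := by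
    refine ContinuousOn.intervalIntegrable_of_Icc h2Λ.le ?_
    have := hψ.continuousOn_radialWeight (Λ := Λ) (R := 2 * Λ) ha
    fun_prop
  have i2 : IntervalIntegrable (fun r => radialWeight ψ Λ a r * F r) volume 0 (2 * Λ) :=
    ContinuousOn.intervalIntegrable_of_Icc h2Λ.le
      ((hψ.continuousOn_radialWeight ha).mul hF.continuousOn)
  rw [e1, intervalIntegral.integral_add i1 i2, intervalIntegral.integral_const_mul]
  refine (abs_add_le _ _).trans ?_
  rw [abs_mul, abs_of_pos (inv_pos.2 hy)]
  have b1 := mul_le_mul_of_nonneg_left (hψ.abs_integral_mul_radialWeight_mul_sin_le hM0 hM hΛ ha hy)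
    (inv_pos.2 hy).le
  have b2 := hψ.abs_integral_radialWeight_mul_le (Λ := Λ) ha h2Λ hs hFb
  refine (add_le_add b1 b2).trans ?_
  have hl : 0 ≤ a * Real.log (1 + 2 * Λ / s) + s := by
    have : 0 ≤ Real.log (1 + 2 * Λ / s) := Real.log_nonneg (by
      have : 0 ≤ 2 * Λ / s := by positivity
      linarith)
    positivity
  have e2 : y⁻¹ * ((4 * M + 1) / (6 * y) * a) + 2 / y ^ 2 * ((a * Real.log (1 + 2 * Λ / s) + s) / 3) =
      1 / y ^ 2 * ((4 * M + 1) / 6 * a + 2 / 3 * (a * Real.log (1 + 2 * Λ / s) + s)) := by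
    field_simp
  have e3 : (M + 1) / y ^ 2 * (a + (a * Real.log (1 + 2 * Λ / s) + s)) =
      1 / y ^ 2 * ((M + 1) * a + (M + 1) * (a * Real.log (1 + 2 * Λ / s) + s)) := by
    ring
  rw [e2, e3]
  gcongr <;> linarith

lemma IsCutoff.exists_oscillatory_bound {χ : ℝ → ℝ} (hχ : IsCutoff χ) (hΛ : 0 < Λ) :
    ∃ C, 0 < C ∧ ∀ y a s : ℝ, 0 < y → 0 ≤ a → 0 < s →
      |∫ k : R3, oscillatory χ Λ y k * (a * ‖k‖ / (3 * (a + ‖k‖)))| ≤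
        C / y ^ 2 * (a + (a * Real.log (1 + 2 * Λ / s) + s)) := by
  obtain ⟨ψ, hψ, hχψ⟩ := hχ.exists_isGlobalCutoff
  obtain ⟨M, hM0, hM⟩ := hψ.exists_abs_deriv_le
  refine ⟨M + 1, by linarith, fun y a s hy ha hs => ?_⟩
  rcases ha.eq_or_lt with rfl | ha
  · simp only [zero_mul, zero_div, mul_zero, integral_zero, abs_zero, zero_add]
    positivity
  simp only [oscillatory_mul_eq hχψ hΛ]
  rw [integral_const_mul, integral_coord_radial (g := fun q => q ^ 2 * Real.cos (2 * q * y))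
    (by fun_prop) hψ.measurable_radialKernel
    (fun q r hr hq => hψ.abs_mul_radialKernel_le ha hr hq)
    (fun r hr => hψ.radialKernel_eq_zero hΛ hr), ← mul_assoc, abs_mul]
  -- The prefactor `-1/π²` of the integrand times the `2π` from the sphere has modulus `2/π`.
  have hpi : |-(1 / Real.pi ^ 2) * (2 * Real.pi)| ≤ 1 := by
    have h1 := Real.pi_gt_three
    have h2 : -(1 / Real.pi ^ 2) * (2 * Real.pi) = -(2 / Real.pi) := by field_simp
    rw [h2, abs_neg, abs_of_pos (by positivity), div_le_one (by positivity)]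
    linarith
  exact (mul_le_of_le_one_left (abs_nonneg _) hpi).trans
    (hψ.abs_integral_radialKernel_le hM0 hM hΛ ha hy hs)

end FixedSpectralParameter

/-! ### Integration over the spectral measures -/

section Oscillatory

variable {χ : ℝ → ℝ} {Λ : ℝ}

lemma IsCutoff.measurable_oscillatory (hχ : IsCutoff χ) (hΛ : 0 < Λ) (y : ℝ) :
    Measurable (oscillatory χ Λ y) := by
  obtain ⟨ψ, hψ, hχψ⟩ := hχ.exists_isGlobalCutoff
  have h1 := hψ.contDiff.continuous.measurable
  rw [funext (oscillatory_eq hχψ hΛ y)]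
  fun_prop

/-- The factor `|k|` of the dipole term absorbs the singularity `|k|⁻¹`. As `a/(3(a + |k|)) ≤ 1`,
the indicator of a ball dominates the integrand uniformly in `t`, which justifies Fubini. -/
lemma IsCutoff.abs_oscillatory_mul_norm_le (hχ : IsCutoff χ) (hΛ : 0 < Λ) (y : ℝ) (k : R3) :
    |oscillatory χ Λ y k| * ‖k‖ ≤ (Metric.closedBall (0 : R3) Λ).indicator (fun _ => 1) k := by
  obtain ⟨ψ, hψ, hχψ⟩ := hχ.exists_isGlobalCutoff
  rw [oscillatory_eq hχψ hΛ]
  by_cases hk : ‖k‖ ≤ Λ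
  · rw [indicator_of_mem (mem_closedBall_zero_iff.2 hk)]
    rcases eq_or_ne k 0 with rfl | hk0
    · simp
    have hk' : 0 < ‖k‖ := norm_pos_iff.2 hk0
    have h1 : k 0 ^ 2 ≤ ‖k‖ ^ 2 := by
      rw [← sq_abs]; exact pow_le_pow_left₀ (abs_nonneg _) (abs_coord_le_norm k 0) 2
    have h2 : ψ (‖k‖ / Λ) ^ 2 ≤ 1 := pow_le_one₀ (hψ.nonneg _) (hψ.le_one _)
    have h3 : 1 / Real.pi ^ 2 ≤ 1 := by
      have := Real.pi_gt_three
      rw [div_le_one (by positivity)]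
      nlinarith
    have h4 := Real.abs_cos_le_one (2 * k 0 * y)
    have h5 : 0 ≤ ψ (‖k‖ / Λ) ^ 2 * k 0 ^ 2 / ‖k‖ ^ 3 := by positivity
    rw [abs_mul, abs_mul, abs_neg, abs_of_nonneg h5,
      abs_of_pos (by positivity : 0 < 1 / Real.pi ^ 2)]
    calc 1 / Real.pi ^ 2 * (ψ (‖k‖ / Λ) ^ 2 * k 0 ^ 2 / ‖k‖ ^ 3 * |Real.cos (2 * k 0 * y)|) * ‖k‖
        ≤ 1 * (1 * ‖k‖ ^ 2 / ‖k‖ ^ 3 * 1) * ‖k‖ := by gcongr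
      _ = 1 := by field_simp
  · rw [indicator_of_notMem (by simpa using hk), hψ.eq_zero _ ((one_lt_div hΛ).2 (not_le.1 hk))]
    simp

lemma IsCutoff.integrable_oscillatory_mul (hχ : IsCutoff χ) (hΛ : 0 < Λ) (y : ℝ) {α : ℝ}
    (hα : 0 < α) (j : Fin 3) :
    Integrable (fun p : R3 × ℝ => oscillatory χ Λ y p.1 * ((p.2 - groundEnergy α) * ‖p.1‖ /
      (3 * (p.2 - groundEnergy α + ‖p.1‖)))) (volume.prod (dipoleMeasure α hα j)) := by
  have hb : Integrable (fun p : R3 × ℝ =>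
      (Metric.closedBall (0 : R3) Λ).indicator (fun _ => (1 : ℝ)) p.1 * 1)
      (volume.prod (dipoleMeasure α hα j)) :=
    Integrable.mul_prod (f := (Metric.closedBall (0 : R3) Λ).indicator fun _ => (1 : ℝ))
      (g := fun _ => (1 : ℝ)) ((integrable_indicator_iff measurableSet_closedBall).2
      (integrableOn_const measure_closedBall_lt_top.ne)) (integrable_const 1)
  have hm := hχ.measurable_oscillatory hΛ y
  refine hb.mono' (by fun_prop : Measurable _).aestronglyMeasurable ?_
  filter_upwards [Measure.quasiMeasurePreserving_snd.ae (dipoleMeasure_ae_ge hα j)] with p hp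
  rw [mul_one]
  refine le_trans ?_ (hχ.abs_oscillatory_mul_norm_le hΛ y p.1)
  rw [Real.norm_eq_abs, abs_mul]
  refine mul_le_mul_of_nonneg_left ?_ (abs_nonneg _)
  rw [abs_of_nonneg (by positivity)]
  refine div_le_of_le_mul₀ (by positivity) (by positivity) ?_
  nlinarith [mul_nonneg hp (norm_nonneg p.1), norm_nonneg p.1, sq_nonneg ‖p.1‖]

lemma oscillatory_mul_dipoleFactor (χ : ℝ → ℝ) (Λ y : ℝ) {α : ℝ} (hα : 0 < α) (k : R3) :
    oscillatory χ Λ y k * dipoleFactor α hα k =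
      ∑ j, ∫ t, oscillatory χ Λ y k * ((t - groundEnergy α) * ‖k‖ /
        (3 * (t - groundEnergy α + ‖k‖))) ∂(dipoleMeasure α hα j) := by
  simp only [integral_const_mul]
  rw [← Finset.mul_sum]
  rfl

lemma IsCutoff.integrable_oscillatory_mul_dipoleFactor (hχ : IsCutoff χ) (hΛ : 0 < Λ) (y : ℝ)
    {α : ℝ} (hα : 0 < α) :
    Integrable (fun k : R3 => oscillatory χ Λ y k * dipoleFactor α hα k) := by
  simp only [oscillatory_mul_dipoleFactor]
  exact integrable_finsetSum _ fun j _ =>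
    (hχ.integrable_oscillatory_mul hΛ y hα j).integral_prod_left

lemma IsCutoff.integral_oscillatory_mul_dipoleFactor (hχ : IsCutoff χ) (hΛ : 0 < Λ) (y : ℝ)
    {α : ℝ} (hα : 0 < α) :
    ∫ k : R3, oscillatory χ Λ y k * dipoleFactor α hα k =
      ∑ j, ∫ t, (∫ k : R3, oscillatory χ Λ y k * ((t - groundEnergy α) * ‖k‖ /
        (3 * (t - groundEnergy α + ‖k‖)))) ∂(dipoleMeasure α hα j) := by
  simp only [oscillatory_mul_dipoleFactor]
  rw [integral_finsetSum _ fun j _ =>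
    (hχ.integrable_oscillatory_mul hΛ y hα j).integral_prod_left]
  exact Finset.sum_congr rfl fun j _ =>
    integral_integral_swap (hχ.integrable_oscillatory_mul hΛ y hα j)

lemma IsCutoff.exists_integral_dipoleFactor_bound (hχ : IsCutoff χ) (hΛ : 0 < Λ) :
    ∃ C, 0 < C ∧ ∀ (α : ℝ) (hα : 0 < α) (y : ℝ), 0 < y →
      |∫ k : R3, oscillatory χ Λ y k * dipoleFactor α hα k| ≤
        C / y ^ 2 * (1 + Real.log (1 + 2 * Λ / α ^ 2)) := by
  obtain ⟨C, hC, hbound⟩ := hχ.exists_oscillatory_bound hΛ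
  -- The first moment contributes `13/2` and the mass `α² · 12/α² = 12`, in total less than `19`.
  refine ⟨19 * C, by positivity, fun α hα y hy => ?_⟩
  set ℓ := Real.log (1 + 2 * Λ / α ^ 2) with hℓ
  have hℓ0 : 0 ≤ ℓ := Real.log_nonneg (by
    have : 0 ≤ 2 * Λ / α ^ 2 := by positivity
    linarith)
  have hi : ∀ j, Integrable (fun t => C / y ^ 2 * ((1 + ℓ) * (t - groundEnergy α) + α ^ 2))
      (dipoleMeasure α hα j) := fun j =>
    (((integrable_dipoleMeasure hα j).const_mul _).add (integrable_const _)).const_mul _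
  have h1 : ∀ j, |∫ t, (∫ k : R3, oscillatory χ Λ y k * ((t - groundEnergy α) * ‖k‖ /
      (3 * (t - groundEnergy α + ‖k‖)))) ∂(dipoleMeasure α hα j)| ≤
      C / y ^ 2 * ((1 + ℓ) * ∫ t, (t - groundEnergy α) ∂(dipoleMeasure α hα j) +
        α ^ 2 * (dipoleMeasure α hα j).real univ) := fun j => by
    have e : ∫ t, C / y ^ 2 * ((1 + ℓ) * (t - groundEnergy α) + α ^ 2) ∂(dipoleMeasure α hα j) =
        C / y ^ 2 * ((1 + ℓ) * ∫ t, (t - groundEnergy α) ∂(dipoleMeasure α hα j) +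
        α ^ 2 * (dipoleMeasure α hα j).real univ) := by
      rw [integral_const_mul, integral_add ((integrable_dipoleMeasure hα j).const_mul _)
        (integrable_const _), integral_const_mul, integral_const, smul_eq_mul,
        mul_comm (α ^ 2)]
    rw [← e, ← Real.norm_eq_abs]
    refine norm_integral_le_of_norm_le (hi j) ?_
    filter_upwards [dipoleMeasure_ae_ge hα j] with t ht
    -- The scale `s = α²` is that of the atomic energies; it balances the mass `12/α²`.
    refine (hbound y _ (α ^ 2) hy ht (by positivity)).trans (le_of_eq ?_)
    rw [← hℓ]
    ring
  rw [hχ.integral_oscillatory_mul_dipoleFactor hΛ]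
  refine (Finset.abs_sum_le_sum_abs _ _).trans ((Finset.sum_le_sum fun j _ => h1 j).trans ?_)
  rw [← Finset.mul_sum, Finset.sum_add_distrib, ← Finset.mul_sum, ← Finset.mul_sum,
    sum_dipoleMeasure_univ]
  have h2 := mul_le_mul_of_nonneg_left (sum_integral_dipoleMeasure_le hα)
    (by linarith : 0 ≤ 1 + ℓ)
  have h3 : α ^ 2 * (12 / α ^ 2) = 12 := by field_simp
  rw [h3]
  calc _ ≤ C / y ^ 2 * (19 * (1 + ℓ)) := by gcongr; linarith
    _ = _ := by ring

end Oscillatory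

/-! ### The coefficient of `α / L⁴` -/

lemma dipoleMeasure_arctan_bounds (l : ℝ) (hl : 0 < l) (j : Fin 3) :
    0 ≤ ∫ t, Real.arctan (l * (t - groundEnergy 1)) ∂(dipoleMeasure 1 one_pos j) ∧
      ∫ t, Real.arctan (l * (t - groundEnergy 1)) ∂(dipoleMeasure 1 one_pos j) ≤
        l * ∫ t, (t - groundEnergy 1) ∂(dipoleMeasure 1 one_pos j) := by
  have h0 := dipoleMeasure_ae_ge one_pos j
  refine ⟨integral_nonneg_of_ae ?_, ?_⟩
  · filter_upwards [h0] with t ht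
    exact Real.arctan_nonneg.2 (by positivity)
  · rw [← integral_const_mul]
    refine integral_mono_of_nonneg ?_ ((integrable_dipoleMeasure one_pos j).const_mul l) ?_
    · filter_upwards [h0] with t ht
      exact Real.arctan_nonneg.2 (by positivity)
    · filter_upwards [h0] with t ht
      have h1 := Real.le_tan (Real.arctan_nonneg.2 (mul_nonneg hl.le ht))
        (Real.arctan_lt_pi_div_two _)
      rwa [Real.tan_arctan] at h1

/-- The mass is `12` at `α = 1`, and `(6π)⁻¹ · (π/2) · 12 = 1`, so the leading part of `ℵ` is
exactly `α L`. -/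
lemma aleph_eq {α L : ℝ} (hl : 0 < α * L) :
    aleph α L = α * L - α * L / (6 * Real.pi) *
      ∑ j, ∫ t, Real.arctan (α * L * (t - groundEnergy 1)) ∂(dipoleMeasure 1 one_pos j) := by
  have h1 : ∀ j, expectation (hydrogen 1)
      (fun t => α * L * Real.arctan (1 / (α * L * (t - groundEnergy 1))))
        (positionGroundState 1 one_pos j) =
      α * L * (Real.pi / 2 * (dipoleMeasure 1 one_pos j).real univ -
        ∫ t, Real.arctan (α * L * (t - groundEnergy 1)) ∂(dipoleMeasure 1 one_pos j)) := fun j => by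
    have hi : Integrable (fun t => Real.arctan (α * L * (t - groundEnergy 1)))
        (dipoleMeasure 1 one_pos j) := by
      refine (integrable_const (Real.pi / 2)).mono' (by fun_prop) (Eventually.of_forall fun t => ?_)
      exact abs_le.2 ⟨(Real.neg_pi_div_two_lt_arctan _).le, (Real.arctan_lt_pi_div_two _).le⟩
    rw [expectation, integral_const_mul, mul_comm (Real.pi / 2), ← smul_eq_mul _ (Real.pi / 2),
      ← integral_const, ← integral_sub (integrable_const _) hi]
    congr 1
    refine integral_congr_ae ?_
    filter_upwards [dipoleMeasure_one_ae_pos j] with t ht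
    rw [one_div, Real.arctan_inv_of_pos (mul_pos hl ht)]
  rw [aleph, dipoleExpectation, Finset.sum_congr rfl fun j _ => h1 j, ← Finset.mul_sum,
    Finset.sum_sub_distrib, ← Finset.mul_sum, sum_dipoleMeasure_univ]
  have := Real.pi_pos
  field_simp
  ring

/-- After the exact cancellation of `α²/L³`, only the `arctan` expectation `S ≤ (13/2) α L` remains,
and `13/2 ≤ 6π`. -/
lemma abs_main_term_le {α L : ℝ} (hα : 0 < α) (hL : 1 < L) :
    |α ^ 2 / L ^ 3 - aleph α L * (α / L ^ 4)| ≤ α ^ 3 / L ^ 2 := by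
  have hL0 : 0 < L := by linarith
  have hl : 0 < α * L := by positivity
  set S := ∑ j, ∫ t, Real.arctan (α * L * (t - groundEnergy 1)) ∂(dipoleMeasure 1 one_pos j) with hS
  have hS0 : 0 ≤ S := Finset.sum_nonneg fun j _ => (dipoleMeasure_arctan_bounds _ hl j).1
  have hS1 : S ≤ α * L * (13 / 2) := by
    refine (Finset.sum_le_sum fun j _ => (dipoleMeasure_arctan_bounds _ hl j).2).trans ?_
    rw [← Finset.mul_sum]
    exact mul_le_mul_of_nonneg_left (sum_integral_dipoleMeasure_le one_pos) hl.le
  have hpi := Real.pi_gt_three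
  have h1 : α ^ 2 / L ^ 3 - aleph α L * (α / L ^ 4) = α ^ 2 / L ^ 3 * (S / (6 * Real.pi)) := by
    rw [aleph_eq hl, ← hS]
    field_simp
    ring
  have h2 : S / (6 * Real.pi) ≤ α * L := by
    rw [div_le_iff₀ (by positivity)]
    refine hS1.trans (mul_le_mul_of_nonneg_left (by linarith) hl.le)
  rw [h1, abs_of_nonneg (by positivity)]
  calc α ^ 2 / L ^ 3 * (S / (6 * Real.pi)) ≤ α ^ 2 / L ^ 3 * (α * L) := by gcongr
    _ = _ := by field_simp

/-- The restriction `α ≤ 1/2` makes `log α⁻¹ ≥ log 2 ≥ 1/2`, so constants can be absorbed into the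
logarithm. -/
lemma one_add_log_le {α Λ : ℝ} (hα : 0 < α) (hα' : α ≤ 1 / 2) (hΛ : 0 < Λ) :
    1 ≤ 2 * Real.log α⁻¹ ∧
      1 + Real.log (1 + 2 * Λ / α ^ 2) ≤ (4 + 2 * Real.log (1 + 2 * Λ)) * Real.log α⁻¹ := by
  have h1 : 1 ≤ 2 * Real.log α⁻¹ := by
    have h2 : (2 : ℝ) ≤ α⁻¹ := by rw [le_inv_comm₀ (by norm_num) hα]; linarith
    have h3 := Real.log_le_log (by norm_num) h2
    have := Real.log_two_gt_d9
    linarith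
  refine ⟨h1, ?_⟩
  have h4 : 1 + 2 * Λ / α ^ 2 ≤ (1 + 2 * Λ) * α⁻¹ ^ 2 := by
    have h5 : α ^ 2 ≤ 1 := pow_le_one₀ hα.le (by linarith)
    rw [inv_pow, ← div_eq_mul_inv, le_div_iff₀ (by positivity), add_mul,
      div_mul_cancel₀ _ (by positivity)]
    linarith
  have h6 := Real.log_le_log (by positivity) h4
  rw [Real.log_mul (by positivity) (by positivity), Real.log_pow] at h6
  have h7 : 0 ≤ Real.log (1 + 2 * Λ) := Real.log_nonneg (by linarith)
  push_cast at h6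
  nlinarith

end CasimirPolder

end

/-! ### Conclusion: both bounds combined by the triangle inequality. -/

theorem propositionB2 (χ : ℝ → ℝ) (hχ : CasimirPolder.IsCutoff χ) (Λ : ℝ) (hΛ : 0 < Λ) :
    ∃ α₀ : ℝ, 0 < α₀ ∧ α₀ < 1 ∧ ∃ C : ℝ, 0 < C ∧
      ∀ (α : ℝ) (hα : 0 < α), α ≤ α₀ → ∀ L : ℝ, 1 < L →
        Integrable (fun k : CasimirPolder.R3 =>
          CasimirPolder.oscillatory χ Λ (L / α) k * CasimirPolder.dipoleFactor α hα k) ∧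
        |α * (∫ k : CasimirPolder.R3,
            CasimirPolder.oscillatory χ Λ (L / α) k * CasimirPolder.dipoleFactor α hα k) -
          (α ^ 2 / L ^ 3 - CasimirPolder.aleph α L * (α / L ^ 4))| ≤
          C * (α ^ 3 / L ^ 2 * Real.log α⁻¹) := by
  obtain ⟨C, hC, hbound⟩ := hχ.exists_integral_dipoleFactor_bound hΛ
  have hlog : 0 ≤ Real.log (1 + 2 * Λ) := Real.log_nonneg (by linarith)
  -- The first summand of the constant bounds the integral; the `2` turns the bound `α³/L²` of the
  -- main term into one with the logarithm.
  refine ⟨1 / 2, by norm_num, by norm_num, C * (4 + 2 * Real.log (1 + 2 * Λ)) + 2, by positivity,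
    fun α hα hα' L hL => ⟨hχ.integrable_oscillatory_mul_dipoleFactor hΛ _ hα, ?_⟩⟩
  have hL0 : 0 < L := by linarith
  obtain ⟨h1, h2⟩ := CasimirPolder.one_add_log_le hα hα' hΛ
  have h3 := hbound α hα (L / α) (by positivity)
  have h4 := CasimirPolder.abs_main_term_le hα hL
  set I := ∫ k : CasimirPolder.R3,
    CasimirPolder.oscillatory χ Λ (L / α) k * CasimirPolder.dipoleFactor α hα k
  have h5 : |α * I| ≤ C * (4 + 2 * Real.log (1 + 2 * Λ)) * (α ^ 3 / L ^ 2 * Real.log α⁻¹) := by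
    rw [abs_mul, abs_of_pos hα]
    calc α * |I| ≤ α * (C / (L / α) ^ 2 * ((4 + 2 * Real.log (1 + 2 * Λ)) * Real.log α⁻¹)) := by
          refine mul_le_mul_of_nonneg_left (h3.trans ?_) hα.le
          exact mul_le_mul_of_nonneg_left h2 (by positivity)
      _ = _ := by field_simp
  have h6 : α ^ 3 / L ^ 2 ≤ 2 * (α ^ 3 / L ^ 2 * Real.log α⁻¹) := by
    have := mul_le_mul_of_nonneg_left h1 (by positivity : 0 ≤ α ^ 3 / L ^ 2)
    linarith
  refine (abs_sub _ _).trans ((add_le_add h5 (h4.trans h6)).trans (le_of_eq ?_))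
  ring
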